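/- **Setting.** Let $\mathbb{DH}=\mathbb R[\epsilon]\otimes_{\mathbb R}\mathbb H$ ($\epsilon^2=0$) be the algebra of dual quaternions and $\mathbb{DH}_{\mathbb C}$ its complexification. An oriented line in $\mathbb R^3$ is a dual quaternion $h=p+\epsilon m$ with $h^2=-1$; $p$ is its unit direction, and its points are the $x$ with $p\times x=m$. Let $L=(h_1,\dots,h_6)$ be a closed 6R linkage (lines with $h_i\neq\pm h_{i+1}$, indices modulo 6) such that $h_i,h_{i+1}$ are never parallel and, for every $i$, the ordered products of subsets of $\{h_i,h_{i+1},h_{i+2}\}$ span a real vector space of dimension 8. Its configuration set is $$K=\{(t_1,\dots,t_6)\in\mathbb P^1(\mathbb R)^6 : (t_1-h_1)\cdots(t_6-h_6)\in\mathbb R^*\}.$$ **Bonds.** Suppose $\dim K=1$, and let $N(K)$ be the normalization of the one-dimensional part of the Zariski closure of $K$ in $\mathbb P^1(\mathbb C)^6$. A bond is a point $\beta\in N(K)$ at which $(t_1-h_1)\cdots(t_6-h_6)$ vanishes. Let $v_\beta(i,j)$ be the vanishing order at $\beta$ of $(t_{i+1}-h_{i+1})\cdots(t_j-h_j)$ (each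 factor being scaled so as to be finite and nonzero at $\beta$). The bond connects $h_i$ and $h_j$ if its connection number $k_\beta(i,j)=v_\beta(i,j-1)+v_\beta(i-1,j)-v_\beta(i,j)-v_\beta(i-1,j-1)$ is nonzero; this number is its multiplicity. **Quad polynomials.** For $k\in\{1,\dots,6\}$ let $g$ generate, as a module over the complex dual numbers, the set of all $q\in(\mathrm i-h_k)\mathbb{DH}_{\mathbb C}$ with $q(\mathrm i-h_{k+3})=0$; take $g=(\mathrm i-h_k)(\mathrm i+h_{k+3})$ if $h_k$ and $h_{k+3}$ are not parallel. The quad polynomial $Q_{h_k,h_{k+1},h_{k+2},h_{k+3}}\in\mathbb C[x]$ is the monic generator of the ideal obtained by eliminating $y\in\mathbb C$ and $(t,t')\in\mathbb P^1\times\mathbb P^1$ from $$(\mathrm i-h_k)(t-h_{k+1})(t'-h_{k+2})(\mathrm i-h_{k+3})=0,\qquad (\mathrm i-h_k)(t-h_{k+1})(t'-h_{k+2})=y(1+x\epsilon)g .$$ Define $Q_{h_{k+3},h_{k+4},h_{k+5},h_k}$ in the same way, with $g$ replaced by its quaternion conjugate $\overline g$. Let $w_k$ be the arithmetic mean of all roots,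 with multiplicity, of these two polynomials. Put $Q_k^+(x)=Q_{h_k,h_{k+1},h_{k+2},h_{k+3}}(x+w_k)$, and let $Q_k^-$ be the polynomial $Q_k^+$ of the linkage $(-h_1,h_2,-h_3,h_4,-h_5,h_6)$. **Parameters.** If $u+v\epsilon$ is the scalar part of $h_kh_{k+1}$, put $c_k=-u$, $b_k=-v/(1-u^2)$ and $f_k=b_kc_k$. Let $s_k$ be the signed distance, along the oriented line $h_k$, from the foot of the common normal of $h_{k-1},h_k$ to the foot of the common normal of $h_k,h_{k+1}$. **Theorem.** Let $k\in\{1,\dots,6\}$. 1. If $\dim K=1$, then the number of bonds connecting $h_k$ and $h_{k+3}$ with $t_k=t_{k+3}=+\mathrm i$, counted with multiplicity, is finite and at most $\deg\gcd(Q_k^+,Q_{k+3}^+)$, and the number of those with $t_k=+\mathrm i$, $t_{k+3}=-\mathrm i$, counted with multiplicity, is finite and at most $\deg\gcd(Q_k^-,Q_{k+3}^-)$. 2. $Q_k^+$ and $Q_k^-$ are invariant under motion: they do not change when the lines are moved according to any configuration $(r_1,\dots,r_6)\in K$, with any link as the fixed base. 3. We have $$\begin{aligned}Q_k^+(x)={}&\Bigl(x+\tfrac{f_k-f_{k+2}-f_{k+3}+f_{k+5}}{4}+\mathrm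 i\,\tfrac{s_{k+3}-s_k}{4}\Bigr)^2+\tfrac{s_{k+1}^2+s_{k+2}^2+b_{k+1}^2-f_{k+1}^2-b_k^2-b_{k+2}^2}{4}\\&-\tfrac{c_{k+1}}{2}\,(b_kb_{k+2}-s_{k+1}s_{k+2})-\tfrac{\mathrm i}{2}\bigl(s_{k+1}(b_k+b_{k+2}c_{k+1})+s_{k+2}(b_{k+2}+b_kc_{k+1})\bigr),\end{aligned}$$ and $Q_k^-$ is obtained from this by replacing all $b_j,c_j$ by $-b_j,-c_j$ and all $s_j$ by $(-1)^js_j$. -/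

import Mathlib

open scoped Matrix

noncomputable section

namespace Linkage

/-! ### Dual quaternions -/

/-- The dual quaternions `R[ε] ⊗ ℍ` over a commutative ring `R`. -/
abbrev DQ (R : Type*) [CommRing R] : Type _ := Quaternion (DualNumber R)

section DQ

variable {R S : Type*} [CommRing R] [CommRing S]

/-- The scalar `a : R` as a dual quaternion. -/
def scalar (a : R) : DQ R := ((TrivSqZeroExt.inl a : DualNumber R) : DQ R)

/-- The dual unit `ε` as a dual quaternion. -/
def eps : DQ R := ((DualNumber.eps : DualNumber R) : DQ R)

/-- The eight coordinates of a dual quaternion (primal part first, then dual part). -/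
def coord (q : DQ R) : Fin 8 → R :=
  ![q.re.fst, q.imI.fst, q.imJ.fst, q.imK.fst, q.re.snd, q.imI.snd, q.imJ.snd, q.imK.snd]

/-- Coordinatewise change of the base ring of a dual number. -/
def mapDual (f : R →+* S) (d : DualNumber R) : DualNumber S :=
  TrivSqZeroExt.inl (f d.fst) + TrivSqZeroExt.inr (f d.snd)

/-- Coordinatewise change of the base ring of a dual quaternion. -/
def mapDQ (f : R →+* S) (q : DQ R) : DQ S :=
  ⟨mapDual f q.re, mapDual f q.imI, mapDual f q.imJ, mapDual f q.imK⟩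

end DQ

/-- Ordered product `x a * x (a + 1) * ⋯ * x (a + m - 1)` of `m` cyclically consecutive factors. -/
def chain {M : Type*} [Monoid M] (x : ZMod 6 → M) (a : ZMod 6) (m : ℕ) : M :=
  ((List.range m).map fun l : ℕ => x (a + (l : ZMod 6))).prod

/-! ### Lines and linkages -/

/-- Primal vector part: the unit direction vector of the oriented line `h`. -/
def dir (h : DQ ℝ) : Fin 3 → ℝ := ![h.imI.fst, h.imJ.fst, h.imK.fst]

/-- Dual vector part: the moment of the oriented line `h`.  The line with direction `p` and
moment `m` is the set of all points `x` with `p × x = m`. -/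
def moment (h : DQ ℝ) : Fin 3 → ℝ := ![h.imI.snd, h.imJ.snd, h.imK.snd]

/-- Two lines are parallel (equally or oppositely oriented). -/
def Parallel (h h' : DQ ℝ) : Prop := dir h = dir h' ∨ dir h = -dir h'

/-- A closed 6R linkage `(h₁, …, h₆)`, indexed cyclically: six lines, given by dual quaternions
of square `-1`, such that cyclically consecutive lines are different. -/
structure IsLinkage (h : ZMod 6 → DQ ℝ) : Prop where
  sq_eq : ∀ i, h i * h i = -1
  ne : ∀ i, h i ≠ h (i + 1)
  ne_neg : ∀ i, h i ≠ -h (i + 1)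

/-- The coupling space of three lines: the real span of all their ordered products. -/
def couplingSpace (h₁ h₂ h₃ : DQ ℝ) : Submodule ℝ (DQ ℝ) :=
  Submodule.span ℝ
    {1, h₁, h₂, h₃, h₁ * h₂, h₁ * h₃, h₂ * h₃, h₁ * h₂ * h₃}

/-! ### Configurations and motions -/

/-- The rotation `t - h` with parameter `t ∈ ℙ¹(ℝ) = ℝ ∪ {∞}` (the identity for `t = ∞`). -/
def rot (h : DQ ℝ) : OnePoint ℝ → DQ ℝ
  | none => 1
  | some t => scalar t - h

/-- The configuration set: all `(t₁, …, t₆)` with `(t₁ - h₁) ⋯ (t₆ - h₆) ∈ ℝ*`. -/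
def configSet (h : ZMod 6 → DQ ℝ) : Set (ZMod 6 → OnePoint ℝ) :=
  {t | ∃ a : ℝ, a ≠ 0 ∧ chain (fun i => rot (h i) (t i)) 1 6 = scalar a}

/-- The linkage `h` moved by the configuration `r`, the link joining `h b` and `h (b + 1)` being
fixed: `h' i = g * h i * g⁻¹` with `g = (r_{b+1} - h_{b+1}) ⋯ (r_{i-1} - h_{i-1})`. -/
def moved (h : ZMod 6 → DQ ℝ) (r : ZMod 6 → OnePoint ℝ) (b : ZMod 6) : ZMod 6 → DQ ℝ :=
  fun i =>
    let g := chain (fun j => rot (h j) (r j)) (b + 1) (i - (b + 1)).val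
    g * h i * Ring.inverse g

/-! ### The complex configuration curve and its bonds

On `ℙ¹(ℂ)` we use the coordinate `z = (t - i) / (t + i)`.  It is finite and nonzero on all of
`ℙ¹(ℝ)`, so that every component of the Zariski closure of the configuration set in `ℙ¹(ℂ)⁶`
meets the affine chart with coordinates `z₁, …, z₆`.  The values `t = i, -i, ∞` correspond to
`z = 0, ∞, 1`. -/

/-- The coordinate `z = (t - i) / (t + i)` of a real parameter `t ∈ ℙ¹(ℝ)`. -/
def zCoord : OnePoint ℝ → ℂ
  | none => 1
  | some t => ((t : ℂ) - Complex.I) / ((t : ℂ) + Complex.I)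

/-- The ideal, in the coordinates `z₁, …, z₆`, of the complex Zariski closure of the
configuration set. -/
def configIdeal (h : ZMod 6 → DQ ℝ) : Ideal (MvPolynomial (ZMod 6) ℂ) :=
  MvPolynomial.vanishingIdeal ℂ ((fun t i => zCoord (t i)) '' configSet h)

/-- The mobility: the dimension of the configuration set. -/
def mobility (h : ZMod 6 → DQ ℝ) : WithBot ℕ∞ :=
  ringKrullDim (MvPolynomial (ZMod 6) ℂ ⧸ configIdeal h)

/-- A point of the normalization of the complex configuration curve (for mobility one): a
normalized discrete valuation, trivial on `ℂ`, of the function field of one of the irreducible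
components of the curve.  It is given by its restriction to polynomials in `z₁, …, z₆`,
which takes the value `⊤` exactly on the ideal of the component. -/
structure CurvePoint (h : ZMod 6 → DQ ℝ) where
  v : AddValuation (MvPolynomial (ZMod 6) ℂ) (WithTop ℤ)
  on_curve : ∀ f ∈ configIdeal h, v f = ⊤
  trivial_on_const : ∀ a : ℂ, a ≠ 0 → v (MvPolynomial.C a) = 0
  normalized : ∃ f g, v g ≠ ⊤ ∧ v f = v g + 1

namespace CurvePoint

variable {h : ZMod 6 → DQ ℝ}

/-- `t_j = +i` at the point. -/
def IsPlusI (p : CurvePoint h) (j : ZMod 6) : Prop := 0 < p.v (MvPolynomial.X j)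

/-- `t_j = -i` at the point. -/
def IsMinusI (p : CurvePoint h) (j : ZMod 6) : Prop := p.v (MvPolynomial.X j) < 0

end CurvePoint

/-- The factor `t_j - h_j` up to a scalar: `(1 - z)(t - h) = (i - h) + z (i + h)`. -/
def rotFactor (h : ZMod 6 → DQ ℝ) (j : ZMod 6) : DQ (MvPolynomial (ZMod 6) ℂ) :=
  let hc : DQ (MvPolynomial (ZMod 6) ℂ) := mapDQ (algebraMap ℝ (MvPolynomial (ZMod 6) ℂ)) (h j)
  let i : DQ (MvPolynomial (ZMod 6) ℂ) := scalar (MvPolynomial.C Complex.I)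
  (i - hc) + scalar (MvPolynomial.X j) * (i + hc)

namespace CurvePoint

variable {h : ZMod 6 → DQ ℝ}

/-- The vanishing order at the point `p` of the product of the `m` factors
`(t_a - h_a) (t_{a+1} - h_{a+1}) ⋯`, where each factor is scaled to be finite and nonzero at `p`:
`(i - h) + z (i + h)` is divided by `z` at the poles of `z`. -/
def vanishingOrder (p : CurvePoint h) (a : ZMod 6) (m : ℕ) : ℤ :=
  (Finset.univ.inf fun c : Fin 8 => p.v (coord (chain (rotFactor h) a m) c)).untopD 0
    - ∑ l ∈ Finset.range m, (min (p.v (MvPolynomial.X (a + (l : ZMod 6)))) 0).untopD 0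

/-- A bond: a point of the normalized curve where `(t₁ - h₁) ⋯ (t₆ - h₆)` vanishes. -/
def IsBond (p : CurvePoint h) : Prop := 0 < p.vanishingOrder 1 6

/-- The connection number of the joints `i` and `j = i + d`.  With `v(a,b)` the vanishing order
of `(t_{a+1} - h_{a+1}) ⋯ (t_b - h_b)`, it is `v(i,j-1) + v(i-1,j) - v(i,j) - v(i-1,j-1)`. -/
def connectionNumber (p : CurvePoint h) (i : ZMod 6) (d : ℕ) : ℤ :=
  p.vanishingOrder (i + 1) (d - 1) + p.vanishingOrder i (d + 1)
    - p.vanishingOrder (i + 1) d - p.vanishingOrder i d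

end CurvePoint

/-- The bonds connecting `h_k` and `h_{k+3}` with `t_k = +i` and `t_{k+3} = +i`. -/
def bondsPlus (h : ZMod 6 → DQ ℝ) (k : ZMod 6) : Set (CurvePoint h) :=
  {p | p.IsBond ∧ p.connectionNumber k 3 ≠ 0 ∧ p.IsPlusI k ∧ p.IsPlusI (k + 3)}

/-- The bonds connecting `h_k` and `h_{k+3}` with `t_k = +i` and `t_{k+3} = -i`. -/
def bondsMinus (h : ZMod 6 → DQ ℝ) (k : ZMod 6) : Set (CurvePoint h) :=
  {p | p.IsBond ∧ p.connectionNumber k 3 ≠ 0 ∧ p.IsPlusI k ∧ p.IsMinusI (k + 3)}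

/-! ### Quad polynomials -/

/-- `i - h` over the complex numbers. -/
def iSub (h : DQ ℝ) : DQ ℂ := scalar Complex.I - mapDQ (algebraMap ℝ ℂ) h

/-- `i + h` over the complex numbers. -/
def iAdd (h : DQ ℝ) : DQ ℂ := scalar Complex.I + mapDQ (algebraMap ℝ ℂ) h

/-- `g` generates, over the complex dual numbers, the intersection of the right ideal of
`i - h₁` with the left annihilator of `i - h₄`. -/
def IsLineGenerator (h₁ h₄ : DQ ℝ) (g : DQ ℂ) : Prop :=
  ∀ q : DQ ℂ, ((∃ a : DQ ℂ, q = iSub h₁ * a) ∧ q * iSub h₄ = 0) ↔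
    ∃ d : DualNumber ℂ, q = (d : DQ ℂ) * g

open Classical in
/-- The generator `(i - h₁)(i + h₄)` if `h₁` and `h₄` are not parallel, some generator
otherwise. -/
def lineGenerator (h₁ h₄ : DQ ℝ) : DQ ℂ :=
  if Parallel h₁ h₄ then Classical.epsilon (IsLineGenerator h₁ h₄) else iSub h₁ * iAdd h₄

/-- The polynomial ring `ℂ[x, y, t₂, t₃]`, with variables `0, 1, 2, 3`. -/
abbrev ElimRing : Type := MvPolynomial (Fin 4) ℂ

/-- A rotation about `h` in one of the two standard charts of `ℙ¹`, with the variable number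
`j` as coordinate: `t - h`, or `1 - s h` with `s = 1 / t`. -/
def chartRot (h : DQ ℝ) (j : Fin 4) (atInfinity : Bool) : DQ ElimRing :=
  let hc : DQ ElimRing := mapDQ (algebraMap ℝ ElimRing) h
  let t : DQ ElimRing := scalar (MvPolynomial.X j)
  if atInfinity then 1 - t * hc else t - hc

/-- The ideal, in one of the four charts of `(t₂, t₃) ∈ ℙ¹ × ℙ¹`, generated by the coordinates of
`(i - h₁)(t₂ - h₂)(t₃ - h₃)(i - h₄)` and of `(i - h₁)(t₂ - h₂)(t₃ - h₃) - y (1 + x ε) g`. -/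
def quadIdeal (g : DQ ℂ) (h₁ h₂ h₃ h₄ : DQ ℝ) (c₂ c₃ : Bool) : Ideal ElimRing :=
  let C : ℂ →+* ElimRing := MvPolynomial.C
  let q : DQ ElimRing := mapDQ C (iSub h₁) * chartRot h₂ 2 c₂ * chartRot h₃ 3 c₃
  let x : DQ ElimRing := scalar (MvPolynomial.X 0)
  let y : DQ ElimRing := scalar (MvPolynomial.X 1)
  Ideal.span (Set.range (coord (q * mapDQ C (iSub h₄))) ∪
    Set.range (coord (q - y * (1 + x * eps) * mapDQ C g)))

/-- The ideal of all polynomials in `x` alone that lie in the ideal above in every chart. -/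
def quadElim (g : DQ ℂ) (h₁ h₂ h₃ h₄ : DQ ℝ) : Ideal (Polynomial ℂ) :=
  ⨅ (c₂ : Bool) (c₃ : Bool),
    (quadIdeal g h₁ h₂ h₃ h₄ c₂ c₃).comap
      (Polynomial.aeval (MvPolynomial.X 0 : ElimRing)).toRingHom

/-- The quad polynomial (relative to the generator `g`): the monic generator of the elimination
ideal. -/
def quadPoly (g : DQ ℂ) (h₁ h₂ h₃ h₄ : DQ ℝ) : Polynomial ℂ :=
  normalize (Submodule.IsPrincipal.generator (quadElim g h₁ h₂ h₃ h₄))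

/-- The arithmetic mean of all roots (with multiplicity) of two polynomials. -/
def meanRoot (P Q : Polynomial ℂ) : ℂ :=
  (P.roots + Q.roots).sum / (Multiset.card (P.roots + Q.roots) : ℂ)

/-- The invariant quad polynomial `Q_k⁺(x) = Q(x + w)`, where `Q` is the quad polynomial of
`h_k, h_{k+1}, h_{k+2}, h_{k+3}` and `w` is the mean of all roots of `Q` and of the quad
polynomial of `h_{k+3}, h_{k+4}, h_{k+5}, h_k`.  The latter is taken relative to the conjugate
generator; the conjugate of `(i - h_k)(i + h_{k+3})` is `(i - h_{k+3})(i + h_k)`. -/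
def invQuadPlus (h : ZMod 6 → DQ ℝ) (k : ZMod 6) : Polynomial ℂ :=
  let g := lineGenerator (h k) (h (k + 3))
  let Q := quadPoly g (h k) (h (k + 1)) (h (k + 2)) (h (k + 3))
  let Q' := quadPoly (star g) (h (k + 3)) (h (k + 4)) (h (k + 5)) (h k)
  Q.comp (Polynomial.X + Polynomial.C (meanRoot Q Q'))

/-- The linkage `(-h₁, h₂, -h₃, h₄, -h₅, h₆)`. -/
def flipOdd (h : ZMod 6 → DQ ℝ) : ZMod 6 → DQ ℝ := fun i => (-1) ^ i.val * h i

/-- The invariant quad polynomial `Q_k⁻`. -/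
def invQuadMinus (h : ZMod 6 → DQ ℝ) (k : ZMod 6) : Polynomial ℂ := invQuadPlus (flipOdd h) k

/-! ### Denavit–Hartenberg parameters -/

/-- `c_k`: the cosine of the angle between `h_k` and `h_{k+1}`, i.e. `-u` if `u + v ε` is the
scalar part of `h_k h_{k+1}`. -/
def paramC (h : ZMod 6 → DQ ℝ) (k : ZMod 6) : ℝ := -(h k * h (k + 1)).re.fst

/-- `b_k`: the Bennett ratio (distance divided by the sine of the angle, with sign) of `h_k` and
`h_{k+1}`, i.e. `-v / (1 - u²)` if `u + v ε` is the scalar part of `h_k h_{k+1}`. -/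
def paramB (h : ZMod 6 → DQ ℝ) (k : ZMod 6) : ℝ :=
  -(h k * h (k + 1)).re.snd / (1 - (h k * h (k + 1)).re.fst ^ 2)

/-- The point of the line `h` closest to the origin. -/
def basePoint (h : DQ ℝ) : Fin 3 → ℝ := moment h ⨯₃ dir h

/-- The position on the line `h`, measured from `basePoint h` in the direction `dir h`, of the
foot of the common normal of `h` and the non-parallel line `h'`. -/
def footParam (h h' : DQ ℝ) : ℝ :=
  let w := basePoint h' - basePoint h
  let c := dir h ⬝ᵥ dir h'
  (w ⬝ᵥ dir h - c * (w ⬝ᵥ dir h')) / (1 - c ^ 2)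

/-- The foot on `h` of the common normal of `h` and `h'`. -/
def foot (h h' : DQ ℝ) : Fin 3 → ℝ := basePoint h + footParam h h' • dir h

/-- `s_k`: the offset, i.e. the signed distance on the oriented line `h_k` from its intersection
with the common normal of `h_{k-1}, h_k` to that with the common normal of `h_k, h_{k+1}`. -/
def paramS (h : ZMod 6 → DQ ℝ) (k : ZMod 6) : ℝ :=
  footParam (h k) (h (k + 1)) - footParam (h k) (h (k - 1))

/-- The explicit quadratic polynomial in terms of the parameters, with `f_k = b_k c_k`. -/
def quadFormula (b c s : ZMod 6 → ℝ) (k : ZMod 6) : Polynomial ℂ :=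
  let f : ZMod 6 → ℝ := fun j => b j * c j
  let re₁ : ℝ := (f k - f (k + 2) - f (k + 3) + f (k + 5)) / 4
  let im₁ : ℝ := (s (k + 3) - s k) / 4
  let re₀ : ℝ :=
    (s (k + 1) ^ 2 + s (k + 2) ^ 2 + b (k + 1) ^ 2 - f (k + 1) ^ 2 - b k ^ 2 - b (k + 2) ^ 2) / 4
      - c (k + 1) / 2 * (b k * b (k + 2) - s (k + 1) * s (k + 2))
  let im₀ : ℝ :=
    -(s (k + 1) * (b k + b (k + 2) * c (k + 1)) + s (k + 2) * (b (k + 2) + b k * c (k + 1))) / 2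
  (Polynomial.X + Polynomial.C (⟨re₁, im₁⟩ : ℂ)) ^ 2 + Polynomial.C (⟨re₀, im₀⟩ : ℂ)

/-- Lines have a unit direction vector that is orthogonal to the moment. -/
theorem line_spec (h : DQ ℝ) (hh : h * h = -1) :
    dir h ⬝ᵥ dir h = 1 ∧ dir h ⬝ᵥ moment h = 0 := by
  have e0 := congrArg (fun q : DQ ℝ => q.re.fst) hh
  have e1 := congrArg (fun q : DQ ℝ => q.imI.fst) hh
  have e2 := congrArg (fun q : DQ ℝ => q.imJ.fst) hh
  have e3 := congrArg (fun q : DQ ℝ => q.imK.fst) hh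
  have e4 := congrArg (fun q : DQ ℝ => q.re.snd) hh
  have o0 : (1 : DQ ℝ).re = 1 := rfl
  have o1 : (1 : DQ ℝ).imI = 0 := rfl
  have o2 : (1 : DQ ℝ).imJ = 0 := rfl
  have o3 : (1 : DQ ℝ).imK = 0 := rfl
  simp [o0, o1, o2, o3] at e0 e1 e2 e3 e4
  have hre : h.re.fst = 0 := by
    by_contra hne
    have a1 : h.imI.fst = 0 := by
      have : h.re.fst * h.imI.fst = 0 := by linarith
      exact (mul_eq_zero.mp this).resolve_left hne
    have a2 : h.imJ.fst = 0 := by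
      have : h.re.fst * h.imJ.fst = 0 := by linarith
      exact (mul_eq_zero.mp this).resolve_left hne
    have a3 : h.imK.fst = 0 := by
      have : h.re.fst * h.imK.fst = 0 := by linarith
      exact (mul_eq_zero.mp this).resolve_left hne
    rw [a1, a2, a3] at e0
    nlinarith [mul_self_nonneg h.re.fst]
  rw [hre] at e0 e4
  constructor
  · simp [dir]; linarith
  · simp [dir, moment]; linarith

/-- The feet lie on their lines, and the segment between them is orthogonal to both lines. -/
theorem foot_spec (h h' : DQ ℝ) (hh : h * h = -1) (hh' : h' * h' = -1) (hp : ¬ Parallel h h') :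
    dir h ⨯₃ foot h h' = moment h ∧
      (foot h' h - foot h h') ⬝ᵥ dir h = 0 ∧ (foot h' h - foot h h') ⬝ᵥ dir h' = 0 := by
  obtain ⟨n1, o1⟩ := line_spec h hh
  obtain ⟨n2, o2⟩ := line_spec h' hh'
  have base_dot : ∀ k : DQ ℝ, basePoint k ⬝ᵥ dir k = 0 := fun k => by
    rw [basePoint, dotProduct_comm]; exact dot_cross_self _ _
  have hc : 1 - (dir h ⬝ᵥ dir h') ^ 2 ≠ 0 := by
    intro h0
    apply hp
    have h1 : (dir h ⬝ᵥ dir h' - 1) * (dir h ⬝ᵥ dir h' + 1) = 0 := by linarith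
    rcases mul_eq_zero.mp h1 with h2 | h2
    · left
      have : (dir h - dir h') ⬝ᵥ (dir h - dir h') = 0 := by
        rw [sub_dotProduct, dotProduct_sub, dotProduct_sub, dotProduct_comm (dir h') (dir h)]
        linarith
      exact sub_eq_zero.mp (dotProduct_self_eq_zero.mp this)
    · right
      have : (dir h + dir h') ⬝ᵥ (dir h + dir h') = 0 := by
        rw [add_dotProduct, dotProduct_add, dotProduct_add, dotProduct_comm (dir h') (dir h)]
        linarith
      exact eq_neg_of_add_eq_zero_left (dotProduct_self_eq_zero.mp this)
  have b1 := base_dot h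
  have b2 := base_dot h'
  have cc : dir h' ⬝ᵥ dir h = dir h ⬝ᵥ dir h' := dotProduct_comm _ _
  refine ⟨?_, ?_, ?_⟩
  · have e : dir h ⨯₃ foot h h' =
        (dir h ⬝ᵥ dir h) • moment h - (dir h ⬝ᵥ moment h) • dir h := by
      rw [foot, basePoint, map_add, map_smul, cross_self, smul_zero, add_zero]
      ext i
      fin_cases i <;> simp [cross_apply, Matrix.vec3_dotProduct] <;> ring
    rw [e, n1, o1]; simp
  · simp only [foot, footParam, sub_dotProduct, add_dotProduct, smul_dotProduct, smul_eq_mul, cc,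
      b1, b2, n1]
    field_simp
    ring
  · simp only [foot, footParam, sub_dotProduct, add_dotProduct, smul_dotProduct, smul_eq_mul, cc,
      b1, b2, n2]
    field_simp
    ring

end Linkage

end

/-! Over the complex dual numbers a line `h` becomes the rank one projection `proj h` = (1 + i h)/2,
whose conjugate is its complement, and `t - h` is proportional to `proj h + z (1 - proj h)` with z =
(t - i)/(t + i). Products of such projections are evaluated by traces, because e x e = tr(e x) e
(`IsProj.sandwich`).

Quad polynomials. For projections e₁, …, e₄ of four consecutive lines, the elements fixed by e₁ on
the left and killed by e₄ on the right are the multiples of one generator g, and four structure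
constants α, β, α', β' compare the products of e₁, e₂, e₃ and their complements with g (`Coeffs`).
The equations of a quad express the rank one matrix of products of the two rotation parameters
linearly in y₀ and y₁, so the ratio x = y₁/y₀ is a root of the quadratic polynomial `quadNum`.
Conversely, the residue class of x modulo `quadNum` yields solutions locally, so this polynomial
generates the elimination ideal (`quadElim_eq`). Coupling dimension eight provides functionals that
are multiplicative in three factors (`exists_functional`), and these exclude degenerate constants.

Formula and invariance. The roots are governed by the logarithmic derivatives `logd` of the
structure constants. Ratios of constants are ratios of traces, and the logarithmic derivatives of
these traces are Bennett ratios and offsets, the latter by the dual spherical cosine rule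
(`offset_spec`). The discriminant involves one quad only. The difference of the root sums of
opposite quads follows from a trace that both quads share (`closing`), and the generator drops out.
The shift by the mean root leaves just these two quantities. A motion multiplies the relevant traces
by complex constants, which `logd` ignores, so all parameters are invariant.

Bonds. Closure of the linkage makes the product X of three consecutive factors proportional to the
conjugate of the product Y of the other three. Modulo z_k, X becomes a dual multiple of g and Y the
same multiple of `star g`, up to a unit without dual part. Hence one x solves both quads: after the
common shift it is a root of the gcd, and it generates all other parameters (`exists_root`). So the
coordinate ring modulo z_k and the closure relations is spanned by deg gcd elements
(`exists_span_mod`). A bound for places (`IsPlaces.sum_le`) turns this into a bound for the sum of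
the orders of z_k at distinct points of the curve, and these orders dominate the connection numbers
(`connectionNumber_le`). The case t_{k+3} = -i is reduced to t_{k+3} = +i by reversing lines. -/

noncomputable section
namespace Linkage

open Quaternion

/-! ### Rank one projections in quaternion algebras -/

section Projections

variable {T : Type*} [CommRing T]

/-- The reduced trace. -/
def tr (q : ℍ[T]) : T := 2 * q.re

theorem coe_tr (q : ℍ[T]) : ((tr q : T) : ℍ[T]) = q + star q := by
  rw [Quaternion.self_add_star, tr]; push_cast; rfl

theorem tr_add (p q : ℍ[T]) : tr (p + q) = tr p + tr q := by simp [tr, mul_add]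

theorem tr_sub (p q : ℍ[T]) : tr (p - q) = tr p - tr q := by simp [tr, mul_sub]

theorem tr_zero : tr (0 : ℍ[T]) = 0 := by simp [tr]

theorem tr_smul (d : T) (q : ℍ[T]) : tr (d • q) = d * tr q := by simp [tr]; ring

theorem tr_mul_comm (p q : ℍ[T]) : tr (p * q) = tr (q * p) := by
  simp [tr]; ring

theorem tr_star (q : ℍ[T]) : tr (star q) = tr q := by simp [tr]

theorem smul_eq_tr (d : T) (q : ℍ[T]) : d • q = (d : ℍ[T]) * q :=
  (Quaternion.coe_mul_eq_smul d q).symm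

/-- A quaternion `e` that is idempotent with `star e = 1 - e`. -/
structure IsProj (e : ℍ[T]) : Prop where
  idem : e * e = e
  star_eq : star e = 1 - e

namespace IsProj

variable {e f a b : ℍ[T]}

theorem compl (he : IsProj e) : IsProj (1 - e) where
  idem := by
    have := he.idem
    simp [mul_sub, sub_mul, this]
  star_eq := by rw [star_sub, star_one, he.star_eq]

theorem mul_compl (he : IsProj e) : e * (1 - e) = 0 := by rw [mul_sub, mul_one, he.idem, sub_self]

theorem compl_mul (he : IsProj e) : (1 - e) * e = 0 := by rw [sub_mul, one_mul, he.idem, sub_self]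

/-- Write the trace as `e * x + star x * star e`; the second term dies against `e` because `star e =
1 - e`. This is the rank one property of `e`, and it turns products of projections into traces. -/
theorem sandwich (he : IsProj e) (x : ℍ[T]) : e * x * e = tr (e * x) • e := by
  rw [smul_eq_tr, coe_tr, star_mul, add_mul, mul_assoc (star x), he.star_eq, he.compl_mul,
    mul_zero, add_zero]

theorem tr_self (he : IsProj e) : tr e = 1 := by
  apply Quaternion.coe_injective
  rw [coe_tr, he.star_eq]; simp

/-- Two multiples of a projection-product are compared through a unit trace. -/
theorem rank_one (he : IsProj e) (hf : IsProj f) {p q : ℍ[T]} (w : ℍ[T]) (hp : e * p = p)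
    (hp' : p * f = p) (hq : e * q = q) (hq' : q * f = q) :
    tr (w * p) • q = tr (w * q) • p := by
  -- The product `q * w * p` is evaluated twice, with `sandwich` for `e` and with `sandwich` for
  -- `f`.
  have h1 : q * w * p = tr (w * q) • p := by
    have : e * (q * w) * e = tr (e * (q * w)) • e := he.sandwich _
    calc q * w * p = e * (q * w) * e * p := by
          rw [mul_assoc _ e p, hp, ← mul_assoc e, hq]
      _ = tr (w * q) • p := by rw [this, smul_mul_assoc, hp, ← mul_assoc e, hq, tr_mul_comm]
  have h2 : q * w * p = tr (w * p) • q := by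
    have : f * (w * p) * f = tr (f * (w * p)) • f := hf.sandwich _
    calc q * w * p = q * (f * (w * p) * f) := by
          rw [mul_assoc f, mul_assoc w, hp', ← mul_assoc q f, hq', mul_assoc]
      _ = tr (w * p) • q := by
          rw [this, mul_smul_comm, hq', tr_mul_comm, mul_assoc, hp']
  rw [← h1, h2]

theorem ext_right {p q : ℍ[T]} (h1 : p * e = q * e)
    (h2 : p * (1 - e) = q * (1 - e)) : p = q := by
  have : p * e + p * (1 - e) = q * e + q * (1 - e) := by rw [h1, h2]
  simpa [mul_sub] using this

theorem star_compl (he : IsProj e) : star (1 - e) = e := by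
  rw [he.compl.star_eq, sub_sub_cancel]

end IsProj

/-- `g` generates the `T`-module `e A (1 - f)`, in the strong sense that some trace `tr (w g)` is
a unit. -/
structure IsGen (e f g : ℍ[T]) : Prop where
  left : e * g = g
  right : g * f = 0
  unit : ∃ w, IsUnit (tr (w * g))

namespace IsGen

variable {e f g a : ℍ[T]}

theorem right' (hg : IsGen e f g) : g * (1 - f) = g := by rw [mul_sub, mul_one, hg.right, sub_zero]

/-- By `rank_one` for `e` and `1 - f`, tr(w g) q = tr(w q) g, and the first trace is a unit. -/
theorem exists_smul (he : IsProj e) (hf : IsProj f) (hg : IsGen e f g) {q : ℍ[T]}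
    (h1 : e * q = q) (h2 : q * f = 0) : ∃ d : T, q = d • g := by
  obtain ⟨w, u, hu⟩ := hg.unit
  have h2' : q * (1 - f) = q := by rw [mul_sub, mul_one, h2, sub_zero]
  have := he.rank_one hf.compl w hg.left hg.right' h1 h2'
  refine ⟨↑u⁻¹ * tr (w * q), ?_⟩
  rw [mul_smul, ← this, ← hu, smul_smul]; simp

theorem smul_cancel (hg : IsGen e f g) {c d : T} (h : c • g = d • g) : c = d := by
  obtain ⟨w, hw⟩ := hg.unit
  have := congrArg (fun x => tr (w * x)) h
  simp only [mul_smul_comm, tr_smul] at this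
  exact hw.mul_right_cancel this

/-- Conjugation reverses products and exchanges a projection with its complement. It lets the
opposite quad be measured with the conjugate of the same generator. -/
theorem star_gen (he : IsProj e) (hf : IsProj f) (hg : IsGen e f g) : IsGen f e (star g) where
  left := by
    have := congrArg Star.star hg.right'
    rwa [star_mul, hf.star_compl] at this
  right := by
    have h : (1 - e) * g = 0 := by rw [sub_mul, one_mul, hg.left, sub_self]
    have := congrArg Star.star h
    rwa [star_mul, he.star_compl, star_zero] at this
  unit := by
    obtain ⟨w, hw⟩ := hg.unit
    refine ⟨Star.star w, ?_⟩
    rwa [← star_mul, tr_star, tr_mul_comm]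

/-- Cancellation after multiplication by a projection in general position. -/
theorem smul_mul_cancel (hf : IsProj f) (hg : IsGen e f g)
    (hfa : IsUnit (tr ((1 - f) * a))) {c d : T} (h : c • (g * a) = d • (g * a)) : c = d := by
  have key : g * a * (1 - f) = tr ((1 - f) * a) • g := by
    conv_lhs => rw [← hg.right']
    rw [mul_assoc, mul_assoc, ← mul_assoc (1 - f), hf.compl.sandwich, mul_smul_comm, hg.right']
  have := congrArg (fun x => x * (1 - f)) h
  simp only [smul_mul_assoc, key, smul_smul] at this
  exact hfa.mul_right_cancel (hg.smul_cancel this)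

/-- Multiplication by `1 - f` moves `e * x * a` into the module generated by `g`; multiplication by
`a` brings it back at the cost of the unit tr((1 - f) a). -/
theorem exists_coeff (he : IsProj e) (hf : IsProj f) (hg : IsGen e f g) (ha : IsProj a)
    (hfa : IsUnit (tr ((1 - f) * a))) (x : ℍ[T]) : ∃ d : T, e * x * a = d • (g * a) := by
  have h1 : e * (e * x * a * (1 - f)) = e * x * a * (1 - f) := by
    simp only [← mul_assoc, he.idem]
  have h2 : e * x * a * (1 - f) * f = 0 := by rw [mul_assoc, hf.compl_mul, mul_zero]
  obtain ⟨d, hd⟩ := hg.exists_smul he hf h1 h2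
  obtain ⟨u, hu⟩ := hfa
  refine ⟨↑u⁻¹ * d, ?_⟩
  have key : e * x * a * (1 - f) * a = tr ((1 - f) * a) • (e * x * a) := by
    rw [mul_assoc (e * x * a), mul_assoc (e * x), ← mul_assoc a, ha.sandwich, mul_smul_comm,
      tr_mul_comm]
  rw [mul_smul, ← smul_mul_assoc, ← hd, key, ← hu, smul_smul]; simp

/-- The four structure constants of the products `e₁ e₂ e₃` relative to a generator. -/
structure Coeffs (e₁ e₂ e₃ g : ℍ[T]) (α β α' β' : T) : Prop where
  ha : e₁ * e₂ * e₃ = α • (g * e₃)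
  hb : e₁ * (1 - e₂) * e₃ = β • (g * e₃)
  ha' : e₁ * e₂ * (1 - e₃) = α' • (g * (1 - e₃))
  hb' : e₁ * (1 - e₂) * (1 - e₃) = β' • (g * (1 - e₃))

end IsGen

/-- Four projections such that consecutive ones are in general position. -/
structure GenPos (e f : ℍ[T]) : Prop where
  unit : IsUnit (tr (e * f))
  unit_compl : IsUnit (tr (e * (1 - f)))

namespace GenPos

variable {e f : ℍ[T]}

theorem tr_compl_left (he : IsProj e) (hf : IsProj f) : tr ((1 - e) * f) = tr (e * (1 - f)) := by
  rw [sub_mul, mul_sub, tr_sub, tr_sub, one_mul, mul_one, he.tr_self, hf.tr_self]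

theorem tr_compl_compl (he : IsProj e) (hf : IsProj f) :
    tr ((1 - e) * (1 - f)) = tr (e * f) := by
  rw [tr_compl_left he hf.compl, sub_sub_cancel]

theorem symm (he : IsProj e) (hf : IsProj f) (h : GenPos e f) : GenPos f e where
  unit := by rw [tr_mul_comm]; exact h.unit
  unit_compl := by rw [tr_mul_comm, tr_compl_left he hf]; exact h.unit_compl

theorem compl_left (he : IsProj e) (hf : IsProj f) (h : GenPos e f) : GenPos (1 - e) f where
  unit := by rw [tr_compl_left he hf]; exact h.unit_compl
  unit_compl := by rw [tr_compl_compl he hf]; exact h.unit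

end GenPos

theorem IsProj.tr_chain {e f a : ℍ[T]} (he : IsProj e) (hf : IsProj f) :
    e * f * a * f * e = (tr (f * a) * tr (e * f)) • e := by
  rw [mul_assoc (e * f * a), mul_assoc e f a, mul_assoc e (f * a), ← mul_assoc (f * a),
    hf.sandwich, smul_mul_assoc, mul_smul_comm, ← mul_assoc, he.sandwich, smul_smul]

/-! ### Structure constants of a quad relative to a generator. -/

section Four

variable {e₁ e₂ e₃ e₄ g : ℍ[T]} {α β α' β' : T}

theorem IsGen.exists_coeffs (h₁ : IsProj e₁) (h₃ : IsProj e₃) (h₄ : IsProj e₄)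
    (h34 : GenPos e₃ e₄) (hg : IsGen e₁ e₄ g) :
    ∃ α β α' β', IsGen.Coeffs e₁ e₂ e₃ g α β α' β' := by
  have u1 : IsUnit (tr ((1 - e₄) * e₃)) := by rw [tr_mul_comm]; exact h34.unit_compl
  have u2 : IsUnit (tr ((1 - e₄) * (1 - e₃))) := by
    rw [GenPos.tr_compl_compl h₄ h₃, tr_mul_comm]; exact h34.unit
  obtain ⟨α, ha⟩ := hg.exists_coeff h₁ h₄ h₃ u1 e₂
  obtain ⟨β, hb⟩ := hg.exists_coeff h₁ h₄ h₃ u1 (1 - e₂)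
  obtain ⟨α', ha'⟩ := hg.exists_coeff h₁ h₄ h₃.compl u2 e₂
  obtain ⟨β', hb'⟩ := hg.exists_coeff h₁ h₄ h₃.compl u2 (1 - e₂)
  exact ⟨α, β, α', β', ha, hb, ha', hb'⟩

/-- Multiplying on the right by `e₂ * e₁` and taking the trace exhibits `α` as a divisor of tr(e₂
e₃) tr(e₁ e₂). -/
theorem isUnit_of_prod (h₁ : IsProj e₁) (h₂ : IsProj e₂) (h12 : IsUnit (tr (e₁ * e₂)))
    (h23 : IsUnit (tr (e₂ * e₃))) {α : T} {p : ℍ[T]} (h : e₁ * e₂ * e₃ = α • p) : IsUnit α := by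
  have h1 := h₁.tr_chain h₂ (a := e₃)
  rw [h, smul_mul_assoc, smul_mul_assoc] at h1
  have h2 := congrArg tr h1
  rw [tr_smul, tr_smul, h₁.tr_self, mul_one] at h2
  exact isUnit_of_mul_isUnit_left (h2 ▸ h23.mul h12)

namespace IsGen.Coeffs

theorem isUnit (h₁ : IsProj e₁) (h₂ : IsProj e₂) (h₃ : IsProj e₃) (h12 : GenPos e₁ e₂)
    (h23 : GenPos e₂ e₃) (h : Coeffs e₁ e₂ e₃ g α β α' β') :
    IsUnit α ∧ IsUnit β ∧ IsUnit α' ∧ IsUnit β' :=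
  ⟨isUnit_of_prod h₁ h₂ h12.unit h23.unit h.ha,
    isUnit_of_prod h₁ h₂.compl h12.unit_compl (h23.compl_left h₂ h₃).unit h.hb,
    isUnit_of_prod h₁ h₂ h12.unit h23.unit_compl h.ha',
    isUnit_of_prod h₁ h₂.compl h12.unit_compl (h23.compl_left h₂ h₃).unit_compl h.hb'⟩

/-- The two products are multiples of the same `g * e₃`, so cross-multiplication eliminates `g`; the
trace against `e₂` then gives the ratio β/α in terms of the projections only. -/
theorem beta_mul (h₂ : IsProj e₂) (h : Coeffs e₁ e₂ e₃ g α β α' β') :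
    β * (tr (e₁ * e₂) * tr (e₂ * e₃)) = α * tr (e₁ * (1 - e₂) * e₃ * e₂) := by
  have h1 : β • (e₁ * e₂ * e₃) = α • (e₁ * (1 - e₂) * e₃) := by
    rw [h.ha, h.hb, smul_smul, smul_smul, mul_comm]
  have h2 := congrArg (fun x => tr (x * e₂)) h1
  simp only [smul_mul_assoc, tr_smul] at h2
  rw [← h2, mul_assoc e₁ e₂ e₃, mul_assoc e₁ (e₂ * e₃), h₂.sandwich, mul_smul_comm, tr_smul]
  ring

/-- The ratio α'/α needs a passage from `1 - e₃` to `e₃`. It goes through `1 - e₄`, where `g`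
reproduces itself up to a trace. -/
theorem alpha'_mul (h₂ : IsProj e₂) (h₄ : IsProj e₄)
    (h12 : IsUnit (tr (e₁ * e₂))) (hg : IsGen e₁ e₄ g) (h : Coeffs e₁ e₂ e₃ g α β α' β') :
    α' * (tr ((1 - e₃) * (1 - e₄)) * tr (e₂ * e₃)) =
      α * tr (e₂ * (1 - e₃) * (1 - e₄) * e₃) := by
  have h1 : α • (e₁ * (e₂ * (1 - e₃) * (1 - e₄) * e₃)) =
      (α' * tr ((1 - e₃) * (1 - e₄))) • (e₁ * e₂ * e₃) := by
    have e1 : e₁ * (e₂ * (1 - e₃) * (1 - e₄) * e₃) = e₁ * e₂ * (1 - e₃) * (1 - e₄) * e₃ := by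
      simp only [mul_assoc]
    have e2 : g * (1 - e₃) * (1 - e₄) = tr ((1 - e₃) * (1 - e₄)) • g := by
      conv_lhs => rw [← hg.right']
      rw [mul_assoc g, mul_assoc g, h₄.compl.sandwich, mul_smul_comm, hg.right', tr_mul_comm]
    rw [e1, h.ha', smul_mul_assoc, smul_mul_assoc, e2, smul_mul_assoc, h.ha]
    simp only [smul_smul]
    congr 1; ring
  have h2 := congrArg (fun x => tr (x * e₂)) h1
  simp only [smul_mul_assoc, tr_smul] at h2
  have e3 : e₁ * (e₂ * (1 - e₃) * (1 - e₄) * e₃) * e₂ =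
      tr (e₂ * (1 - e₃) * (1 - e₄) * e₃) • (e₁ * e₂) := by
    have : e₂ * ((1 - e₃) * (1 - e₄) * e₃) * e₂ = _ := h₂.sandwich _
    rw [mul_assoc e₁, mul_assoc e₂, mul_assoc e₂, this, mul_smul_comm]
  have e4 : e₁ * e₂ * e₃ * e₂ = tr (e₂ * e₃) • (e₁ * e₂) := by
    rw [mul_assoc e₁, mul_assoc e₁, h₂.sandwich, mul_smul_comm]
  rw [e3, e4, tr_smul, tr_smul] at h2
  apply h12.mul_right_cancel
  linear_combination -h2

/-- The norm of `g` is a scalar killed by `1 - e₁`, and `1 - e₁` has trace one. -/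
theorem g_mul_star (h₁ : IsProj e₁) (hg : IsGen e₁ e₄ g) : g * star g = 0 := by
  have h : (1 - e₁) * g = 0 := by rw [sub_mul, one_mul, hg.left, sub_self]
  rw [Quaternion.self_mul_star]
  have h2 : (1 - e₁) * (g * star g) = 0 := by rw [← mul_assoc, h, zero_mul]
  rw [Quaternion.self_mul_star, Quaternion.mul_coe_eq_smul] at h2
  have h3 := congrArg tr h2
  rw [tr_smul, h₁.compl.tr_self, mul_one, tr_zero] at h3
  rw [h3]; rfl

/-- The conjugate of the equation for `β'` ends in `star g`. Multiplying the equation for `α` by it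
lets `e₂ * e₃ * e₂` contract to a trace, and the left side no longer contains the generator. -/
theorem alpha_mul_beta' (h₂ : IsProj e₂) (h₃ : IsProj e₃) (h₁ : IsProj e₁)
    (h : Coeffs e₁ e₂ e₃ g α β α' β') :
    tr (e₂ * e₃) • (e₁ * e₂ * (1 - e₁)) = (α * β') • (g * e₃ * star g) := by
  have h1 := congrArg star h.hb'
  rw [Quaternion.star_smul, star_mul, star_mul, star_mul, h₃.star_compl, h₂.star_compl,
    h₁.star_eq] at h1
  have h2 : e₁ * e₂ * e₃ * (e₃ * (e₂ * (1 - e₁))) = (α * β') • (g * e₃ * star g) := by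
    rw [h1, h.ha, smul_mul_assoc, mul_smul_comm, smul_smul, ← mul_assoc, mul_assoc g e₃ e₃,
      h₃.idem]
  rw [← h2]
  have h3 : e₁ * e₂ * e₃ * (e₃ * (e₂ * (1 - e₁))) = e₁ * (e₂ * (e₃ * e₃) * e₂) * (1 - e₁) := by
    simp only [mul_assoc]
  rw [h3, h₃.idem, h₂.sandwich, mul_smul_comm, smul_mul_assoc]

theorem alpha'_mul_beta (h₂ : IsProj e₂) (h₃ : IsProj e₃) (h₁ : IsProj e₁)
    (h : Coeffs e₁ e₂ e₃ g α β α' β') :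
    tr (e₂ * (1 - e₃)) • (e₁ * e₂ * (1 - e₁)) = (α' * β) • (g * (1 - e₃) * star g) := by
  have h' : Coeffs e₁ e₂ (1 - e₃) g α' β' α β :=
    ⟨h.ha', h.hb', by rw [sub_sub_cancel]; exact h.ha, by rw [sub_sub_cancel]; exact h.hb⟩
  exact h'.alpha_mul_beta' h₂ h₃.compl h₁

/-- Since `g * star g = 0`, replacing `e₃` by its complement changes only the sign of `g * e₃ * star
g`. Thus αβ' and α'β are compared through `e₁ * e₂ * (1 - e₁)`, whose trace against `e₂` is a unit
and may be cancelled. -/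
theorem cross_ratio (h₁ : IsProj e₁) (h₂ : IsProj e₂) (h₃ : IsProj e₃) (hg : IsGen e₁ e₄ g)
    (h12 : GenPos e₁ e₂) (h : Coeffs e₁ e₂ e₃ g α β α' β') :
    α' * β * tr (e₂ * e₃) = -(α * β' * tr (e₂ * (1 - e₃))) := by
  have h1 := h.alpha_mul_beta' h₂ h₃ h₁
  have h2 := h.alpha'_mul_beta h₂ h₃ h₁
  have h3 : g * (1 - e₃) * star g = -(g * e₃ * star g) := by
    rw [mul_sub, mul_one, sub_mul, g_mul_star h₁ hg, zero_sub]
  rw [h3] at h2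
  have h4 : ((α' * β) * tr (e₂ * e₃)) • (e₁ * e₂ * (1 - e₁)) =
      (-(α * β' * tr (e₂ * (1 - e₃)))) • (e₁ * e₂ * (1 - e₁)) := by
    rw [mul_smul (α' * β), h1, neg_smul, mul_smul (α * β'), h2, smul_neg, smul_neg, neg_neg, smul_smul,
      smul_smul, mul_comm]
  have h5 := congrArg (fun x => tr (x * e₂)) h4
  simp only [smul_mul_assoc, tr_smul] at h5
  have u : IsUnit (tr (e₁ * e₂ * (1 - e₁) * e₂)) := by
    rw [mul_assoc e₁, mul_assoc e₁, h₂.sandwich, mul_smul_comm, tr_smul]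
    refine IsUnit.mul ?_ h12.unit
    rw [tr_mul_comm, GenPos.tr_compl_left h₁ h₂]; exact h12.unit_compl
  exact u.mul_right_cancel h5

/-- One quad pairs `g * e₃ * star g` with `e₆`, the opposite one pairs `star g * e₆ * g` with `e₃`;
cyclicity of the trace makes the two pairings equal. This common `κ` is the only link between the
two quads. -/
theorem closing {e₅ e₆ : ℍ[T]} {γ δ γ' δ' : T} (h₁ : IsProj e₁) (h₂ : IsProj e₂)
    (h₃ : IsProj e₃) (h₄ : IsProj e₄) (h₅ : IsProj e₅) (h₆ : IsProj e₆)
    (h : Coeffs e₁ e₂ e₃ g α β α' β') (k : Coeffs e₄ e₅ e₆ (star g) γ δ γ' δ') :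
    ∃ κ, tr (e₂ * e₃) * tr (e₆ * e₁ * e₂ * (1 - e₁)) = α * β' * κ ∧
      tr (e₅ * e₆) * tr (e₃ * e₄ * e₅ * (1 - e₄)) = γ * δ' * κ := by
  refine ⟨tr (e₆ * (g * e₃ * star g)), ?_, ?_⟩
  · have := congrArg (fun x => tr (e₆ * x)) (h.alpha_mul_beta' h₂ h₃ h₁)
    simp only [mul_smul_comm, tr_smul] at this
    rw [← this]; simp only [mul_assoc]
  · have := congrArg (fun x => tr (e₃ * x)) (k.alpha_mul_beta' h₅ h₆ h₄)
    simp only [mul_smul_comm, tr_smul, star_star] at this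
    have e : tr (e₆ * (g * e₃ * star g)) = tr (e₃ * (star g * e₆ * g)) := by
      have := tr_mul_comm (e₃ * star g) (e₆ * g)
      simp only [mul_assoc] at this ⊢
      exact this.symm
    rw [e, ← this]; simp only [mul_assoc]

/-- The equation of a quad in terms of the structure constants. -/
theorem prod_eq_smul_iff (h₃ : IsProj e₃) (h₄ : IsProj e₄) (h34 : GenPos e₃ e₄)
    (hg : IsGen e₁ e₄ g) (h : Coeffs e₁ e₂ e₃ g α β α' β') (a₂ b₂ a₃ b₃ Y : T) :
    e₁ * (a₂ • e₂ + b₂ • (1 - e₂)) * (a₃ • e₃ + b₃ • (1 - e₃)) = Y • g ↔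
      a₃ * (a₂ * α + b₂ * β) = Y ∧ b₃ * (a₂ * α' + b₂ * β') = Y := by
  have u1 : IsUnit (tr ((1 - e₄) * e₃)) := by rw [tr_mul_comm]; exact h34.unit_compl
  have u2 : IsUnit (tr ((1 - e₄) * (1 - e₃))) := by
    rw [GenPos.tr_compl_compl h₄ h₃, tr_mul_comm]; exact h34.unit
  have r1 : e₁ * (a₂ • e₂ + b₂ • (1 - e₂)) * (a₃ • e₃ + b₃ • (1 - e₃)) * e₃ =
      (a₃ * (a₂ * α + b₂ * β)) • (g * e₃) := by
    rw [mul_assoc _ _ e₃, add_mul (a₃ • e₃), smul_mul_assoc, smul_mul_assoc, h₃.idem, h₃.compl_mul]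
    simp only [smul_zero, add_zero, mul_add, add_mul, mul_smul_comm, smul_mul_assoc, h.ha, h.hb,
      smul_smul, ← add_smul]
  have r2 : e₁ * (a₂ • e₂ + b₂ • (1 - e₂)) * (a₃ • e₃ + b₃ • (1 - e₃)) * (1 - e₃) =
      (b₃ * (a₂ * α' + b₂ * β')) • (g * (1 - e₃)) := by
    rw [mul_assoc _ _ (1 - e₃), add_mul (a₃ • e₃), smul_mul_assoc, smul_mul_assoc, h₃.mul_compl,
      h₃.compl.idem]
    simp only [smul_zero, zero_add, mul_add, add_mul _ _ (1 - e₃), mul_smul_comm, smul_mul_assoc, h.ha', h.hb', smul_smul, ← add_smul]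
  constructor
  · intro hq
    rw [hq, smul_mul_assoc] at r1 r2
    exact ⟨(hg.smul_mul_cancel h₄ u1 r1).symm, (hg.smul_mul_cancel h₄ u2 r2).symm⟩
  · rintro ⟨rfl, hY⟩
    apply IsProj.ext_right (e := e₃)
    · rw [r1, smul_mul_assoc]
    · rw [r2, smul_mul_assoc, hY]

end IsGen.Coeffs

end Four

end Projections

end Linkage

end

noncomputable section
namespace Linkage

open Quaternion

/-! ### Dual quaternions over varying rings -/

section BaseChange

variable {R S U : Type*} [CommRing R] [CommRing S] [CommRing U]

@[simp] theorem fst_mapDual (f : R →+* S) (d : DualNumber R) : (mapDual f d).fst = f d.fst := by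
  simp [mapDual]

@[simp] theorem snd_mapDual (f : R →+* S) (d : DualNumber R) : (mapDual f d).snd = f d.snd := by
  simp [mapDual]

/-- `mapDual` as a ring homomorphism. -/
def mapDualHom (f : R →+* S) : DualNumber R →+* DualNumber S where
  toFun := mapDual f
  map_one' := by ext <;> simp
  map_mul' x y := by ext <;> simp
  map_zero' := by ext <;> simp
  map_add' x y := by ext <;> simp

@[simp] theorem mapDualHom_apply (f : R →+* S) (d : DualNumber R) :
    mapDualHom f d = mapDual f d := rfl

@[simp] theorem re_mapDQ (f : R →+* S) (q : DQ R) : (mapDQ f q).re = mapDual f q.re := rfl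
@[simp] theorem imI_mapDQ (f : R →+* S) (q : DQ R) : (mapDQ f q).imI = mapDual f q.imI := rfl
@[simp] theorem imJ_mapDQ (f : R →+* S) (q : DQ R) : (mapDQ f q).imJ = mapDual f q.imJ := rfl
@[simp] theorem imK_mapDQ (f : R →+* S) (q : DQ R) : (mapDQ f q).imK = mapDual f q.imK := rfl

instance smulCommClass_DQ : SMulCommClass R (DQ R) (DQ R) where
  smul_comm a p q := by simp only [smul_eq_mul]; ext <;> simp <;> ring

instance isScalarTower_DQ : IsScalarTower R (DQ R) (DQ R) where
  smul_assoc a p q := by simp only [smul_eq_mul]; ext <;> simp <;> ring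

theorem quat_mul_neg {T : Type*} [CommRing T] (p q : ℍ[T]) : p * -q = -(p * q) := mul_neg p q
theorem quat_neg_mul {T : Type*} [CommRing T] (p q : ℍ[T]) : -p * q = -(p * q) := neg_mul p q
theorem quat_neg_neg {T : Type*} [CommRing T] (p : ℍ[T]) : - -p = p := neg_neg p

namespace DQ

theorem neg_neg (p : DQ R) : - -p = p := quat_neg_neg p

theorem smul_add (a : R) (p q : DQ R) : a • (p + q) = a • p + a • q := _root_.smul_add a p q
theorem smul_neg (a : R) (p : DQ R) : a • (-p) = -(a • p) := _root_.smul_neg a p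
theorem neg_smul (a : R) (p : DQ R) : -a • p = -(a • p) := _root_.neg_smul a p
theorem smul_smul (a b : R) (p : DQ R) : a • b • p = (a * b) • p := _root_.smul_smul a b p
theorem one_smul (p : DQ R) : (1 : R) • p = p := _root_.one_smul R p
theorem zero_smul (p : DQ R) : (0 : R) • p = 0 := _root_.zero_smul R p
theorem smul_zero (a : R) : a • (0 : DQ R) = 0 := by
  ext <;> simp
theorem smul_mul (a : R) (p q : DQ R) : a • p * q = a • (p * q) := smul_mul_assoc a p q
theorem mul_smul (a : R) (p q : DQ R) : p * a • q = a • (p * q) := mul_smul_comm a p q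
theorem one_mul (p : DQ R) : 1 * p = p := _root_.one_mul p
theorem mul_one (p : DQ R) : p * 1 = p := _root_.mul_one p
theorem star_smul (a : R) (p : DQ R) : star (a • p) = a • star p := Quaternion.star_smul a p

theorem mul_neg (p q : DQ R) : p * -q = -(p * q) := quat_mul_neg p q
theorem neg_mul (p q : DQ R) : -p * q = -(p * q) := quat_neg_mul p q
theorem neg_mul_neg (p q : DQ R) : -p * -q = p * q := by
  rw [mul_neg, neg_mul, DQ.neg_neg]

end DQ

@[simp] theorem fst_two : (2 : DualNumber R).fst = 2 := by
  rw [← one_add_one_eq_two, TrivSqZeroExt.fst_add, TrivSqZeroExt.fst_one, one_add_one_eq_two]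
@[simp] theorem snd_two : (2 : DualNumber R).snd = 0 := by
  rw [← one_add_one_eq_two]; simp

/-- `mapDQ` as a ring homomorphism. -/
def mapDQHom (f : R →+* S) : DQ R →+* DQ S where
  toFun := mapDQ f
  map_one' := by
    ext1
    · exact map_one (mapDualHom f)
    all_goals exact map_zero (mapDualHom f)
  map_mul' x y := by
    ext1 <;> simp [← mapDualHom_apply]
  map_zero' := by
    ext1 <;> exact map_zero (mapDualHom f)
  map_add' x y := by
    ext1 <;> simp [← mapDualHom_apply]

theorem mapDQ_one (f : R →+* S) : mapDQ f (1 : DQ R) = 1 := map_one (mapDQHom f)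
theorem mapDQ_zero (f : R →+* S) : mapDQ f (0 : DQ R) = 0 := map_zero (mapDQHom f)
theorem mapDQ_mul (f : R →+* S) (p q : DQ R) : mapDQ f (p * q) = mapDQ f p * mapDQ f q :=
  map_mul (mapDQHom f) p q
theorem mapDQ_add (f : R →+* S) (p q : DQ R) : mapDQ f (p + q) = mapDQ f p + mapDQ f q :=
  map_add (mapDQHom f) p q
theorem mapDQ_sub (f : R →+* S) (p q : DQ R) : mapDQ f (p - q) = mapDQ f p - mapDQ f q :=
  map_sub (mapDQHom f) p q
theorem mapDQ_neg (f : R →+* S) (p : DQ R) : mapDQ f (-p) = -mapDQ f p :=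
  map_neg (mapDQHom f) p

theorem mapDQ_star (f : R →+* S) (q : DQ R) : mapDQ f (star q) = star (mapDQ f q) := by
  ext1 <;> simp [← mapDualHom_apply]

theorem mapDQ_mapDQ (f : R →+* S) (k : S →+* U) (q : DQ R) :
    mapDQ k (mapDQ f q) = mapDQ (k.comp f) q := by
  ext <;> simp

theorem mapDQ_smul (f : R →+* S) (d : DualNumber R) (q : DQ R) :
    mapDQ f (d • q) = mapDual f d • mapDQ f q := by
  ext1 <;> simp [← mapDualHom_apply]

theorem smul_eq_inl_smul (a : R) (q : DQ R) :
    a • q = (TrivSqZeroExt.inl a : DualNumber R) • q := by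
  ext <;> simp

theorem mapDQ_smul' (f : R →+* S) (a : R) (q : DQ R) :
    mapDQ f (a • q) = f a • mapDQ f q := by
  ext <;> simp

theorem mapDQ_coe (f : R →+* S) (d : DualNumber R) :
    mapDQ f (d : DQ R) = ((mapDual f d : DualNumber S) : DQ S) := by
  ext1 <;> simp [← mapDualHom_apply]

theorem scalar_mul (a : R) (q : DQ R) : scalar a * q = a • q := by
  rw [scalar, Quaternion.coe_mul_eq_smul, smul_eq_inl_smul]

theorem scalar_eq_smul (a : R) : (scalar a : DQ R) = a • 1 := by
  rw [← scalar_mul]; exact (mul_one (scalar a : DQ R)).symm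

theorem mapDQ_scalar (f : R →+* S) (a : R) : mapDQ f (scalar a : DQ R) = scalar (f a) := by
  rw [scalar_eq_smul, scalar_eq_smul, mapDQ_smul', mapDQ_one]

theorem mapDQ_eps (f : R →+* S) : mapDQ f (eps : DQ R) = eps := by
  rw [eps, mapDQ_coe, eps]; congr 1; ext <;> simp

theorem tr_mapDQ (f : R →+* S) (q : DQ R) : tr (mapDQ f q) = mapDual f (tr q) := by
  simp only [tr, re_mapDQ, ← mapDualHom_apply, map_mul, map_ofNat]

theorem isProj_mapDQ (f : R →+* S) {e : DQ R} (he : IsProj e) : IsProj (mapDQ f e) where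
  idem := by rw [← mapDQ_mul, he.idem]
  star_eq := by rw [← mapDQ_star, he.star_eq, mapDQ_sub, mapDQ_one]

theorem isUnit_mapDual (f : R →+* S) {d : DualNumber R} (hd : IsUnit d) : IsUnit (mapDual f d) :=
  hd.map (mapDualHom f)

theorem genPos_mapDQ (f : R →+* S) {e e' : DQ R} (h : GenPos e e') :
    GenPos (mapDQ f e) (mapDQ f e') where
  unit := by rw [← mapDQ_mul, tr_mapDQ]; exact isUnit_mapDual f h.unit
  unit_compl := by
    rw [← mapDQ_one f, ← mapDQ_sub, ← mapDQ_mul, tr_mapDQ]; exact isUnit_mapDual f h.unit_compl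

theorem isGen_mapDQ (f : R →+* S) {e e' g : DQ R} (h : IsGen e e' g) :
    IsGen (mapDQ f e) (mapDQ f e') (mapDQ f g) where
  left := by rw [← mapDQ_mul, h.left]
  right := by rw [← mapDQ_mul, h.right, mapDQ_zero]
  unit := by
    obtain ⟨w, hw⟩ := h.unit
    exact ⟨mapDQ f w, by rw [← mapDQ_mul, tr_mapDQ]; exact isUnit_mapDual f hw⟩

theorem coeffs_mapDQ (f : R →+* S) {e₁ e₂ e₃ g : DQ R} {α β α' β' : DualNumber R}
    (h : IsGen.Coeffs e₁ e₂ e₃ g α β α' β') :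
    IsGen.Coeffs (mapDQ f e₁) (mapDQ f e₂) (mapDQ f e₃) (mapDQ f g)
      (mapDual f α) (mapDual f β) (mapDual f α') (mapDual f β') := by
  constructor
  all_goals
    simp only [← mapDQ_one f, ← mapDQ_sub, ← mapDQ_mul, ← mapDQ_smul]
  · rw [h.ha]
  · rw [h.hb]
  · rw [h.ha']
  · rw [h.hb']

/-! ### Coordinates and linear functionals -/

theorem coord_injective : Function.Injective (coord : DQ R → Fin 8 → R) := by
  intro p q h
  have := fun i => congrFun h i
  ext
  · exact this 0
  · exact this 4
  · exact this 1
  · exact this 5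
  · exact this 2
  · exact this 6
  · exact this 3
  · exact this 7

/-- Coordinates as a linear map. -/
def coordLin : DQ R →ₗ[R] (Fin 8 → R) where
  toFun := coord
  map_add' p q := by ext i; fin_cases i <;> simp [coord]
  map_smul' a p := by ext i; fin_cases i <;> simp [coord]

@[simp] theorem coordLin_apply (q : DQ R) : coordLin q = coord q := rfl

theorem coord_add (p q : DQ R) : coord (p + q) = coord p + coord q := coordLin.map_add p q
theorem coord_smul (a : R) (q : DQ R) : coord (a • q) = a • coord q := coordLin.map_smul a q
theorem coord_zero : coord (0 : DQ R) = 0 := coordLin.map_zero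

theorem linearIndependent_coord {ι : Type*} [Fintype ι] {v : ι → DQ R}
    (h : LinearIndependent R v) : LinearIndependent R fun i => coord (v i) := by
  rw [Fintype.linearIndependent_iffₛ] at h ⊢
  intro f g hg
  refine h f g (coord_injective ?_)
  have e := fun k : ι → R => map_sum (coordLin (R := R)) (fun i => k i • v i) Finset.univ
  simp only [map_smul, coordLin_apply] at e
  rw [e, e, hg]

theorem coord_mapDQ (f : R →+* S) (q : DQ R) (c : Fin 8) :
    coord (mapDQ f q) c = f (coord q c) := by
  fin_cases c <;> simp [coord, mapDQ]

/-- Coordinates as a linear equivalence. -/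
def coordEquiv : DQ R ≃ₗ[R] (Fin 8 → R) :=
  LinearEquiv.ofBijective coordLin ⟨coord_injective, fun x =>
    ⟨⟨TrivSqZeroExt.inl (x 0) + TrivSqZeroExt.inr (x 4),
      TrivSqZeroExt.inl (x 1) + TrivSqZeroExt.inr (x 5),
      TrivSqZeroExt.inl (x 2) + TrivSqZeroExt.inr (x 6),
      TrivSqZeroExt.inl (x 3) + TrivSqZeroExt.inr (x 7)⟩, by
      ext i; fin_cases i <;> simp [coordLin, coord]⟩⟩

end BaseChange

/-! ### Linear functionals with complex coefficients, extended to algebras. -/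

section Functional

variable {S : Type*} [CommRing S] [Algebra ℂ S]

/-- The `S`-linear extension of a linear functional on `DQ ℂ`, given by its coefficients. -/
def ev {S : Type*} [CommRing S] [Algebra ℂ S] (φ : Fin 8 → ℂ) : DQ S →ₗ[S] S where
  toFun q := ∑ c, algebraMap ℂ S (φ c) * coord q c
  map_add' p q := by simp [coord_add, mul_add, Finset.sum_add_distrib]
  map_smul' a p := by
    simp only [coord_smul, Pi.smul_apply, smul_eq_mul, Finset.mul_sum, RingHom.id_apply]
    exact Finset.sum_congr rfl fun _ _ => by ring

theorem ev_apply (φ : Fin 8 → ℂ) (q : DQ S) : ev φ q = ∑ c, algebraMap ℂ S (φ c) * coord q c := rfl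

theorem ev_mapDQ (φ : Fin 8 → ℂ) (q : DQ ℂ) :
    ev φ (mapDQ (algebraMap ℂ S) q) = algebraMap ℂ S (ev φ q) := by
  simp [ev_apply, coord_mapDQ]

/-- Every `ℂ`-linear functional on `DQ ℂ` is of the form `ev φ`. -/
theorem exists_ev (ψ : DQ ℂ →ₗ[ℂ] ℂ) : ∃ φ : Fin 8 → ℂ, ∀ q, ev (S := ℂ) φ q = ψ q := by
  refine ⟨fun c => ψ ((coordEquiv (R := ℂ)).symm (Pi.single c 1)), fun q => ?_⟩
  have h : q = ∑ c, coord q c • (coordEquiv (R := ℂ)).symm (Pi.single c 1) := by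
    apply (coordEquiv (R := ℂ)).injective
    ext i
    simp only [map_sum, map_smul, LinearEquiv.apply_symm_apply, Finset.sum_apply, Pi.smul_apply,
      smul_eq_mul, Pi.single_apply, mul_ite, mul_one, mul_zero]
    simp only [Finset.sum_ite_eq, Finset.mem_univ, if_true]
    rfl
  conv_rhs => rw [h]
  simp [ev_apply, mul_comm]

/-- Precomposition of a functional with multiplication by constants. -/
theorem exists_ev_mul (φ : Fin 8 → ℂ) (a b : DQ ℂ) :
    ∃ ψ : Fin 8 → ℂ, ∀ (S : Type*) [CommRing S] [Algebra ℂ S] (q : DQ S),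
      ev ψ q = ev φ (mapDQ (algebraMap ℂ S) a * q * mapDQ (algebraMap ℂ S) b) := by
  obtain ⟨ψ, hψ⟩ := exists_ev (ev (S := ℂ) φ ∘ₗ
    (LinearMap.mulRight ℂ b) ∘ₗ (LinearMap.mulLeft ℂ a))
  refine ⟨ψ, fun S _ _ q => ?_⟩
  have h : q = ∑ c, coord q c • mapDQ (algebraMap ℂ S) ((coordEquiv (R := ℂ)).symm (Pi.single c 1)) := by
    apply coord_injective
    ext i
    change coord q i = coordLin (R := S) _ i
    rw [map_sum, Finset.sum_apply]
    simp only [map_smul, coordLin_apply, Pi.smul_apply, coord_mapDQ, smul_eq_mul]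
    have : ∀ c, coord ((coordEquiv (R := ℂ)).symm (Pi.single c 1)) i = (Pi.single c 1 : Fin 8 → ℂ) i :=
      fun c => congrFun ((coordEquiv (R := ℂ)).apply_symm_apply (Pi.single c 1)) i
    simp [this, Pi.single_apply]
  have e : ev φ (mapDQ (algebraMap ℂ S) a * q * mapDQ (algebraMap ℂ S) b) =
      (ev φ ∘ₗ LinearMap.mulRight S (mapDQ (algebraMap ℂ S) b) ∘ₗ
        LinearMap.mulLeft S (mapDQ (algebraMap ℂ S) a)) q := rfl
  rw [e, h]
  simp only [map_sum, map_smul, ev_mapDQ, hψ, LinearMap.comp_apply, LinearMap.mulRight_apply,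
    LinearMap.mulLeft_apply, ← mapDQ_mul]

end Functional

end Linkage

end

noncomputable section
namespace Linkage

open Quaternion

/-! ### Lines as projections -/

/-- The imaginary components of `h * h` are twice the scalar part times those of `h`. As the
direction is a unit vector, first the primal and then the dual scalar part must vanish. -/
theorem re_eq_zero_of_sq {h : DQ ℝ} (hh : h * h = -1) : h.re = 0 := by
  have e0 := congrArg (fun q : DQ ℝ => q.re.fst) hh
  have e1 := congrArg (fun q : DQ ℝ => q.imI.fst) hh
  have e2 := congrArg (fun q : DQ ℝ => q.imJ.fst) hh
  have e3 := congrArg (fun q : DQ ℝ => q.imK.fst) hh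
  have f1 := congrArg (fun q : DQ ℝ => q.imI.snd) hh
  have f2 := congrArg (fun q : DQ ℝ => q.imJ.snd) hh
  have f3 := congrArg (fun q : DQ ℝ => q.imK.snd) hh
  have n := (line_spec h hh).1
  simp at e0 e1 e2 e3 f1 f2 f3
  simp [dir] at n
  have hre : h.re.fst = 0 := by nlinarith
  simp only [hre, zero_mul, mul_zero, zero_add, add_zero] at f1 f2 f3
  ext
  · exact hre
  · have h1 : h.imI.fst * h.re.snd = 0 := by linarith
    have h2 : h.imJ.fst * h.re.snd = 0 := by linarith
    have h3 : h.imK.fst * h.re.snd = 0 := by linarith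
    have : h.re.snd = h.imI.fst * (h.imI.fst * h.re.snd) + h.imJ.fst * (h.imJ.fst * h.re.snd) +
        h.imK.fst * (h.imK.fst * h.re.snd) := by linear_combination -h.re.snd * n
    rw [this, h1, h2, h3]; simp

theorem star_eq_neg_of_sq {h : DQ ℝ} (hh : h * h = -1) : star h = -h := by
  have := re_eq_zero_of_sq hh
  ext1 <;> simp [this]

section HalfProj

variable {T : Type*} [CommRing T]

/-- The quaternion `c (1 + ι x)`; a projection if `2 c = 1`, `ι ^ 2 = -1` and `x ^ 2 = -1`. -/
def halfProj (c ι : T) (x : ℍ[T]) : ℍ[T] := c • (1 + ι • x)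

variable {c ι : T} (hc : 2 * c = 1) (hι : ι * ι = -1)

include hc in
theorem one_sub_halfProj (x : ℍ[T]) : 1 - halfProj c ι x = c • (1 - ι • x) := by
  have : (1 : ℍ[T]) = (2 * c) • (1 : ℍ[T]) := by rw [hc, one_smul]
  rw [halfProj]
  nth_rewrite 1 [this]
  module

include hc in
theorem halfProj_neg (x : ℍ[T]) : halfProj c ι (-x) = 1 - halfProj c ι x := by
  rw [one_sub_halfProj hc, halfProj, smul_neg, sub_eq_add_neg]

include hc hι in
theorem isProj_halfProj {x : ℍ[T]} (hx : x * x = -1) (hs : star x = -x) :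
    IsProj (halfProj c ι x) where
  idem := by
    rw [halfProj, smul_mul_smul_comm, mul_add, mul_one, add_mul, one_mul, smul_mul_smul_comm, hι,
      hx, smul_neg, neg_smul, neg_neg, one_smul]
    have : (1 : ℍ[T]) + ι • x + (ι • x + 1) = (2 : T) • (1 + ι • x) := by module
    rw [this, smul_smul, mul_assoc, mul_comm c 2, hc, mul_one]
  star_eq := by
    rw [one_sub_halfProj hc, halfProj, Quaternion.star_smul, star_add, star_one,
      Quaternion.star_smul, hs, smul_neg, sub_eq_add_neg]

include hc hι in
theorem coe_sub_eq_halfProj (x : ℍ[T]) : (ι : ℍ[T]) - x = (2 * ι) • halfProj c ι x := by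
  have h1 : (2 * ι) • halfProj c ι x = (2 * c * ι) • (1 : ℍ[T]) + (2 * c * (ι * ι)) • x := by
    rw [halfProj]; module
  rw [h1, hc, hι, one_mul, one_mul, neg_smul, one_smul, sub_eq_add_neg]
  congr 1
  rw [smul_eq_tr, mul_one]

include hc hι in
theorem coe_add_eq_halfProj (x : ℍ[T]) : (ι : ℍ[T]) + x = (2 * ι) • (1 - halfProj c ι x) := by
  rw [← halfProj_neg hc, ← coe_sub_eq_halfProj hc hι, sub_neg_eq_add]

include hc hι in
theorem eq_halfProj (x : ℍ[T]) : x = ι • (1 - halfProj c ι x) - ι • halfProj c ι x := by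
  have h1 : ι • (1 - halfProj c ι x) - ι • halfProj c ι x = (-(2 * c * (ι * ι))) • x := by
    rw [one_sub_halfProj hc, halfProj]; module
  rw [h1, hc, hι, one_mul, neg_neg, one_smul]

include hc hι in
theorem tr_halfProj_mul {x y : ℍ[T]} (hx : x.re = 0) (hy : y.re = 0) :
    tr (halfProj c ι x * halfProj c ι y) = c * (1 - (x * y).re) := by
  have e : halfProj c ι x * halfProj c ι y =
      (c * c) • (1 + ι • x + ι • y + (ι * ι) • (x * y)) := by
    rw [halfProj, halfProj, smul_mul_smul_comm, mul_add, mul_one, add_mul, one_mul,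
      smul_mul_smul_comm]
    module
  rw [e, tr, hι]
  simp only [Quaternion.re_smul, Quaternion.re_add, hx, hy, Quaternion.re_one, smul_eq_mul,
    mul_zero, add_zero]
  linear_combination (c * (1 - (x * y).re)) * hc

end HalfProj

/-- The complexification of a real dual quaternion. -/
def toC (h : DQ ℝ) : DQ ℂ := mapDQ (algebraMap ℝ ℂ) h

theorem toC_mul (p q : DQ ℝ) : toC (p * q) = toC p * toC q := mapDQ_mul _ _ _

theorem toC_neg (p : DQ ℝ) : toC (-p) = -toC p := mapDQ_neg _ _

theorem toC_one : toC 1 = 1 := mapDQ_one _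

/-- The dual number `1 / 2`. -/
def dualHalf : DualNumber ℂ := TrivSqZeroExt.inl 2⁻¹

/-- The imaginary unit as a dual number. -/
def dualI : DualNumber ℂ := TrivSqZeroExt.inl Complex.I

theorem two_mul_dualHalf : 2 * dualHalf = 1 := by
  ext <;> simp [dualHalf]

theorem dualI_mul_self : dualI * dualI = -1 := by
  ext <;> simp [dualI]

/-- The projection `(1 + i h) / 2 = (i - h) / (2 i)` attached to a line `h`. -/
def proj (h : DQ ℝ) : DQ ℂ := halfProj dualHalf dualI (toC h)

theorem proj_neg (h : DQ ℝ) : proj (-h) = 1 - proj h := by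
  rw [proj, toC_neg]; exact halfProj_neg two_mul_dualHalf _

theorem isProj_proj {h : DQ ℝ} (hh : h * h = -1) : IsProj (proj h) := by
  refine isProj_halfProj two_mul_dualHalf dualI_mul_self ?_ ?_
  · rw [← toC_mul, hh, toC_neg, toC_one]
  · rw [toC, ← mapDQ_star, star_eq_neg_of_sq hh, mapDQ_neg]

theorem iSub_eq (h : DQ ℝ) : iSub h = (2 * dualI) • proj h :=
  coe_sub_eq_halfProj two_mul_dualHalf dualI_mul_self _

theorem iAdd_eq (h : DQ ℝ) : iAdd h = (2 * dualI) • (1 - proj h) :=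
  coe_add_eq_halfProj two_mul_dualHalf dualI_mul_self _

theorem toC_eq (h : DQ ℝ) : toC h = dualI • (1 - proj h) - dualI • proj h :=
  eq_halfProj two_mul_dualHalf dualI_mul_self _

/-- The dual cosine of the dual angle between two lines. -/
def dcos (a b : DQ ℝ) : DualNumber ℝ := -(a * b).re

theorem dcos_fst {a b : DQ ℝ} (ha : a * a = -1) (hb : b * b = -1) :
    (dcos a b).fst = dir a ⬝ᵥ dir b := by
  have h1 := re_eq_zero_of_sq ha
  have h2 := re_eq_zero_of_sq hb
  simp [dcos, dir, h1]; ring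

theorem dcos_snd {a b : DQ ℝ} (ha : a * a = -1) :
    (dcos a b).snd = dir a ⬝ᵥ moment b + moment a ⬝ᵥ dir b := by
  have h1 := re_eq_zero_of_sq ha
  simp [dcos, dir, moment, h1]; ring

/-- A real dual number viewed as a complex one. -/
abbrev dualC (d : DualNumber ℝ) : DualNumber ℂ := mapDual (algebraMap ℝ ℂ) d

theorem tr_proj_mul {a b : DQ ℝ} (ha : a * a = -1) (hb : b * b = -1) :
    tr (proj a * proj b) = dualHalf * (1 + dualC (dcos a b)) := by
  have h1 : (toC a).re = 0 := by rw [toC, re_mapDQ, re_eq_zero_of_sq ha]; ext <;> simp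
  have h2 : (toC b).re = 0 := by rw [toC, re_mapDQ, re_eq_zero_of_sq hb]; ext <;> simp
  have := tr_halfProj_mul two_mul_dualHalf dualI_mul_self h1 h2
  rw [proj, proj]
  refine this.trans ?_
  rw [← toC_mul, toC, re_mapDQ, dcos, dualC, ← mapDualHom_apply, ← mapDualHom_apply, map_neg,
    sub_eq_add_neg]

theorem dcos_sq_ne_one {a b : DQ ℝ} (ha : a * a = -1) (hb : b * b = -1) (hp : ¬Parallel a b) :
    (dcos a b).fst ^ 2 ≠ 1 := by
  obtain ⟨n1, -⟩ := line_spec a ha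
  obtain ⟨n2, -⟩ := line_spec b hb
  rw [dcos_fst ha hb]
  intro h0
  apply hp
  rcases mul_self_eq_one_iff.mp ((sq _).symm.trans h0) with h2 | h2
  · left
    have : (dir a - dir b) ⬝ᵥ (dir a - dir b) = 0 := by
      rw [sub_dotProduct, dotProduct_sub, dotProduct_sub, dotProduct_comm (dir b) (dir a)]
      linarith
    exact sub_eq_zero.mp (dotProduct_self_eq_zero.mp this)
  · right
    have : (dir a + dir b) ⬝ᵥ (dir a + dir b) = 0 := by
      rw [add_dotProduct, dotProduct_add, dotProduct_add, dotProduct_comm (dir b) (dir a)]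
      linarith
    exact eq_neg_of_add_eq_zero_left (dotProduct_self_eq_zero.mp this)

theorem not_parallel_of_dcos {a b : DQ ℝ} (ha : a * a = -1) (hb : b * b = -1)
    (h : (dcos a b).fst ^ 2 ≠ 1) : ¬Parallel a b := by
  obtain ⟨n2, -⟩ := line_spec b hb
  rw [dcos_fst ha hb] at h
  rintro (hp | hp) <;> rw [hp] at h <;> simp [n2] at h

theorem isUnit_dual {d : DualNumber ℂ} : IsUnit d ↔ d.fst ≠ 0 := by
  rw [TrivSqZeroExt.isUnit_iff_isUnit_fst, isUnit_iff_ne_zero]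

theorem sq_neg_eq {h : DQ ℝ} (hh : h * h = -1) : -h * -h = -1 := by rw [DQ.neg_mul_neg, hh]

theorem dcos_neg_right (a b : DQ ℝ) : dcos a (-b) = -dcos a b := by
  simp only [dcos, DQ.mul_neg, Quaternion.re_neg]

theorem dcos_neg_left (a b : DQ ℝ) : dcos (-a) b = -dcos a b := by
  simp only [dcos, DQ.neg_mul, Quaternion.re_neg]

theorem tr_proj_mul_compl {a b : DQ ℝ} (ha : a * a = -1) (hb : b * b = -1) :
    tr (proj a * (1 - proj b)) = dualHalf * (1 - dualC (dcos a b)) := by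
  rw [← proj_neg, tr_proj_mul ha (sq_neg_eq hb), dcos_neg_right, dualC, ← mapDualHom_apply, map_neg,
    sub_eq_add_neg, mapDualHom_apply]

theorem genPos_proj {a b : DQ ℝ} (ha : a * a = -1) (hb : b * b = -1) (hp : ¬Parallel a b) :
    GenPos (proj a) (proj b) := by
  have h := dcos_sq_ne_one ha hb hp
  constructor
  · rw [tr_proj_mul ha hb, isUnit_dual]
    simp only [TrivSqZeroExt.fst_mul, TrivSqZeroExt.fst_add, TrivSqZeroExt.fst_one, fst_mapDual,
      dualHalf, TrivSqZeroExt.fst_inl]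
    intro h0
    apply h
    have : (1 : ℂ) + ((dcos a b).fst : ℝ) = 0 := by simpa using h0
    have h1 : (1 : ℝ) + (dcos a b).fst = 0 := by exact_mod_cast this
    have h2 : (dcos a b).fst = -1 := by linarith
    rw [h2]; norm_num
  · rw [tr_proj_mul_compl ha hb, isUnit_dual]
    simp only [TrivSqZeroExt.fst_mul, TrivSqZeroExt.fst_sub, TrivSqZeroExt.fst_one, fst_mapDual,
      dualHalf, TrivSqZeroExt.fst_inl]
    intro h0
    apply h
    have : (1 : ℂ) - ((dcos a b).fst : ℝ) = 0 := by simpa using h0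
    have h1 : (1 : ℝ) - (dcos a b).fst = 0 := by exact_mod_cast this
    have h2 : (dcos a b).fst = 1 := by linarith
    rw [h2]; norm_num

end Linkage

end

noncomputable section
namespace Linkage

open Quaternion

/-! ### Functionals on products of three factors -/

section CouplingFunctional

variable {h₁ h₂ h₃ : DQ ℝ}

/-- The two basis elements `1, h` of the commutative algebra of a line. -/
def linePow (h : DQ ℝ) : Fin 2 → DQ ℝ := ![1, h]

/-- The spanning set of the coupling space consists of the eight products of one basis element `1,
h` per line, so full dimension means that they are independent. -/
theorem linearIndependent_coupling (hd : Module.finrank ℝ (couplingSpace h₁ h₂ h₃) = 8) :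
    LinearIndependent ℝ fun i : Fin 2 × Fin 2 × Fin 2 =>
      linePow h₁ i.1 * linePow h₂ i.2.1 * linePow h₃ i.2.2 := by
  have : Set.range (fun i : Fin 2 × Fin 2 × Fin 2 =>
      linePow h₁ i.1 * linePow h₂ i.2.1 * linePow h₃ i.2.2) =
      {1, h₁, h₂, h₃, h₁ * h₂, h₁ * h₃, h₂ * h₃, h₁ * h₂ * h₃} := by
    ext q
    simp only [linePow, Set.mem_range, Prod.exists, Fin.exists_fin_two, Matrix.cons_val_zero,
      Matrix.cons_val_one, DQ.one_mul, DQ.mul_one, Set.mem_insert_iff, Set.mem_singleton_iff,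
      eq_comm (b := q)]
    tauto
  rw [linearIndependent_iff_card_eq_finrank_span, Set.finrank, this, ← couplingSpace, hd]
  rfl

/-- The functional is the combination with coefficients `π` of the dual basis of the eight products;
the dual basis is real and is extended to ℂ coefficientwise. -/
theorem exists_functional_linePow (hd : Module.finrank ℝ (couplingSpace h₁ h₂ h₃) = 8)
    (π : Fin 2 × Fin 2 × Fin 2 → ℂ) :
    ∃ φ : Fin 8 → ℂ, ∀ i, ev (S := ℂ) φ (toC (linePow h₁ i.1 * linePow h₂ i.2.1 * linePow h₃ i.2.2)) =
      π i := by
  obtain ⟨v, hv⟩ : ∃ v : Fin 2 × Fin 2 × Fin 2 → DQ ℝ,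
      v = fun i => linePow h₁ i.1 * linePow h₂ i.2.1 * linePow h₃ i.2.2 := ⟨_, rfl⟩
  have li : LinearIndependent ℝ fun i => coord (v i) := by
    rw [hv]; exact linearIndependent_coord (linearIndependent_coupling hd)
  let B := basisOfLinearIndependentOfCardEqFinrank li (by simp)
  refine ⟨fun c => ∑ j, π j * ((B.coord j (Pi.single c 1) : ℝ) : ℂ), fun i => ?_⟩
  have key : ∀ (x : Fin 8 → ℝ) (j), B.coord j x = ∑ c, B.coord j (Pi.single c 1) * x c := by
    intro x j
    conv_lhs => rw [← Finset.univ_sum_single x, map_sum]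
    refine Finset.sum_congr rfl fun c _ => ?_
    have : (Pi.single c (x c) : Fin 8 → ℝ) = x c • Pi.single c (1 : ℝ) := by
      rw [← Pi.single_smul, smul_eq_mul, mul_one]
    rw [this, map_smul, smul_eq_mul, mul_comm]
  have hB : ∀ i, B i = coord (v i) := fun i => by simp [B]
  have e : ∀ j, (((B.coord j (B i)) : ℝ) : ℂ) =
      ∑ c, ((B.coord j (Pi.single c 1) : ℝ) : ℂ) * ((coord (v i) c : ℝ) : ℂ) := by
    intro j; rw [hB, key]; push_cast; rfl
  have hvi : linePow h₁ i.1 * linePow h₂ i.2.1 * linePow h₃ i.2.2 = v i := by rw [hv]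
  rw [hvi, ev_apply]
  calc _ = ∑ j, π j * (((B.coord j (B i)) : ℝ) : ℂ) := by
        simp only [e, Finset.mul_sum, Algebra.algebraMap_self, RingHom.id_apply, toC, coord_mapDQ,
          Finset.sum_mul]
        rw [Finset.sum_comm]
        refine Finset.sum_congr rfl fun j _ => Finset.sum_congr rfl fun c _ => ?_
        rw [mul_assoc]; rfl
    _ = π i := by
        simp [Finsupp.single_apply, apply_ite]

/-- A rotation factor with homogeneous parameters `a, b`. -/
def factor {S : Type*} [CommRing S] [Algebra ℂ S] (h : DQ ℝ) (a b : S) : DQ S :=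
  (TrivSqZeroExt.inl a : DualNumber S) • mapDQ (algebraMap ℂ S) (proj h) +
    (TrivSqZeroExt.inl b : DualNumber S) • (1 - mapDQ (algebraMap ℂ S) (proj h))

theorem mapDQ_halfProj {R S : Type*} [CommRing R] [CommRing S] (f : R →+* S) (c ι : DualNumber R)
    (q : DQ R) : mapDQ f (halfProj c ι q) = halfProj (mapDual f c) (mapDual f ι) (mapDQ f q) := by
  have h1 : mapDQ f (1 + ι • q) = 1 + mapDual f ι • mapDQ f q := by
    rw [mapDQ_add, mapDQ_one, mapDQ_smul]
  exact (mapDQ_smul f c (1 + ι • q)).trans (congrArg _ h1)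

theorem factor_halfProj {T : Type*} [CommRing T] {c ι : T} (hc : 2 * c = 1) (a b : T) (x : ℍ[T]) :
    a • halfProj c ι x + b • (1 - halfProj c ι x) =
      (c * (a + b)) • (1 : ℍ[T]) + (c * (ι * (a - b))) • x := by
  rw [one_sub_halfProj hc, halfProj]; module

theorem factor_eq {S : Type*} [CommRing S] [Algebra ℂ S] (h : DQ ℝ) (a b : S) :
    factor h a b = (algebraMap ℂ S 2⁻¹ * (a + b)) • (1 : DQ S)
      + (algebraMap ℂ S 2⁻¹ * (algebraMap ℂ S Complex.I * (a - b))) •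
        mapDQ (algebraMap ℂ S) (toC h) := by
  have hc : 2 * mapDual (algebraMap ℂ S) dualHalf = 1 := by
    have := congrArg (mapDualHom (algebraMap ℂ S)) two_mul_dualHalf
    simpa only [map_mul, map_ofNat, map_one, mapDualHom_apply] using this
  have e := factor_halfProj hc (ι := mapDual (algebraMap ℂ S) dualI)
    (TrivSqZeroExt.inl a) (TrivSqZeroExt.inl b) (mapDQ (algebraMap ℂ S) (toC h))
  rw [factor, proj, mapDQ_halfProj, smul_eq_inl_smul, smul_eq_inl_smul]
  refine e.trans ?_
  congr 2 <;> ext <;> simp [dualHalf, dualI]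

/-- There are functionals on products of three factors with prescribed product values. -/
theorem exists_functional.{u} (hd : Module.finrank ℝ (couplingSpace h₁ h₂ h₃) = 8)
    (p q : Fin 3 → ℂ) :
    ∃ φ : Fin 8 → ℂ, ∀ (S : Type u) [CommRing S] [Algebra ℂ S] (a₁ b₁ a₂ b₂ a₃ b₃ : S),
      ev φ (factor h₁ a₁ b₁ * factor h₂ a₂ b₂ * factor h₃ a₃ b₃) =
        (p 0 • a₁ + q 0 • b₁) * (p 1 • a₂ + q 1 • b₂) * (p 2 • a₃ + q 2 • b₃) := by
  -- A functional with value `p` on `proj h` and `q` on `1 - proj h` has the value `p + q` on `1`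
  -- and `i (q - p)` on `h`, because `h = i (1 - proj h) - i proj h`.
  let l : Fin 3 → Fin 2 → ℂ := fun j => ![p j + q j, Complex.I * (q j - p j)]
  obtain ⟨φ, hφ⟩ := exists_functional_linePow hd fun i => l 0 i.1 * l 1 i.2.1 * l 2 i.2.2
  refine ⟨φ, fun S _ _ a₁ b₁ a₂ b₂ a₃ b₃ => ?_⟩
  have key : ∀ i j k : Fin 2, ev φ (mapDQ (algebraMap ℂ S) (toC (linePow h₁ i)) *
      mapDQ (algebraMap ℂ S) (toC (linePow h₂ j)) * mapDQ (algebraMap ℂ S) (toC (linePow h₃ k))) =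
      algebraMap ℂ S (l 0 i * l 1 j * l 2 k) := by
    intro i j k
    rw [← mapDQ_mul, ← mapDQ_mul, ← toC_mul, ← toC_mul, ev_mapDQ]
    exact congrArg _ (hφ (i, j, k))
  have hf : ∀ (h : DQ ℝ) (a b : S), factor h a b =
      (algebraMap ℂ S 2⁻¹ * (a + b)) • mapDQ (algebraMap ℂ S) (toC (linePow h 0)) +
      (algebraMap ℂ S 2⁻¹ * (algebraMap ℂ S Complex.I * (a - b))) •
        mapDQ (algebraMap ℂ S) (toC (linePow h 1)) := by
    intro h a b
    have e0 : linePow h 0 = 1 := rfl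
    have e1 : linePow h 1 = h := rfl
    rw [factor_eq, e0, e1, toC_one, mapDQ_one]
  have hl : ∀ (j : Fin 3) (a b : S), p j • a + q j • b =
      algebraMap ℂ S 2⁻¹ * (a + b) * algebraMap ℂ S (l j 0) +
      algebraMap ℂ S 2⁻¹ * (algebraMap ℂ S Complex.I * (a - b)) * algebraMap ℂ S (l j 1) := by
    intro j a b
    have h2 : algebraMap ℂ S 2⁻¹ * 2 = 1 := by
      rw [← map_ofNat (algebraMap ℂ S) 2, ← map_mul]; norm_num
    have hI : algebraMap ℂ S Complex.I * algebraMap ℂ S Complex.I = -1 := by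
      rw [← map_mul, Complex.I_mul_I, map_neg, map_one]
    simp only [l, Matrix.cons_val_zero, Matrix.cons_val_one, map_mul, map_add, map_sub,
      Algebra.smul_def]
    linear_combination (-(algebraMap ℂ S (p j) * a + algebraMap ℂ S (q j) * b)) * h2 -
      algebraMap ℂ S 2⁻¹ * (a - b) * (algebraMap ℂ S (q j) - algebraMap ℂ S (p j)) * hI
  rw [hf, hf, hf, hl, hl, hl]
  simp only [mul_add, add_mul, DQ.smul_mul, DQ.mul_smul, map_add, map_smul, key, smul_eq_mul,
    map_mul]
  ring

end CouplingFunctional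

end Linkage

end

noncomputable section
namespace Linkage

open Quaternion Polynomial

/-! ### Generators -/

theorem isUnit_two_dualI : IsUnit (2 * dualI) := by
  rw [isUnit_dual]; simp [dualI]

theorem isGen_of_isUnit {T : Type*} [CommRing T] {e f g : ℍ[T]} {d : T} (hd : IsUnit d)
    (hg : IsGen e f g) : IsGen e f (d • g) where
  left := by rw [mul_smul_comm, hg.left]
  right := by rw [smul_mul_assoc, hg.right, smul_zero]
  unit := by
    obtain ⟨w, hw⟩ := hg.unit
    exact ⟨w, by rw [mul_smul_comm, tr_smul]; exact hd.mul hw⟩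

theorem IsGen.mul_smul_left {T : Type*} [CommRing T] {e f g : ℍ[T]} (hg : IsGen e f g) (d : T) :
    e * d • g = d • g := by rw [mul_smul_comm, hg.left]

theorem IsGen.smul_mul_right {T : Type*} [CommRing T] {e f g : ℍ[T]} (hg : IsGen e f g) (d : T) :
    d • g * f = 0 := by rw [smul_mul_assoc, hg.right, smul_zero]

theorem tr_mul_smul {T : Type*} [CommRing T] (d : T) (w g : ℍ[T]) :
    tr (w * d • g) = d * tr (w * g) := by rw [mul_smul_comm, tr_smul]

theorem quat_one_smul {T : Type*} [CommRing T] (g : ℍ[T]) : (1 : T) • g = g := one_smul _ _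

theorem quat_smul_mul_smul {T : Type*} [CommRing T] (c d : T) (p q : ℍ[T]) :
    c • p * d • q = (c * d) • (p * q) := smul_mul_smul_comm c p d q

theorem isGen_mul_compl {T : Type*} [CommRing T] {e f : ℍ[T]} (he : IsProj e) (hf : IsProj f)
    (h : IsUnit (tr (e * (1 - f)))) : IsGen e f (e * (1 - f)) where
  left := by rw [← mul_assoc, he.idem]
  right := by rw [mul_assoc, hf.compl_mul, mul_zero]
  unit := ⟨1, by rwa [one_mul]⟩

/-- For parallel lines `e * (1 - f)` can fail to generate. A third projection `k` in general
position to both replaces it, and the trace against `k` itself is a product of two units. -/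
theorem isGen_mul_mul_compl {T : Type*} [CommRing T] {e f k : ℍ[T]} (he : IsProj e) (hf : IsProj f)
    (hk : IsProj k) (h1 : IsUnit (tr (k * e))) (h2 : IsUnit (tr (k * (1 - f)))) :
    IsGen e f (e * k * (1 - f)) where
  left := by rw [mul_assoc e k, ← mul_assoc, he.idem]
  right := by rw [mul_assoc, hf.compl_mul, mul_zero]
  unit := ⟨k, by
    have : k * (e * k * (1 - f)) = tr (k * e) • (k * (1 - f)) := by
      rw [← mul_assoc, ← mul_assoc, hk.sandwich, smul_mul_assoc]
    rw [this, tr_smul]; exact h1.mul h2⟩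

theorem smul_eq_zero_iff_of_isUnit {T : Type*} [CommRing T] {d : T} (hd : IsUnit d) {q : ℍ[T]} :
    d • q = 0 ↔ q = 0 := by
  obtain ⟨u, rfl⟩ := hd
  constructor
  · intro h
    have := congrArg (fun x => (↑u⁻¹ : T) • x) h
    simpa [smul_smul] using this
  · rintro rfl; simp

theorem isLineGenerator_iff {T : Type*} [CommRing T] {e f i j q : ℍ[T]} {d : T} (hd : IsUnit d)
    (he : IsProj e) (hi : i = d • e) (hj : j = d • f) :
    ((∃ a, q = i * a) ∧ q * j = 0) ↔ e * q = q ∧ q * f = 0 := by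
  subst hi hj
  rw [mul_smul_comm, smul_eq_zero_iff_of_isUnit hd]
  refine and_congr_left fun _ => ⟨?_, fun h => ?_⟩
  · rintro ⟨a, rfl⟩
    rw [smul_mul_assoc, mul_smul_comm, ← mul_assoc, he.idem]
  · obtain ⟨u, rfl⟩ := hd
    refine ⟨(↑u⁻¹ : T) • q, ?_⟩
    rw [smul_mul_assoc, mul_smul_comm, smul_smul, h]; simp

theorem isLineGenerator_of_isGen {h₁ h₄ : DQ ℝ} (H₁ : h₁ * h₁ = -1) (H₄ : h₄ * h₄ = -1) {g : DQ ℂ}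
    (hg : IsGen (proj h₁) (proj h₄) g) : IsLineGenerator h₁ h₄ g := by
  intro q
  refine (isLineGenerator_iff isUnit_two_dualI (isProj_proj H₁) (iSub_eq h₁) (iSub_eq h₄)).trans
    ⟨fun ⟨h1, h2⟩ => ?_, ?_⟩
  · obtain ⟨d, hd⟩ := hg.exists_smul (isProj_proj H₁) (isProj_proj H₄) h1 h2
    exact ⟨d, hd.trans (smul_eq_tr _ _)⟩
  · rintro ⟨d, hd⟩
    have : q = d • g := hd.trans (smul_eq_tr _ _).symm
    rw [this]
    exact ⟨hg.mul_smul_left d, hg.smul_mul_right d⟩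

/-- A known generator `g₀` is a multiple `d • g`, so a unit trace of `g₀` forces a unit trace of
`g`. This covers generators that are only chosen, not computed. -/
theorem isGen_of_isLineGenerator {h₁ h₄ : DQ ℝ} (H₁ : h₁ * h₁ = -1) {g g₀ : DQ ℂ}
    (hg₀ : IsGen (proj h₁) (proj h₄) g₀) (hg : IsLineGenerator h₁ h₄ g) :
    IsGen (proj h₁) (proj h₄) g := by
  have key : ∀ q : DQ ℂ, (proj h₁ * q = q ∧ q * proj h₄ = 0) ↔ ∃ d : DualNumber ℂ, q = d • g := by
    intro q
    refine (isLineGenerator_iff isUnit_two_dualI (isProj_proj H₁) (iSub_eq h₁)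
      (iSub_eq h₄)).symm.trans ((hg q).trans ?_)
    refine exists_congr fun d => ?_
    rw [smul_eq_tr]
  obtain ⟨h1, h2⟩ := (key g).mpr ⟨1, (quat_one_smul g).symm⟩
  obtain ⟨d, hd⟩ := (key g₀).mp ⟨hg₀.left, hg₀.right⟩
  refine ⟨h1, h2, ?_⟩
  obtain ⟨w, hw⟩ := hg₀.unit
  refine ⟨w, ?_⟩
  have e : tr (w * g₀) = d * tr (w * g) := by
    rw [hd]; exact tr_mul_smul d w g
  rw [e] at hw
  exact isUnit_of_mul_isUnit_right hw

/-- If `h₁` and `h₄` are parallel, then `h₂` is parallel to neither and supplies the auxiliary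
projection; hence a generator exists and the arbitrary choice is one. -/
theorem isGen_lineGenerator {h₁ h₂ h₄ : DQ ℝ} (H₁ : h₁ * h₁ = -1) (H₂ : h₂ * h₂ = -1)
    (H₄ : h₄ * h₄ = -1) (hp : ¬Parallel h₁ h₂) :
    IsGen (proj h₁) (proj h₄) (lineGenerator h₁ h₄) := by
  rw [lineGenerator]
  split_ifs with h
  · have hp' : ¬Parallel h₄ h₂ := by
      rintro (h' | h') <;> rcases h with h | h <;> refine hp ?_
      · exact Or.inl (h.trans h')
      · exact Or.inr (by rw [h, h'])
      · exact Or.inr (h.trans h')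
      · exact Or.inl (by rw [h, h', neg_neg])
    have g1 := genPos_proj H₁ H₂ hp
    have g2 := (genPos_proj H₄ H₂ hp').symm (isProj_proj H₄) (isProj_proj H₂)
    have h0 := isGen_mul_mul_compl (isProj_proj H₁) (isProj_proj H₄) (isProj_proj H₂)
      (g1.symm (isProj_proj H₁) (isProj_proj H₂)).unit g2.unit_compl
    exact isGen_of_isLineGenerator H₁ h0
      (Classical.epsilon_spec ⟨_, isLineGenerator_of_isGen H₁ H₄ h0⟩)
  · have h0 := isGen_mul_compl (isProj_proj H₁) (isProj_proj H₄)
      (genPos_proj H₁ H₄ h).unit_compl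
    have e : iSub h₁ * iAdd h₄ = ((2 * dualI) * (2 * dualI)) • (proj h₁ * (1 - proj h₄)) := by
      rw [iSub_eq, iAdd_eq]
      exact quat_smul_mul_smul _ _ _ _
    rw [e]
    exact isGen_of_isUnit (isUnit_two_dualI.mul isUnit_two_dualI) h0

/-! ### The equation of a quad -/

section QuadSol

variable {S : Type*} [CommRing S]

/-- The equations `a₃ (a₂ α + b₂ β) = y₀ + y₁ ε = b₃ (a₂ α' + b₂ β')`, written in components. -/
structure QuadSol (α β α' β' : DualNumber S) (y₀ y₁ a₂ b₂ a₃ b₃ : S) : Prop where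
  fst : a₃ * (a₂ * α.fst + b₂ * β.fst) = y₀
  snd : a₃ * (a₂ * α.snd + b₂ * β.snd) = y₁
  fst' : b₃ * (a₂ * α'.fst + b₂ * β'.fst) = y₀
  snd' : b₃ * (a₂ * α'.snd + b₂ * β'.snd) = y₁

variable {α β α' β' : DualNumber S} {y₀ y₁ a₂ b₂ a₃ b₃ : S}

theorem quadSol_iff {d : DualNumber S} :
    ((TrivSqZeroExt.inl a₃ : DualNumber S) * (TrivSqZeroExt.inl a₂ * α + TrivSqZeroExt.inl b₂ * β) = d ∧
      (TrivSqZeroExt.inl b₃ : DualNumber S) * (TrivSqZeroExt.inl a₂ * α' + TrivSqZeroExt.inl b₂ * β') = d) ↔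
      QuadSol α β α' β' d.fst d.snd a₂ b₂ a₃ b₃ := by
  constructor
  · rintro ⟨h1, h2⟩
    have e1 := congrArg TrivSqZeroExt.fst h1
    have e2 := congrArg TrivSqZeroExt.snd h1
    have e3 := congrArg TrivSqZeroExt.fst h2
    have e4 := congrArg TrivSqZeroExt.snd h2
    simp at e1 e2 e3 e4
    exact ⟨e1, e2, e3, e4⟩
  · rintro ⟨h1, h2, h3, h4⟩
    constructor <;> ext <;> simp [h1, h2, h3, h4]

/-- The determinant of the primal and dual parts of two dual numbers. -/
def ddet (α β : DualNumber S) : S := α.fst * β.snd - α.snd * β.fst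

namespace QuadSol

theorem a₂a₃ (h : QuadSol α β α' β' y₀ y₁ a₂ b₂ a₃ b₃) :
    ddet α β * (a₂ * a₃) = y₀ * β.snd - y₁ * β.fst := by
  rw [← h.fst, ← h.snd, ddet]; ring

theorem b₂a₃ (h : QuadSol α β α' β' y₀ y₁ a₂ b₂ a₃ b₃) :
    ddet α β * (b₂ * a₃) = y₁ * α.fst - y₀ * α.snd := by
  rw [← h.fst, ← h.snd, ddet]; ring

theorem a₂b₃ (h : QuadSol α β α' β' y₀ y₁ a₂ b₂ a₃ b₃) :
    ddet α' β' * (a₂ * b₃) = y₀ * β'.snd - y₁ * β'.fst := by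
  rw [← h.fst', ← h.snd', ddet]; ring

theorem b₂b₃ (h : QuadSol α β α' β' y₀ y₁ a₂ b₂ a₃ b₃) :
    ddet α' β' * (b₂ * b₃) = y₁ * α'.fst - y₀ * α'.snd := by
  rw [← h.fst', ← h.snd', ddet]; ring

/-- The products of `a₂, b₂` with `a₃, b₃` form a matrix of rank one. Up to the two determinants its
entries are linear in `y₀, y₁`, so its vanishing determinant is a binary quadratic form in them. -/
theorem hom_eq_zero (h : QuadSol α β α' β' y₀ y₁ a₂ b₂ a₃ b₃) :
    (y₁ * β.fst - y₀ * β.snd) * (y₁ * α'.fst - y₀ * α'.snd) -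
      (y₁ * α.fst - y₀ * α.snd) * (y₁ * β'.fst - y₀ * β'.snd) = 0 := by
  rw [← h.b₂b₃, ← h.b₂a₃]
  linear_combination ddet α' β' * (b₂ * b₃) * h.a₂a₃ - ddet α β * (b₂ * a₃) * h.a₂b₃

/-- Solutions with `y₀ = 0` are excluded over any ring: the normalized parameters make `y₀, y₁`
generate the unit ideal, while `hom_eq_zero` puts a unit multiple of `y₁ ^ 2` into the ideal of
`y₀`. -/
theorem isUnit_y₀ (h : QuadSol α β α' β' y₀ y₁ a₂ b₂ a₃ b₃) (hd : IsUnit (ddet α β))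
    (hd' : IsUnit (ddet α' β')) (hl : IsUnit (β.fst * α'.fst - α.fst * β'.fst))
    {p₂ q₂ p₃ q₃ : S} (h2 : p₂ * a₂ + q₂ * b₂ = 1) (h3 : p₃ * a₃ + q₃ * b₃ = 1) : IsUnit y₀ := by
  -- Expand the product of the two normalization conditions, which is one, into the four products of
  -- parameters; each is linear in `y₀, y₁`.
  obtain ⟨k, m, hkm⟩ : ∃ k m, ddet α β * ddet α' β' = y₁ * k + y₀ * m := by
    refine ⟨ddet α' β' * p₂ * p₃ * (-β.fst) + ddet α' β' * q₂ * p₃ * α.fst +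
      ddet α β * p₂ * q₃ * (-β'.fst) + ddet α β * q₂ * q₃ * α'.fst,
      ddet α' β' * p₂ * p₃ * β.snd - ddet α' β' * q₂ * p₃ * α.snd +
      ddet α β * p₂ * q₃ * β'.snd - ddet α β * q₂ * q₃ * α'.snd, ?_⟩
    have : ddet α β * ddet α' β' * ((p₂ * a₂ + q₂ * b₂) * (p₃ * a₃ + q₃ * b₃)) =
        ddet α β * ddet α' β' := by rw [h2, h3]; ring
    rw [← this]
    linear_combination ddet α' β' * p₂ * p₃ * h.a₂a₃ + ddet α' β' * q₂ * p₃ * h.b₂a₃ +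
      ddet α β * p₂ * q₃ * h.a₂b₃ + ddet α β * q₂ * q₃ * h.b₂b₃
  obtain ⟨l, hle⟩ : ∃ l, (β.fst * α'.fst - α.fst * β'.fst) * y₁ ^ 2 = y₀ * l := by
    refine ⟨y₁ * (β.fst * α'.snd + β.snd * α'.fst - α.fst * β'.snd - α.snd * β'.fst) -
      y₀ * (β.snd * α'.snd - α.snd * β'.snd), ?_⟩
    linear_combination h.hom_eq_zero
  -- Square the relation `hkm`; the only term not visibly divisible by `y₀` is the one with `y₁ ^
  -- 2`, which `hle` handles.
  have e : y₀ * (l * k ^ 2 + (β.fst * α'.fst - α.fst * β'.fst) * (2 * y₁ * k * m + y₀ * m ^ 2)) =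
      (β.fst * α'.fst - α.fst * β'.fst) * (ddet α β * ddet α' β') ^ 2 := by
    rw [hkm]; linear_combination (-k ^ 2) * hle
  exact isUnit_of_mul_isUnit_left (e ▸ hl.mul ((hd.mul hd').pow 2))

end QuadSol

end QuadSol

/-- The numerator polynomial of a quad. -/
def quadNum (α β α' β' : DualNumber ℂ) : ℂ[X] :=
  (C β.fst * X - C β.snd) * (C α'.fst * X - C α'.snd) -
    (C α.fst * X - C α.snd) * (C β'.fst * X - C β'.snd)

/-- Nondegenerate structure constants. -/
structure NonDeg (α β α' β' : DualNumber ℂ) : Prop where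
  det : ddet α β ≠ 0
  det' : ddet α' β' ≠ 0
  lead : β.fst * α'.fst - α.fst * β'.fst ≠ 0

theorem QuadSol.aeval_quadNum {S : Type*} [CommRing S] [Algebra ℂ S] {α β α' β' : DualNumber ℂ}
    (hn : NonDeg α β α' β') {y₀ y₁ a₂ b₂ a₃ b₃ : S}
    (h : QuadSol (mapDual (algebraMap ℂ S) α) (mapDual (algebraMap ℂ S) β)
      (mapDual (algebraMap ℂ S) α') (mapDual (algebraMap ℂ S) β') y₀ y₁ a₂ b₂ a₃ b₃)
    {p₂ q₂ p₃ q₃ : S} (h2 : p₂ * a₂ + q₂ * b₂ = 1) (h3 : p₃ * a₃ + q₃ * b₃ = 1) :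
    IsUnit y₀ ∧ ∀ x, y₁ = y₀ * x → aeval x (quadNum α β α' β') = 0 := by
  have hu : IsUnit y₀ := by
    refine h.isUnit_y₀ ?_ ?_ ?_ h2 h3
    · have := (isUnit_iff_ne_zero.mpr hn.det).map (algebraMap ℂ S)
      simpa [ddet] using this
    · have := (isUnit_iff_ne_zero.mpr hn.det').map (algebraMap ℂ S)
      simpa [ddet] using this
    · have := (isUnit_iff_ne_zero.mpr hn.lead).map (algebraMap ℂ S)
      simpa using this
  refine ⟨hu, fun x hx => ?_⟩
  have e := h.hom_eq_zero
  simp only [fst_mapDual, snd_mapDual, hx] at e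
  apply (hu.mul hu).mul_left_cancel
  simp only [quadNum, map_sub, map_mul, aeval_C, aeval_X]
  linear_combination e

end Linkage

end

noncomputable section
namespace Linkage

open Quaternion Polynomial

/-! ### The elimination ideal of a quad -/

section Chart

variable {S : Type*} [CommRing S] [Algebra ℂ S]

/-- The imaginary unit in a `ℂ`-algebra. -/
abbrev imag (S : Type*) [CommRing S] [Algebra ℂ S] : S := algebraMap ℂ S Complex.I

theorem imag_mul_self : imag S * imag S = -1 := by
  rw [← map_mul, Complex.I_mul_I, map_neg, map_one]

theorem algebraMap_half_mul_two : algebraMap ℂ S 2⁻¹ * 2 = 1 := by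
  rw [← map_ofNat (algebraMap ℂ S) 2, ← map_mul]; norm_num

/-- The first homogeneous parameter of a rotation in a chart. -/
def chartA (c : Bool) (t : S) : S := if c then 1 + imag S * t else t + imag S

/-- The second homogeneous parameter of a rotation in a chart. -/
def chartB (c : Bool) (t : S) : S := if c then 1 - imag S * t else t - imag S

/-- The linear form in the parameters that is one in a chart. -/
def chartForm (c : Bool) (a b : S) : S :=
  if c then algebraMap ℂ S 2⁻¹ * (a + b) else -(algebraMap ℂ S 2⁻¹ * (imag S * (a - b)))

theorem chartForm_self (c : Bool) (t : S) : chartForm c (chartA c t) (chartB c t) = 1 := by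
  have h2 := algebraMap_half_mul_two (S := S)
  have hI := imag_mul_self (S := S)
  cases c
  · simp only [chartForm, chartA, chartB, Bool.false_eq_true, if_false]
    linear_combination (-algebraMap ℂ S 2⁻¹ * 2) * hI + h2
  · simp only [chartForm, chartA, chartB, if_true]
    linear_combination h2

/-- After normalization by the form of one chart, the affine coordinate of that chart is the value
of the other form. -/
theorem chartA_form (c : Bool) {a b : S} (h : chartForm c a b = 1) :
    chartA c (chartForm (!c) a b) = a := by
  have h2 := algebraMap_half_mul_two (S := S)
  have hI := imag_mul_self (S := S)
  cases c
  · simp only [chartForm, chartA, Bool.false_eq_true, if_false, Bool.not_false, if_true] at h ⊢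
    linear_combination (-imag S) * h + (-algebraMap ℂ S 2⁻¹ * (a - b)) * hI + a * h2
  · simp only [chartForm, chartA, Bool.false_eq_true, if_false, Bool.not_true, if_true] at h ⊢
    linear_combination -h + (-algebraMap ℂ S 2⁻¹ * (a - b)) * hI + a * h2

theorem chartB_form (c : Bool) {a b : S} (h : chartForm c a b = 1) :
    chartB c (chartForm (!c) a b) = b := by
  have h2 := algebraMap_half_mul_two (S := S)
  have hI := imag_mul_self (S := S)
  cases c
  · simp only [chartForm, chartB, Bool.false_eq_true, if_false, Bool.not_false, if_true] at h ⊢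
    linear_combination (imag S) * h + (algebraMap ℂ S 2⁻¹ * (a - b)) * hI + b * h2
  · simp only [chartForm, chartB, Bool.false_eq_true, if_false, Bool.not_true, if_true] at h ⊢
    linear_combination -h + (algebraMap ℂ S 2⁻¹ * (a - b)) * hI + b * h2

theorem mapDQ_comp_algebraMap (Ψ : ElimRing →ₐ[ℂ] S) (h : DQ ℝ) :
    mapDQ Ψ.toRingHom (mapDQ (algebraMap ℝ ElimRing) h) = mapDQ (algebraMap ℂ S) (toC h) := by
  rw [toC, mapDQ_mapDQ, mapDQ_mapDQ]
  congr 1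
  ext r
  change Ψ (algebraMap ℝ ElimRing r) = _
  rw [IsScalarTower.algebraMap_apply ℝ ℂ ElimRing, AlgHom.commutes]; rfl

theorem mapDQ_mapDQ_C (Ψ : ElimRing →ₐ[ℂ] S) (q : DQ ℂ) :
    mapDQ Ψ.toRingHom (mapDQ MvPolynomial.C q) = mapDQ (algebraMap ℂ S) q := by
  rw [mapDQ_mapDQ]
  congr 1
  ext r
  exact Ψ.commutes r

theorem sub_eq_factor (h : DQ ℝ) (t : S) :
    scalar t - mapDQ (algebraMap ℂ S) (toC h) = factor h (t + imag S) (t - imag S) := by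
  have h2 := algebraMap_half_mul_two (S := S)
  have hI := imag_mul_self (S := S)
  rw [factor_eq, scalar_eq_smul]
  have e1 : algebraMap ℂ S 2⁻¹ * (t + imag S + (t - imag S)) = t := by linear_combination t * h2
  have e2 : algebraMap ℂ S 2⁻¹ * (algebraMap ℂ S Complex.I * (t + imag S - (t - imag S))) = -1 := by
    linear_combination (algebraMap ℂ S 2⁻¹ * 2) * hI - h2
  rw [e1, e2, DQ.neg_smul, DQ.one_smul, sub_eq_add_neg]

theorem one_sub_eq_factor (h : DQ ℝ) (t : S) :
    1 - scalar t * mapDQ (algebraMap ℂ S) (toC h) =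
      factor h (1 + imag S * t) (1 - imag S * t) := by
  have h2 := algebraMap_half_mul_two (S := S)
  have hI := imag_mul_self (S := S)
  rw [factor_eq, scalar_mul]
  have e1 : algebraMap ℂ S 2⁻¹ * (1 + imag S * t + (1 - imag S * t)) = 1 := by
    linear_combination h2
  have e2 : algebraMap ℂ S 2⁻¹ * (algebraMap ℂ S Complex.I *
      (1 + imag S * t - (1 - imag S * t))) = -t := by
    linear_combination (algebraMap ℂ S 2⁻¹ * 2 * t) * hI - t * h2
  rw [e1, e2, DQ.neg_smul, DQ.one_smul, sub_eq_add_neg]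

theorem mapDQ_chartRot (Ψ : ElimRing →ₐ[ℂ] S) (h : DQ ℝ) (j : Fin 4) (c : Bool) :
    mapDQ Ψ.toRingHom (chartRot h j c) =
      factor h (chartA c (Ψ (MvPolynomial.X j))) (chartB c (Ψ (MvPolynomial.X j))) := by
  cases c
  · simp only [chartRot, chartA, chartB, Bool.false_eq_true, if_false]
    rw [mapDQ_sub, mapDQ_comp_algebraMap, mapDQ_scalar, ← sub_eq_factor]; rfl
  · simp only [chartRot, chartA, chartB, if_true]
    rw [mapDQ_sub, mapDQ_one, mapDQ_mul, mapDQ_comp_algebraMap, mapDQ_scalar, ← one_sub_eq_factor]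
    rfl

end Chart

theorem forall_coord_iff {R S : Type*} [CommRing R] [CommRing S] (f : R →+* S) (q : DQ R) :
    (∀ c, f (coord q c) = 0) ↔ mapDQ f q = 0 := by
  rw [← coord_injective.eq_iff, coord_zero, funext_iff]
  simp only [coord_mapDQ, Pi.zero_apply]

section Quad

variable {h₁ h₂ h₃ h₄ : DQ ℝ} {g : DQ ℂ} {α β α' β' : DualNumber ℂ}

theorem coe_dual_formula {S : Type*} [CommRing S] (y x : S) :
    (((TrivSqZeroExt.inl y * (1 + TrivSqZeroExt.inl x * DualNumber.eps) : DualNumber S)) : DQ S) =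
      scalar y * (1 + scalar x * eps) := by
  rw [Quaternion.coe_mul, Quaternion.coe_add, Quaternion.coe_one, Quaternion.coe_mul]
  rfl

theorem quat_smul_mul_mul {T : Type*} [CommRing T] (k : T) (p q r : ℍ[T]) :
    k • p * q * r = k • (p * q * r) := by rw [smul_mul_assoc, smul_mul_assoc]

theorem quat_mul_smul_eq_zero {T : Type*} [CommRing T] {q f : ℍ[T]} (h : q * f = 0) (c : T) :
    q * c • f = 0 := by rw [mul_smul_comm, h, smul_zero]

theorem quat_smul_eq_iff {T : Type*} [CommRing T] {c c' d : T} (h : c' * c = 1) (p q : ℍ[T]) :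
    c • p = d • q ↔ p = (c' * d) • q := by
  constructor
  · intro e
    rw [mul_smul, ← e, smul_smul, h, one_smul]
  · rintro rfl
    rw [smul_smul, ← mul_assoc, mul_comm c, h, one_mul]

/-- Homomorphisms that kill the ideal of a quad correspond to solutions of the quad equations. -/
theorem quadIdeal_le_ker_iff {S : Type*} [CommRing S] [Algebra ℂ S] (Ψ : ElimRing →ₐ[ℂ] S)
    (H₃ : h₃ * h₃ = -1) (H₄ : h₄ * h₄ = -1) (h34 : ¬Parallel h₃ h₄)
    (hg : IsGen (proj h₁) (proj h₄) g)
    (hc : IsGen.Coeffs (proj h₁) (proj h₂) (proj h₃) g α β α' β') (c₂ c₃ : Bool) :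
    quadIdeal g h₁ h₂ h₃ h₄ c₂ c₃ ≤ RingHom.ker Ψ.toRingHom ↔
      QuadSol (mapDual (algebraMap ℂ S) α) (mapDual (algebraMap ℂ S) β)
        (mapDual (algebraMap ℂ S) α') (mapDual (algebraMap ℂ S) β')
        (algebraMap ℂ S (2 * Complex.I)⁻¹ * Ψ (MvPolynomial.X 1))
        (algebraMap ℂ S (2 * Complex.I)⁻¹ * Ψ (MvPolynomial.X 1) * Ψ (MvPolynomial.X 0))
        (chartA c₂ (Ψ (MvPolynomial.X 2))) (chartB c₂ (Ψ (MvPolynomial.X 2)))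
        (chartA c₃ (Ψ (MvPolynomial.X 3))) (chartB c₃ (Ψ (MvPolynomial.X 3))) := by
  set x := Ψ (MvPolynomial.X 0)
  set y := Ψ (MvPolynomial.X 1)
  set a₂ := chartA c₂ (Ψ (MvPolynomial.X 2))
  set b₂ := chartB c₂ (Ψ (MvPolynomial.X 2))
  set a₃ := chartA c₃ (Ψ (MvPolynomial.X 3))
  set b₃ := chartB c₃ (Ψ (MvPolynomial.X 3))
  set ι := algebraMap ℂ S
  set e₁ := mapDQ ι (proj h₁)
  set κ : DualNumber S := mapDual ι (2 * dualI)
  set d : DualNumber S := TrivSqZeroExt.inl y * (1 + TrivSqZeroExt.inl x * DualNumber.eps)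
  have hg' := isGen_mapDQ ι hg
  have hP : mapDQ Ψ.toRingHom (mapDQ MvPolynomial.C (iSub h₁) * chartRot h₂ 2 c₂ * chartRot h₃ 3 c₃)
      = κ • (e₁ * factor h₂ a₂ b₂ * factor h₃ a₃ b₃) := by
    rw [mapDQ_mul, mapDQ_mul, mapDQ_chartRot, mapDQ_chartRot, mapDQ_mapDQ_C, iSub_eq, mapDQ_smul]
    exact quat_smul_mul_mul _ _ _ _
  have hD : mapDQ Ψ.toRingHom (scalar (MvPolynomial.X 1) * (1 + scalar (MvPolynomial.X 0) * eps) *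
      mapDQ MvPolynomial.C g) = d • mapDQ ι g := by
    rw [mapDQ_mul, mapDQ_mul, mapDQ_add, mapDQ_one, mapDQ_mul, mapDQ_scalar, mapDQ_scalar,
      mapDQ_eps, mapDQ_mapDQ_C, smul_eq_tr]
    congr 1
    exact (coe_dual_formula y x).symm
  have hker : quadIdeal g h₁ h₂ h₃ h₄ c₂ c₃ ≤ RingHom.ker Ψ.toRingHom ↔
      κ • (e₁ * factor h₂ a₂ b₂ * factor h₃ a₃ b₃) * mapDQ ι (iSub h₄) = 0 ∧
      κ • (e₁ * factor h₂ a₂ b₂ * factor h₃ a₃ b₃) = d • mapDQ ι g := by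
    rw [quadIdeal, Ideal.span_le, Set.union_subset_iff, Set.range_subset_iff, Set.range_subset_iff]
    refine and_congr ?_ ?_
    · refine (forall_coord_iff Ψ.toRingHom _).trans ?_
      rw [mapDQ_mul, hP, mapDQ_mapDQ_C]
    · refine (forall_coord_iff Ψ.toRingHom _).trans ?_
      rw [mapDQ_sub, hP, hD]
      exact sub_eq_zero
  -- The annihilation equation is redundant: every multiple of `g` is killed by `proj h₄`.
  have hred : (κ • (e₁ * factor h₂ a₂ b₂ * factor h₃ a₃ b₃) * mapDQ ι (iSub h₄) = 0 ∧
      κ • (e₁ * factor h₂ a₂ b₂ * factor h₃ a₃ b₃) = d • mapDQ ι g) ↔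
      κ • (e₁ * factor h₂ a₂ b₂ * factor h₃ a₃ b₃) = d • mapDQ ι g := by
    refine and_iff_right_of_imp fun h => ?_
    rw [h, iSub_eq, mapDQ_smul]
    exact quat_mul_smul_eq_zero (hg'.smul_mul_right d) _
  -- The factor 2i comes from `iSub h₁ = 2i proj h₁` and explains the constant in front of `y` in
  -- the quad equations.
  have hκ : (TrivSqZeroExt.inl (ι (2 * Complex.I)⁻¹) : DualNumber S) * κ = 1 := by
    have h0 : (2 * Complex.I) ≠ 0 := by simp
    have : ι (2 * Complex.I)⁻¹ * (2 * ι Complex.I) = 1 := by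
      rw [← map_ofNat ι 2, ← map_mul, ← map_mul, inv_mul_cancel₀ h0, map_one]
    have hfst : κ.fst = 2 * ι Complex.I := by simp [κ, dualI, map_ofNat]
    have hsnd : κ.snd = 0 := by simp [κ, dualI]
    ext
    · simpa [hfst] using this
    · simp [hsnd]
  rw [hker, hred]
  refine (quat_smul_eq_iff hκ _ _).trans ?_
  have hq := (coeffs_mapDQ ι hc).prod_eq_smul_iff (isProj_mapDQ ι (isProj_proj H₃))
    (isProj_mapDQ ι (isProj_proj H₄)) (genPos_mapDQ ι (genPos_proj H₃ H₄ h34)) hg'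
    (TrivSqZeroExt.inl a₂) (TrivSqZeroExt.inl b₂) (TrivSqZeroExt.inl a₃) (TrivSqZeroExt.inl b₃)
    (TrivSqZeroExt.inl (ι (2 * Complex.I)⁻¹) * d)
  refine hq.trans (quadSol_iff.trans ?_)
  have f1 : (TrivSqZeroExt.inl (ι (2 * Complex.I)⁻¹) * d).fst = ι (2 * Complex.I)⁻¹ * y := by
    simp [d]
  have f2 : (TrivSqZeroExt.inl (ι (2 * Complex.I)⁻¹) * d).snd =
      ι (2 * Complex.I)⁻¹ * y * x := by
    simp [d, mul_assoc]
  rw [f1, f2]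

theorem chartForm_eq (c : Bool) : ∃ p q : ℂ, ∀ (S : Type) [CommRing S] [Algebra ℂ S] (a b : S),
    chartForm c a b = algebraMap ℂ S p * a + algebraMap ℂ S q * b := by
  cases c
  · refine ⟨-(2⁻¹ * Complex.I), 2⁻¹ * Complex.I, fun S _ _ a b => ?_⟩
    simp only [chartForm, Bool.false_eq_true, if_false, map_neg, map_mul]; ring
  · refine ⟨2⁻¹, 2⁻¹, fun S _ _ a b => ?_⟩
    simp only [chartForm, if_true]; ring

/-- The value of a product of two chart forms at the matrix of products of parameters. -/
def chartProd {S : Type*} [CommRing S] [Algebra ℂ S] (c₂ c₃ : Bool) (a b a' b' : S) : S :=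
  chartForm c₂ (chartForm c₃ a a') (chartForm c₃ b b')

/-- With the chart forms σ = (a + b)/2 and δ = -i (a - b)/2 one has a = σ + i δ and b = σ - i δ;
this is applied in both parameters. Consequently the four chart products generate the ideal of all
matrix entries. -/
theorem fst_eq_chartProd {S : Type*} [CommRing S] [Algebra ℂ S] (a b a' b' : S) :
    a = chartProd true true a b a' b' + imag S * chartProd true false a b a' b' +
      imag S * chartProd false true a b a' b' - chartProd false false a b a' b' := by
  have h2 := algebraMap_half_mul_two (S := S)
  have hI := imag_mul_self (S := S)
  simp only [chartProd, chartForm, Bool.false_eq_true, if_false, if_true]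
  set w := algebraMap ℂ S 2⁻¹
  set i := imag S
  have e : a = (w * 2) ^ 2 * a := by rw [h2]; ring
  linear_combination e + (w ^ 2 * (3 * a - a' - b - b')) * hI

theorem snd_eq_chartProd {S : Type*} [CommRing S] [Algebra ℂ S] (a b a' b' : S) :
    b = chartProd true true a b a' b' + imag S * chartProd true false a b a' b' -
      imag S * chartProd false true a b a' b' + chartProd false false a b a' b' := by
  have h2 := algebraMap_half_mul_two (S := S)
  have hI := imag_mul_self (S := S)
  simp only [chartProd, chartForm, Bool.false_eq_true, if_false, if_true]
  set w := algebraMap ℂ S 2⁻¹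
  set i := imag S
  have e : b = (w * 2) ^ 2 * b := by rw [h2]; ring
  linear_combination e + w ^ 2 * (3 * b - a - a' - b') * hI

/-- Every root of the numerator where a chart form does not vanish gives a solution. -/
theorem exists_algHom_of_root {S : Type} [CommRing S] [Algebra ℂ S]
    (H₃ : h₃ * h₃ = -1) (H₄ : h₄ * h₄ = -1) (h34 : ¬Parallel h₃ h₄)
    (hg : IsGen (proj h₁) (proj h₄) g)
    (hc : IsGen.Coeffs (proj h₁) (proj h₂) (proj h₃) g α β α' β') (c₂ c₃ : Bool)
    {x a b a' b' u : S} (hm : a * b' = b * a')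
    (hu : u * chartProd c₂ c₃ a b a' b' = 1)
    (s₀ : a * algebraMap ℂ S α.fst + b * algebraMap ℂ S β.fst = 1)
    (s₁ : a * algebraMap ℂ S α.snd + b * algebraMap ℂ S β.snd = x)
    (s₀' : a' * algebraMap ℂ S α'.fst + b' * algebraMap ℂ S β'.fst = 1)
    (s₁' : a' * algebraMap ℂ S α'.snd + b' * algebraMap ℂ S β'.snd = x) :
    ∃ Ψ : ElimRing →ₐ[ℂ] S, Ψ (MvPolynomial.X 0) = x ∧
      quadIdeal g h₁ h₂ h₃ h₄ c₂ c₃ ≤ RingHom.ker Ψ.toRingHom := by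
  -- A matrix of rank one splits into a column and a row once it is contracted with a form on either
  -- side; `u` scales it so that the product of the two forms has value one on it.
  set A₂ := chartForm c₃ (u * a) (u * a')
  set B₂ := chartForm c₃ (u * b) (u * b')
  set A₃ := chartForm c₂ (u * a) (u * b)
  set B₃ := chartForm c₂ (u * a') (u * b')
  obtain ⟨p, q, hpq⟩ := chartForm_eq c₂
  obtain ⟨p', q', hpq'⟩ := chartForm_eq c₃
  have e2 : chartForm c₂ A₂ B₂ = 1 := by
    rw [← hu, chartProd]
    simp only [A₂, B₂, hpq, hpq']; ring
  have e3 : chartForm c₃ A₃ B₃ = 1 := by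
    rw [← hu, chartProd]
    simp only [A₃, B₃, hpq, hpq']; ring
  have hu' := hu
  simp only [chartProd, hpq, hpq'] at hu'
  have m00 : A₃ * A₂ = u * a := by
    simp only [A₂, A₃, hpq, hpq']
    linear_combination (u * a) * hu' - u ^ 2 * algebraMap ℂ S q * algebraMap ℂ S q' * hm
  have m10 : A₃ * B₂ = u * b := by
    simp only [B₂, A₃, hpq, hpq']
    linear_combination (u * b) * hu' + u ^ 2 * algebraMap ℂ S p * algebraMap ℂ S q' * hm
  have m01 : B₃ * A₂ = u * a' := by
    simp only [A₂, B₃, hpq, hpq']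
    linear_combination (u * a') * hu' + u ^ 2 * algebraMap ℂ S q * algebraMap ℂ S p' * hm
  have m11 : B₃ * B₂ = u * b' := by
    simp only [B₂, B₃, hpq, hpq']
    linear_combination (u * b') * hu' - u ^ 2 * algebraMap ℂ S p * algebraMap ℂ S p' * hm
  let Ψ : ElimRing →ₐ[ℂ] S := MvPolynomial.aeval ![x, algebraMap ℂ S (2 * Complex.I) * u,
    chartForm (!c₂) A₂ B₂, chartForm (!c₃) A₃ B₃]
  have v0 : Ψ (MvPolynomial.X 0) = x := by simp [Ψ]
  have v1 : Ψ (MvPolynomial.X 1) = algebraMap ℂ S (2 * Complex.I) * u := by simp [Ψ]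
  have v2 : Ψ (MvPolynomial.X 2) = chartForm (!c₂) A₂ B₂ := by simp [Ψ]
  have v3 : Ψ (MvPolynomial.X 3) = chartForm (!c₃) A₃ B₃ := by simp [Ψ]
  refine ⟨Ψ, v0, ?_⟩
  rw [quadIdeal_le_ker_iff Ψ H₃ H₄ h34 hg hc, v0, v1, v2, v3, chartA_form _ e2, chartB_form _ e2,
    chartA_form _ e3, chartB_form _ e3]
  have hI : algebraMap ℂ S (2 * Complex.I)⁻¹ * (algebraMap ℂ S (2 * Complex.I) * u) = u := by
    rw [← mul_assoc, ← map_mul, inv_mul_cancel₀ (by simp), map_one, one_mul]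
  rw [hI]
  constructor
  · simp only [fst_mapDual]
    linear_combination algebraMap ℂ S α.fst * m00 + algebraMap ℂ S β.fst * m10 + u * s₀
  · simp only [snd_mapDual]
    linear_combination algebraMap ℂ S α.snd * m00 + algebraMap ℂ S β.snd * m10 + u * s₁
  · simp only [fst_mapDual]
    linear_combination algebraMap ℂ S α'.fst * m01 + algebraMap ℂ S β'.fst * m11 + u * s₀'
  · simp only [snd_mapDual]
    linear_combination algebraMap ℂ S α'.snd * m01 + algebraMap ℂ S β'.snd * m11 + u * s₁'

/-- The universal case suffices: the quotient by the quad ideal carries a tautological solution, and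
`aeval_quadNum` holds over every ring. -/
theorem quadNum_mem (H₃ : h₃ * h₃ = -1) (H₄ : h₄ * h₄ = -1) (h34 : ¬Parallel h₃ h₄)
    (hg : IsGen (proj h₁) (proj h₄) g)
    (hc : IsGen.Coeffs (proj h₁) (proj h₂) (proj h₃) g α β α' β') (hn : NonDeg α β α' β') :
    quadNum α β α' β' ∈ quadElim g h₁ h₂ h₃ h₄ := by
  simp only [quadElim, Ideal.mem_iInf]
  intro c₂ c₃
  set I := quadIdeal g h₁ h₂ h₃ h₄ c₂ c₃
  let Ψ : ElimRing →ₐ[ℂ] ElimRing ⧸ I := Ideal.Quotient.mkₐ ℂ I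
  have hk : RingHom.ker Ψ.toRingHom = I := Ideal.mk_ker
  obtain ⟨p, q, hpq⟩ := chartForm_eq c₂
  obtain ⟨p', q', hpq'⟩ := chartForm_eq c₃
  have h := (quadIdeal_le_ker_iff Ψ H₃ H₄ h34 hg hc c₂ c₃).mp hk.ge
  have := (h.aeval_quadNum hn (((hpq _ _ _).symm.trans (chartForm_self c₂ _)))
    (((hpq' _ _ _).symm.trans (chartForm_self c₃ _)))).2 _ rfl
  rw [Ideal.mem_comap, ← hk, RingHom.mem_ker]
  have e : Ψ (aeval (MvPolynomial.X 0 : ElimRing) (quadNum α β α' β')) =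
    aeval (Ψ (MvPolynomial.X 0)) (quadNum α β α' β') := (Polynomial.aeval_algHom_apply _ _ _).symm
  exact e.trans this

/-- Work modulo the polynomial itself rather than at its roots, so that a double root counts twice.
There the class of x carries a rank one matrix that splits into parameters after inverting any chart
product. Hence P(x) is killed by a power of each chart product, and since these generate the unit
ideal, P(x) = 0. -/
theorem quadNum_dvd (H₃ : h₃ * h₃ = -1) (H₄ : h₄ * h₄ = -1) (h34 : ¬Parallel h₃ h₄)
    (hg : IsGen (proj h₁) (proj h₄) g)
    (hc : IsGen.Coeffs (proj h₁) (proj h₂) (proj h₃) g α β α' β') (hn : NonDeg α β α' β')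
    {P : ℂ[X]} (hP : P ∈ quadElim g h₁ h₂ h₃ h₄) : quadNum α β α' β' ∣ P := by
  set N := quadNum α β α' β'
  let A := AdjoinRoot N
  let x : A := AdjoinRoot.root N
  let ι := algebraMap ℂ A
  have hx : aeval x N = 0 := by rw [AdjoinRoot.aeval_eq, AdjoinRoot.mk_self]
  -- Cramer's rule for `a α + b β = 1 + x ε` and `a' α' + b' β' = 1 + x ε`.
  let a : A := ι (ddet α β)⁻¹ * (ι β.snd - x * ι β.fst)
  let b : A := ι (ddet α β)⁻¹ * (x * ι α.fst - ι α.snd)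
  let a' : A := ι (ddet α' β')⁻¹ * (ι β'.snd - x * ι β'.fst)
  let b' : A := ι (ddet α' β')⁻¹ * (x * ι α'.fst - ι α'.snd)
  have hd : ι (ddet α β)⁻¹ * (ι α.fst * ι β.snd - ι α.snd * ι β.fst) = 1 := by
    rw [← map_mul, ← map_mul, ← map_sub, ← map_mul]
    exact (congrArg ι (inv_mul_cancel₀ hn.det)).trans (map_one ι)
  have hd' : ι (ddet α' β')⁻¹ * (ι α'.fst * ι β'.snd - ι α'.snd * ι β'.fst) = 1 := by
    rw [← map_mul, ← map_mul, ← map_sub, ← map_mul]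
    exact (congrArg ι (inv_mul_cancel₀ hn.det')).trans (map_one ι)
  have s₀ : a * ι α.fst + b * ι β.fst = 1 := by simp only [a, b]; linear_combination hd
  have s₁ : a * ι α.snd + b * ι β.snd = x := by simp only [a, b]; linear_combination x * hd
  have s₀' : a' * ι α'.fst + b' * ι β'.fst = 1 := by simp only [a', b']; linear_combination hd'
  have s₁' : a' * ι α'.snd + b' * ι β'.snd = x := by simp only [a', b']; linear_combination x * hd'
  -- The rank one condition is exactly the vanishing of the numerator at `x`.
  have hm : a * b' = b * a' := by
    simp only [N, quadNum, map_sub, map_mul, aeval_C, aeval_X] at hx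
    simp only [a, b, a', b']
    linear_combination (-ι (ddet α β)⁻¹ * ι (ddet α' β')⁻¹) * hx
  let J : Ideal A := Ideal.span {0} |>.colon (Ideal.span {aeval x P})
  have hJ : ∀ r, r ∈ J ↔ r * aeval x P = 0 := fun r => by
    simp [J, Submodule.mem_colon_singleton]
  have hrad : ∀ c₂ c₃, chartProd c₂ c₃ a b a' b' ∈ J.radical := by
    intro c₂ c₃
    set L := chartProd c₂ c₃ a b a' b' with hL
    let S := Localization.Away L
    let θ : A →ₐ[ℂ] S := IsScalarTower.toAlgHom ℂ A S
    have hθ : ∀ z : ℂ, θ (ι z) = algebraMap ℂ S z := θ.commutes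
    have hLu : IsLocalization.Away.invSelf L * chartProd c₂ c₃ (θ a) (θ b) (θ a') (θ b') = 1 := by
      obtain ⟨p, q, hpq⟩ := chartForm_eq c₂
      obtain ⟨p', q', hpq'⟩ := chartForm_eq c₃
      have : chartProd c₂ c₃ (θ a) (θ b) (θ a') (θ b') = algebraMap A S L := by
        change _ = θ L
        simp only [hL, chartProd, hpq, hpq', map_add, map_mul, AlgHom.commutes]
      rw [this, mul_comm]
      exact IsLocalization.Away.mul_invSelf L
    obtain ⟨Ψ, hΨ, hker⟩ := exists_algHom_of_root (x := θ x) H₃ H₄ h34 hg hc c₂ c₃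
      (by rw [← map_mul, hm, map_mul]) hLu
      (by rw [← hθ, ← hθ, ← map_mul, ← map_mul, ← map_add, s₀, map_one])
      (by rw [← hθ, ← hθ, ← map_mul, ← map_mul, ← map_add, s₁])
      (by rw [← hθ, ← hθ, ← map_mul, ← map_mul, ← map_add, s₀', map_one])
      (by rw [← hθ, ← hθ, ← map_mul, ← map_mul, ← map_add, s₁'])
    have hPc : aeval (MvPolynomial.X 0 : ElimRing) P ∈ quadIdeal g h₁ h₂ h₃ h₄ c₂ c₃ := by
      simp only [quadElim, Ideal.mem_iInf] at hP
      exact hP c₂ c₃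
    have h0 : Ψ (aeval (MvPolynomial.X 0 : ElimRing) P) = 0 := hker hPc
    rw [← Polynomial.aeval_algHom_apply, hΨ, Polynomial.aeval_algHom_apply] at h0
    obtain ⟨⟨_, n, rfl⟩, hn'⟩ := (IsLocalization.map_eq_zero_iff (Submonoid.powers L) S _).mp h0
    exact ⟨n, (hJ _).mpr hn'⟩
  have h1 : (1 : A) ∈ J.radical := by
    have ha : a ∈ J.radical := by
      rw [fst_eq_chartProd a b a' b']
      exact sub_mem (add_mem (add_mem (hrad _ _) (Ideal.mul_mem_left _ _ (hrad _ _)))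
        (Ideal.mul_mem_left _ _ (hrad _ _))) (hrad _ _)
    have hb : b ∈ J.radical := by
      rw [snd_eq_chartProd a b a' b']
      exact add_mem (sub_mem (add_mem (hrad _ _) (Ideal.mul_mem_left _ _ (hrad _ _)))
        (Ideal.mul_mem_left _ _ (hrad _ _))) (hrad _ _)
    rw [← s₀]
    exact add_mem (Ideal.mul_mem_right _ _ ha) (Ideal.mul_mem_right _ _ hb)
  have h2 : (1 : A) ∈ J := by
    obtain ⟨n, hn⟩ := h1
    rwa [one_pow] at hn
  rw [hJ, one_mul, AdjoinRoot.aeval_eq, AdjoinRoot.mk_eq_zero] at h2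
  exact h2

theorem quadElim_eq (H₃ : h₃ * h₃ = -1) (H₄ : h₄ * h₄ = -1) (h34 : ¬Parallel h₃ h₄)
    (hg : IsGen (proj h₁) (proj h₄) g)
    (hc : IsGen.Coeffs (proj h₁) (proj h₂) (proj h₃) g α β α' β') (hn : NonDeg α β α' β') :
    quadElim g h₁ h₂ h₃ h₄ = Ideal.span {quadNum α β α' β'} := by
  apply le_antisymm
  · intro P hP
    exact Ideal.mem_span_singleton.mpr (quadNum_dvd H₃ H₄ h34 hg hc hn hP)
  · rw [Ideal.span_le, Set.singleton_subset_iff]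
    exact quadNum_mem H₃ H₄ h34 hg hc hn

theorem quadPoly_eq (H₃ : h₃ * h₃ = -1) (H₄ : h₄ * h₄ = -1) (h34 : ¬Parallel h₃ h₄)
    (hg : IsGen (proj h₁) (proj h₄) g)
    (hc : IsGen.Coeffs (proj h₁) (proj h₂) (proj h₃) g α β α' β') (hn : NonDeg α β α' β') :
    quadPoly g h₁ h₂ h₃ h₄ = normalize (quadNum α β α' β') := by
  refine normalize_eq_normalize_iff_associated.mpr ?_
  rw [← Ideal.span_singleton_eq_span_singleton, ← quadElim_eq H₃ H₄ h34 hg hc hn]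
  exact Submodule.IsPrincipal.span_singleton_generator _

end Quad

end Linkage

end

noncomputable section
namespace Linkage

open Quaternion Polynomial

/-! ### The offset as the logarithmic derivative of a trace -/

section Vector

/-- The determinant of three vectors. -/
def det3 (p q r : Fin 3 → ℝ) : ℝ := p ⬝ᵥ q ⨯₃ r

theorem det3_eq (p q r : Fin 3 → ℝ) : det3 p q r =
    p 0 * (q 1 * r 2 - q 2 * r 1) + p 1 * (q 2 * r 0 - q 0 * r 2) +
      p 2 * (q 0 * r 1 - q 1 * r 0) := by
  rw [det3, Matrix.vec3_dotProduct, cross_apply]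
  simp

theorem dot3_eq (p q : Fin 3 → ℝ) : p ⬝ᵥ q = p 0 * q 0 + p 1 * q 1 + p 2 * q 2 :=
  Matrix.vec3_dotProduct _ _

variable {p₁ p₂ p₃ : Fin 3 → ℝ} (n₂ : p₂ ⬝ᵥ p₂ = 1) (n₃ : p₃ ⬝ᵥ p₃ = 1) (b : Fin 3 → ℝ)

/-- A polynomial identity valid for arbitrary vectors once the squared lengths of `p₂` and `p₃` are
inserted homogeneously; the normalization is used only at the end. -/
theorem det3_offset (p₁ : Fin 3 → ℝ) (n₂ : p₂ ⬝ᵥ p₂ = 1) (n₃ : p₃ ⬝ᵥ p₃ = 1) (b : Fin 3 → ℝ) :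
    (1 - (p₂ ⬝ᵥ p₃) ^ 2) * (det3 p₁ p₃ b - p₁ ⬝ᵥ p₂ * det3 p₂ p₃ b) =
      -(det3 p₁ p₂ p₃ * (b ⬝ᵥ p₂ - p₂ ⬝ᵥ p₃ * b ⬝ᵥ p₃)) -
        p₂ ⬝ᵥ p₃ * det3 p₂ p₃ b * (p₁ ⬝ᵥ p₃ - p₁ ⬝ᵥ p₂ * p₂ ⬝ᵥ p₃) := by
  have key : (p₂ ⬝ᵥ p₂ * p₃ ⬝ᵥ p₃ - (p₂ ⬝ᵥ p₃) ^ 2) * det3 p₁ p₃ b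
      - p₃ ⬝ᵥ p₃ * p₁ ⬝ᵥ p₂ * det3 p₂ p₃ b +
      det3 p₁ p₂ p₃ * (p₃ ⬝ᵥ p₃ * b ⬝ᵥ p₂ - p₂ ⬝ᵥ p₃ * b ⬝ᵥ p₃) +
        p₂ ⬝ᵥ p₃ * det3 p₂ p₃ b * p₁ ⬝ᵥ p₃ = 0 := by
    simp only [det3_eq, dot3_eq]; ring
  rw [n₂, n₃] at key
  linear_combination key

theorem det3_cross_offset (p₁ : Fin 3 → ℝ) (n₂ : p₂ ⬝ᵥ p₂ = 1) (n₃ : p₃ ⬝ᵥ p₃ = 1)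
    (b : Fin 3 → ℝ) :
    (1 - (p₂ ⬝ᵥ p₃) ^ 2) * det3 p₁ p₂ (p₃ ⨯₃ b) =
      (b ⬝ᵥ p₂ - p₂ ⬝ᵥ p₃ * b ⬝ᵥ p₃) * (p₁ ⬝ᵥ p₃ - p₁ ⬝ᵥ p₂ * p₂ ⬝ᵥ p₃) -
        p₂ ⬝ᵥ p₃ * det3 p₂ p₃ b * det3 p₁ p₂ p₃ := by
  have k1 : det3 p₁ p₂ (p₃ ⨯₃ b) = p₁ ⬝ᵥ p₃ * b ⬝ᵥ p₂ - p₂ ⬝ᵥ p₃ * b ⬝ᵥ p₁ := by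
    simp [det3_eq, dot3_eq, cross_apply]; ring
  have k2 : det3 p₂ p₃ b * det3 p₁ p₂ p₃ = b ⬝ᵥ p₁ * (p₂ ⬝ᵥ p₂ * p₃ ⬝ᵥ p₃ - (p₂ ⬝ᵥ p₃) ^ 2) -
      p₁ ⬝ᵥ p₂ * (p₃ ⬝ᵥ p₃ * b ⬝ᵥ p₂ - p₂ ⬝ᵥ p₃ * b ⬝ᵥ p₃) +
      p₁ ⬝ᵥ p₃ * (p₂ ⬝ᵥ p₃ * b ⬝ᵥ p₂ - p₂ ⬝ᵥ p₂ * b ⬝ᵥ p₃) := by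
    simp only [det3_eq, dot3_eq]; ring
  rw [n₂, n₃] at k2
  rw [k1]
  linear_combination p₂ ⬝ᵥ p₃ * k2

end Vector

/-- The Bennett ratio of two lines. -/
def bval (h h' : DQ ℝ) : ℝ := (dcos h h').snd / (1 - (dcos h h').fst ^ 2)

/-- The product of the Bennett ratio and the cosine of two lines. -/
def fval (h h' : DQ ℝ) : ℝ := bval h h' * (dcos h h').fst

theorem paramB_eq (h : ZMod 6 → DQ ℝ) (k : ZMod 6) : paramB h k = bval (h k) (h (k + 1)) := by
  rw [paramB, bval, dcos, TrivSqZeroExt.fst_neg, TrivSqZeroExt.snd_neg, neg_sq]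

theorem paramC_eq (h : ZMod 6 → DQ ℝ) (k : ZMod 6) : paramC h k = (dcos (h k) (h (k + 1))).fst := by
  simp [paramC, dcos]

theorem moment_eq {h : DQ ℝ} (hh : h * h = -1) : moment h = dir h ⨯₃ basePoint h := by
  obtain ⟨n1, o1⟩ := line_spec h hh
  have e : dir h ⨯₃ basePoint h =
      (dir h ⬝ᵥ dir h) • moment h - (dir h ⬝ᵥ moment h) • dir h := by
    rw [basePoint]
    ext i
    fin_cases i <;> simp [cross_apply, Matrix.vec3_dotProduct] <;> ring
  rw [e, n1, o1]; simp

theorem dcos_snd_eq {h h' : DQ ℝ} (H : h * h = -1) (H' : h' * h' = -1) :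
    (dcos h h').snd = det3 (dir h) (dir h') (basePoint h' - basePoint h) := by
  rw [dcos_snd H, moment_eq H, moment_eq H']
  simp only [det3_eq, dot3_eq]
  simp [cross_apply]; ring

/-- The scalar part of the product of three lines. -/
def triple (h₁ h₂ h₃ : DQ ℝ) : DualNumber ℝ := (h₁ * h₂ * h₃).re

theorem triple_fst {h₁ h₂ h₃ : DQ ℝ} (H₁ : h₁ * h₁ = -1) (H₂ : h₂ * h₂ = -1) (H₃ : h₃ * h₃ = -1) :
    (triple h₁ h₂ h₃).fst = -det3 (dir h₁) (dir h₂) (dir h₃) := by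
  have r1 := re_eq_zero_of_sq H₁
  have r2 := re_eq_zero_of_sq H₂
  have r3 := re_eq_zero_of_sq H₃
  simp [triple, r1, r2, r3, det3_eq, dir]; ring

theorem triple_snd {h₁ h₂ h₃ : DQ ℝ} (H₁ : h₁ * h₁ = -1) (H₂ : h₂ * h₂ = -1) (H₃ : h₃ * h₃ = -1) :
    (triple h₁ h₂ h₃).snd =
      det3 (dir h₃) (dir h₂) (dir h₁ ⨯₃ (basePoint h₁ - basePoint h₂)) -
      det3 (dir h₁) (dir h₂) (dir h₃ ⨯₃ (basePoint h₃ - basePoint h₂)) := by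
  have r1 := re_eq_zero_of_sq H₁
  have r2 := re_eq_zero_of_sq H₂
  have r3 := re_eq_zero_of_sq H₃
  have e : (triple h₁ h₂ h₃).snd = -(det3 (moment h₁) (dir h₂) (dir h₃) +
      det3 (dir h₁) (moment h₂) (dir h₃) + det3 (dir h₁) (dir h₂) (moment h₃)) := by
    simp [triple, r1, r2, r3, det3_eq, dir, moment]; ring
  rw [e, moment_eq H₁, moment_eq H₂, moment_eq H₃]
  simp [det3_eq, cross_apply]; ring

/-- The signed distance on `h₂` from the foot of the common normal with `h₁` to that with `h₃`. -/
def offset (h₁ h₂ h₃ : DQ ℝ) : ℝ := footParam h₂ h₃ - footParam h₂ h₁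

/-- This is the dual part of the spherical cosine rule. The number `dcos h₁ h₃ - dcos h₁ h₂ * dcos
h₂ h₃ - i triple h₁ h₂ h₃` is, up to sign, the product of two dual sines and of the exponential of
the dual angle at `h₂`. The exponential contributes the offset, and each sine contributes the value
`fval` of its pair of lines. The two equations are the real and imaginary parts, proved directly
from determinant identities. -/
theorem offset_spec {h₁ h₂ h₃ : DQ ℝ} (H₁ : h₁ * h₁ = -1) (H₂ : h₂ * h₂ = -1) (H₃ : h₃ * h₃ = -1)
    (h12 : ¬Parallel h₁ h₂) (h23 : ¬Parallel h₂ h₃) :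
    (dcos h₁ h₃ - dcos h₁ h₂ * dcos h₂ h₃).snd =
        offset h₁ h₂ h₃ * (triple h₁ h₂ h₃).fst -
          (fval h₁ h₂ + fval h₂ h₃) * (dcos h₁ h₃ - dcos h₁ h₂ * dcos h₂ h₃).fst ∧
      (triple h₁ h₂ h₃).snd = -(offset h₁ h₂ h₃ * (dcos h₁ h₃ - dcos h₁ h₂ * dcos h₂ h₃).fst +
          (fval h₁ h₂ + fval h₂ h₃) * (triple h₁ h₂ h₃).fst) := by
  have c1 := dcos_sq_ne_one H₁ H₂ h12
  have c2 := dcos_sq_ne_one H₂ H₃ h23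
  rw [triple_fst H₁ H₂ H₃, triple_snd H₁ H₂ H₃]
  simp only [TrivSqZeroExt.fst_sub, TrivSqZeroExt.snd_sub, TrivSqZeroExt.fst_mul,
    DualNumber.snd_mul, fval, bval, dcos_snd_eq H₁ H₃, dcos_snd_eq H₁ H₂, dcos_snd_eq H₂ H₃,
    offset, footParam]
  rw [dcos_fst H₁ H₂] at c1
  rw [dcos_fst H₂ H₃] at c2
  simp only [dcos_fst H₁ H₂, dcos_fst H₁ H₃, dcos_fst H₂ H₃]
  have n1 := (line_spec h₁ H₁).1
  have n2 := (line_spec h₂ H₂).1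
  have n3 := (line_spec h₃ H₃).1
  set p₁ := dir h₁
  set p₂ := dir h₂
  set p₃ := dir h₃
  set a := basePoint h₁ - basePoint h₂ with ha
  set b := basePoint h₃ - basePoint h₂ with hb
  have e12 : det3 p₁ p₂ (basePoint h₂ - basePoint h₁) = det3 p₂ p₁ a := by
    rw [ha]; simp [det3_eq]; ring
  have e13 : det3 p₁ p₃ (basePoint h₃ - basePoint h₁) = det3 p₁ p₃ b + det3 p₃ p₁ a := by
    rw [ha, hb]; simp [det3_eq]; ring
  have e321 : det3 p₃ p₂ p₁ = -det3 p₁ p₂ p₃ := by simp [det3_eq]; ring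
  rw [e12, e13]
  have b1 := det3_offset p₁ n2 n3 b
  have b2 := det3_cross_offset p₁ n2 n3 b
  have a1 := det3_offset p₃ n2 n1 a
  have a2 := det3_cross_offset p₃ n2 n1 a
  rw [e321] at a1 a2
  have d21 : p₂ ⬝ᵥ p₁ = p₁ ⬝ᵥ p₂ := dotProduct_comm _ _
  have d31 : p₃ ⬝ᵥ p₁ = p₁ ⬝ᵥ p₃ := dotProduct_comm _ _
  have d32 : p₃ ⬝ᵥ p₂ = p₂ ⬝ᵥ p₃ := dotProduct_comm _ _
  rw [d21, d31, d32] at a1 a2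
  rw [d21]
  have c1' : 1 - (p₁ ⬝ᵥ p₂) ^ 2 ≠ 0 := fun h => c1 (by linarith)
  have c2' : 1 - (p₂ ⬝ᵥ p₃) ^ 2 ≠ 0 := fun h => c2 (by linarith)
  have f1 := eq_div_of_mul_eq c2' ((mul_comm _ _).trans b1)
  have f2 := eq_div_of_mul_eq c2' ((mul_comm _ _).trans b2)
  have g1 := eq_div_of_mul_eq c1' ((mul_comm _ _).trans a1)
  have g2 := eq_div_of_mul_eq c1' ((mul_comm _ _).trans a2)
  rw [f2, g2]
  constructor
  · linear_combination f1 + g1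
  · ring

/-! ### Traces of products of projections and their logarithmic derivatives. -/

section HalfProj

variable {T : Type*} [CommRing T] {c ι : T}

/-- The constant terms of the outer projections drop out, since `e * (1 - e) = 0` and `e * z * (1 -
e)` has trace zero. Only the terms linear in `x` and `z` remain. -/
theorem tr_halfProj_triple (hc : 2 * c = 1) (hι : ι * ι = -1) {x y z : ℍ[T]} (hx : x.re = 0)
    (hy : y.re = 0) (hz : z.re = 0) (hyy : y * y = -1) (hs : star y = -y) :
    tr (halfProj c ι x * halfProj c ι y * halfProj c ι z * (1 - halfProj c ι y)) =
      c * c * (-(x * z).re - (x * y).re * (y * z).re - ι * (x * y * z).re) := by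
  have he := isProj_halfProj hc hι hyy hs
  set e := halfProj c ι y with hedef
  have h1 : e * halfProj c ι z * (1 - e) = (c * ι) • (e * z * (1 - e)) := by
    rw [halfProj, mul_smul_comm, smul_mul_assoc, mul_add, mul_one, add_mul, he.mul_compl, zero_add,
      mul_smul_comm, smul_mul_assoc, smul_smul]
  have h2 : tr (halfProj c ι x * (e * z * (1 - e))) = (c * ι) * tr (x * (e * z * (1 - e))) := by
    have h0 : tr (e * z * (1 - e)) = 0 := by
      rw [tr_mul_comm, ← mul_assoc, he.compl_mul, zero_mul, tr_zero]
    rw [halfProj, smul_mul_assoc, tr_smul, add_mul, one_mul, tr_add, h0, smul_mul_assoc, tr_smul]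
    ring
  have h3 : e * z * (1 - e) = (c * c) • (z + ι • (y * z - z * y) + y * z * y) := by
    rw [one_sub_halfProj hc, hedef, halfProj, smul_mul_assoc, smul_mul_smul_comm]
    congr 1
    rw [add_mul, one_mul, mul_sub, mul_one, add_mul, smul_mul_assoc, mul_smul_comm, mul_smul_comm,
      smul_mul_assoc, smul_smul, hι]
    module
  have nyy : y.imI * y.imI + y.imJ * y.imJ + y.imK * y.imK = 1 := by
    have := congrArg (fun q => q.re) hyy
    simp [hy] at this
    linear_combination -this
  rw [mul_assoc (halfProj c ι x * e), mul_assoc (halfProj c ι x), ← mul_assoc e, h1, mul_smul_comm,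
    tr_smul, h2, h3, mul_smul_comm, tr_smul]
  have h4 : tr (x * (z + ι • (y * z - z * y) + y * z * y)) =
      2 * ((2 * (x * z).re) + ι * (2 * (x * y * z).re) + 2 * ((x * y).re * (y * z).re)) := by
    rw [tr]
    simp only [mul_add, mul_sub, mul_smul_comm, Quaternion.re_add, Quaternion.re_smul,
      Quaternion.re_sub, smul_eq_mul]
    simp only [Quaternion.re_mul, Quaternion.imI_mul, Quaternion.imJ_mul, Quaternion.imK_mul, hx,
      hy, hz]
    linear_combination -2 * (x.imI * z.imI + x.imJ * z.imJ + x.imK * z.imK) * nyy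
  rw [h4]
  linear_combination (c * c * (2 * c + 1) * ι * ι * ((x * z).re + ι * ((x * y * z).re) + ((x * y).re * (y * z).re))) * hc +
    c * c * ((x * z).re + ι * ((x * y * z).re) + ((x * y).re * (y * z).re)) * hι

end HalfProj

theorem tr_proj_triple {h₁ h₂ h₃ : DQ ℝ} (H₁ : h₁ * h₁ = -1) (H₂ : h₂ * h₂ = -1)
    (H₃ : h₃ * h₃ = -1) :
    tr (proj h₁ * proj h₂ * proj h₃ * (1 - proj h₂)) = dualHalf * dualHalf *
      (dualC (dcos h₁ h₃ - dcos h₁ h₂ * dcos h₂ h₃) - dualI * dualC (triple h₁ h₂ h₃)) := by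
  have r : ∀ {h : DQ ℝ}, h * h = -1 → (toC h).re = 0 := fun H => by
    rw [toC, re_mapDQ, re_eq_zero_of_sq H]; ext <;> simp
  have s2 : toC h₂ * toC h₂ = -1 := by rw [← toC_mul, H₂, toC_neg, toC_one]
  have t2 : star (toC h₂) = -toC h₂ := by rw [toC, ← mapDQ_star, star_eq_neg_of_sq H₂, mapDQ_neg]
  refine (tr_halfProj_triple two_mul_dualHalf dualI_mul_self (r H₁) (r H₂) (r H₃) s2 t2).trans ?_
  simp only [← toC_mul]
  simp only [toC, re_mapDQ, dcos, triple, dualC, ← mapDualHom_apply, map_neg, map_sub,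
    map_mul]
  ring

theorem quat_sub_sub_cancel {T : Type*} [CommRing T] (p q : ℍ[T]) : p - (p - q) = q :=
  sub_sub_cancel p q

theorem triple_neg (h₁ h₂ h₃ : DQ ℝ) : triple h₁ (-h₂) h₃ = -triple h₁ h₂ h₃ := by
  rw [triple, triple, DQ.mul_neg, DQ.neg_mul, Quaternion.re_neg]

theorem tr_proj_triple' {h₁ h₂ h₃ : DQ ℝ} (H₁ : h₁ * h₁ = -1) (H₂ : h₂ * h₂ = -1)
    (H₃ : h₃ * h₃ = -1) :
    tr (proj h₁ * (1 - proj h₂) * proj h₃ * proj h₂) = dualHalf * dualHalf *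
      (dualC (dcos h₁ h₃ - dcos h₁ h₂ * dcos h₂ h₃) + dualI * dualC (triple h₁ h₂ h₃)) := by
  have := tr_proj_triple H₁ (sq_neg_eq H₂) H₃
  rw [proj_neg, quat_sub_sub_cancel] at this
  rw [this, triple_neg, dcos_neg_left, dcos_neg_right, neg_mul_neg]
  simp only [dualC, ← mapDualHom_apply, map_neg]
  ring

/-- The logarithmic derivative of a dual number. -/
def logd (d : DualNumber ℂ) : ℂ := d.snd / d.fst

theorem logd_mul {c d : DualNumber ℂ} (hc : IsUnit c) (hd : IsUnit d) :
    logd (c * d) = logd c + logd d := by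
  rw [isUnit_dual] at hc hd
  simp only [logd, TrivSqZeroExt.fst_mul, DualNumber.snd_mul]
  field_simp
  ring

theorem logd_neg (d : DualNumber ℂ) : logd (-d) = logd d := by
  simp [logd, neg_div_neg_eq]

/-- Combining both equations of `offset_spec` with a factor i makes the offset additive under
products of traces, and unaffected by factors without dual part. -/
theorem logd_tr_triple {h₁ h₂ h₃ : DQ ℝ} (H₁ : h₁ * h₁ = -1) (H₂ : h₂ * h₂ = -1)
    (H₃ : h₃ * h₃ = -1) (h12 : ¬Parallel h₁ h₂) (h23 : ¬Parallel h₂ h₃)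
    (hu : IsUnit (tr (proj h₁ * proj h₂ * proj h₃ * (1 - proj h₂)))) :
    logd (tr (proj h₁ * proj h₂ * proj h₃ * (1 - proj h₂))) =
      Complex.I * offset h₁ h₂ h₃ - fval h₁ h₂ - fval h₂ h₃ := by
  obtain ⟨e1, e2⟩ := offset_spec H₁ H₂ H₃ h12 h23
  rw [isUnit_dual] at hu
  rw [logd, div_eq_iff hu, tr_proj_triple H₁ H₂ H₃]
  simp only [TrivSqZeroExt.fst_mul, DualNumber.snd_mul, dualHalf, dualI, dualC, fst_mapDual,
    snd_mapDual, TrivSqZeroExt.fst_inl, TrivSqZeroExt.snd_inl, TrivSqZeroExt.snd_sub,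
    TrivSqZeroExt.fst_sub] at e1 e2 ⊢
  rw [e1, e2]
  simp only [Complex.coe_algebraMap]
  push_cast
  linear_combination ((2⁻¹ * 2⁻¹) * (offset h₁ h₂ h₃ : ℂ) * ((triple h₁ h₂ h₃).fst : ℂ)) * Complex.I_mul_I

theorem logd_tr_triple' {h₁ h₂ h₃ : DQ ℝ} (H₁ : h₁ * h₁ = -1) (H₂ : h₂ * h₂ = -1)
    (H₃ : h₃ * h₃ = -1) (h12 : ¬Parallel h₁ h₂) (h23 : ¬Parallel h₂ h₃)
    (hu : IsUnit (tr (proj h₁ * (1 - proj h₂) * proj h₃ * proj h₂))) :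
    logd (tr (proj h₁ * (1 - proj h₂) * proj h₃ * proj h₂)) =
      -(Complex.I * offset h₁ h₂ h₃) - fval h₁ h₂ - fval h₂ h₃ := by
  obtain ⟨e1, e2⟩ := offset_spec H₁ H₂ H₃ h12 h23
  rw [isUnit_dual] at hu
  rw [logd, div_eq_iff hu, tr_proj_triple' H₁ H₂ H₃]
  simp only [TrivSqZeroExt.fst_mul, DualNumber.snd_mul, dualHalf, dualI, dualC, fst_mapDual,
    snd_mapDual, TrivSqZeroExt.fst_inl, TrivSqZeroExt.snd_inl, TrivSqZeroExt.snd_sub,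
    TrivSqZeroExt.fst_sub, TrivSqZeroExt.snd_add, TrivSqZeroExt.fst_add] at e1 e2 ⊢
  rw [e1, e2]
  simp only [Complex.coe_algebraMap]
  push_cast
  linear_combination ((2⁻¹ * 2⁻¹) * (offset h₁ h₂ h₃ : ℂ) * ((triple h₁ h₂ h₃).fst : ℂ)) * Complex.I_mul_I

/-- With c the cosine and b the Bennett ratio, the dual part of 1 + `dcos` is b (1 - c²); division
by 1 + c leaves b - bc. -/
theorem logd_tr_proj_mul {a b : DQ ℝ} (ha : a * a = -1) (hb : b * b = -1) (hp : ¬Parallel a b) :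
    logd (tr (proj a * proj b)) = bval a b - fval a b := by
  have hu := (genPos_proj ha hb hp).unit
  rw [isUnit_dual] at hu
  have h1 : ((1 - (dcos a b).fst ^ 2 : ℝ) : ℂ) ≠ 0 := by
    rw [Ne, Complex.ofReal_eq_zero]
    exact fun h => dcos_sq_ne_one ha hb hp (by linarith)
  rw [logd, div_eq_iff hu, tr_proj_mul ha hb, fval, bval]
  simp only [TrivSqZeroExt.fst_mul, DualNumber.snd_mul, dualHalf, dualC, fst_mapDual,
    snd_mapDual, TrivSqZeroExt.fst_inl, TrivSqZeroExt.snd_inl, TrivSqZeroExt.snd_add,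
    TrivSqZeroExt.fst_add, TrivSqZeroExt.fst_one, TrivSqZeroExt.snd_one, Complex.coe_algebraMap]
  push_cast at h1 ⊢
  field_simp
  ring

theorem logd_tr_proj_mul_compl {a b : DQ ℝ} (ha : a * a = -1) (hb : b * b = -1)
    (hp : ¬Parallel a b) :
    logd (tr (proj a * (1 - proj b))) = -bval a b - fval a b := by
  have hp' : ¬Parallel a (-b) := not_parallel_of_dcos ha (sq_neg_eq hb) (by
    rw [dcos_neg_right, TrivSqZeroExt.fst_neg, neg_sq]; exact dcos_sq_ne_one ha hb hp)
  rw [← proj_neg, logd_tr_proj_mul ha (sq_neg_eq hb) hp']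
  simp [fval, bval, dcos_neg_right, neg_div]

end Linkage

end

noncomputable section
namespace Linkage

open Quaternion Polynomial

/-! ### The quad polynomial in terms of the parameters -/

theorem mapDQ_algebraMap_self (q : DQ ℂ) : mapDQ (algebraMap ℂ ℂ) q = q := by
  have : ∀ d : DualNumber ℂ, mapDual (algebraMap ℂ ℂ) d = d := fun d => by ext <;> simp
  ext1 <;> simp only [re_mapDQ, imI_mapDQ, imJ_mapDQ, imK_mapDQ, this]

theorem quat_one_smul_add_zero_smul {T : Type*} [CommRing T] (p q : ℍ[T]) :
    (1 : T) • p + (0 : T) • q = p := by rw [one_smul, zero_smul, add_zero]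

theorem quat_zero_smul {T : Type*} [CommRing T] (p : ℍ[T]) : (0 : T) • p = 0 := zero_smul _ _

theorem quat_tr_mul_one_sub_mul {T : Type*} [CommRing T] (p q r : ℍ[T]) :
    tr (p * (1 - q) * r) = tr (p * r) - tr (p * q * r) := by
  rw [mul_sub, mul_one, sub_mul, tr_sub]

/-- If the primal part vanished, its imaginary part would make the three directions dependent and
its real part would give c₁₃ = c₁₂ c₂₃. The Gram determinant would then reduce to (1 - c₁₂²)(1 -
c₂₃²) = 0, contrary to nonparallelism. -/
theorem isUnit_tr_proj_triple {h₁ h₂ h₃ : DQ ℝ} (H₁ : h₁ * h₁ = -1) (H₂ : h₂ * h₂ = -1)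
    (H₃ : h₃ * h₃ = -1) (h12 : ¬Parallel h₁ h₂) (h23 : ¬Parallel h₂ h₃) :
    IsUnit (tr (proj h₁ * proj h₂ * proj h₃ * (1 - proj h₂))) := by
  rw [isUnit_dual, tr_proj_triple H₁ H₂ H₃]
  intro h0
  have c1 := dcos_sq_ne_one H₁ H₂ h12
  have c2 := dcos_sq_ne_one H₂ H₃ h23
  have n1 := (line_spec h₁ H₁).1
  have n2 := (line_spec h₂ H₂).1
  have n3 := (line_spec h₃ H₃).1
  simp only [TrivSqZeroExt.fst_mul, dualHalf, dualI, dualC, fst_mapDual, TrivSqZeroExt.fst_inl,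
    TrivSqZeroExt.fst_sub, triple_fst H₁ H₂ H₃, mul_eq_zero, inv_eq_zero, OfNat.ofNat_ne_zero,
    false_or, Complex.coe_algebraMap] at h0
  rw [dcos_fst H₁ H₂] at c1
  rw [dcos_fst H₂ H₃] at c2
  rw [dcos_fst H₁ H₂, dcos_fst H₂ H₃, dcos_fst H₁ H₃] at h0
  have hr := congrArg Complex.re h0
  have hi := congrArg Complex.im h0
  simp at hr hi
  have gram : det3 (dir h₁) (dir h₂) (dir h₃) ^ 2 =
      dir h₁ ⬝ᵥ dir h₁ * (dir h₂ ⬝ᵥ dir h₂ * dir h₃ ⬝ᵥ dir h₃ - (dir h₂ ⬝ᵥ dir h₃) ^ 2) -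
      dir h₁ ⬝ᵥ dir h₂ * (dir h₁ ⬝ᵥ dir h₂ * dir h₃ ⬝ᵥ dir h₃ -
        dir h₂ ⬝ᵥ dir h₃ * dir h₁ ⬝ᵥ dir h₃) +
      dir h₁ ⬝ᵥ dir h₃ * (dir h₁ ⬝ᵥ dir h₂ * dir h₂ ⬝ᵥ dir h₃ -
        dir h₂ ⬝ᵥ dir h₂ * dir h₁ ⬝ᵥ dir h₃) := by
    simp only [det3_eq, dot3_eq]; ring
  rw [n1, n2, n3, hi] at gram
  have : (1 - (dir h₁ ⬝ᵥ dir h₂) ^ 2) * (1 - (dir h₂ ⬝ᵥ dir h₃) ^ 2) = 0 := by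
    linear_combination (dir h₁ ⬝ᵥ dir h₃ - dir h₁ ⬝ᵥ dir h₂ * dir h₂ ⬝ᵥ dir h₃) * hr - gram
  rcases mul_eq_zero.mp this with h | h
  · exact c1 (by linarith)
  · exact c2 (by linarith)

/-! ### Nondegeneracy and the roots of one quad polynomial. -/

section Roots

variable {h₁ h₂ h₃ h₄ : DQ ℝ} {g : DQ ℂ} {α β α' β' : DualNumber ℂ}

theorem factor_one_zero (h : DQ ℝ) : factor h (1 : ℂ) 0 = proj h := by
  rw [factor, mapDQ_algebraMap_self, TrivSqZeroExt.inl_one, TrivSqZeroExt.inl_zero]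
  exact quat_one_smul_add_zero_smul _ _

/-- Apply the functional that reads off the first parameter of the middle factor and the sum of the
parameters of the last one. It exists because the coupling space has full dimension. -/
theorem fst_ne_zero_of_factor_mul (hd : Module.finrank ℝ (couplingSpace h₁ h₂ h₃) = 8) {a b c d : ℂ}
    (hcd : c + d = 1) (h0 : factor h₁ 1 0 * factor h₂ a b * factor h₃ c d = 0) : a = 0 := by
  obtain ⟨φ, hφ⟩ := exists_functional hd ![1, 1, 1] ![0, 0, 1]
  have := hφ ℂ 1 0 a b c d
  rw [h0, map_zero] at this
  simp [hcd] at this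
  exact this.symm

/-- A vanishing determinant of α, β would make the product of three nonzero factors zero, with
parameters (β₀, -α₀) at `h₂` and a projection at `h₃`; the same holds for α', β'. For the leading
coefficient, equality of β₀α'₀ and α₀β'₀ in the primal part of the cross ratio would give α₀β'₀ = 0,
although both are units. -/
theorem nonDeg_of_coeffs (H₁ : h₁ * h₁ = -1) (H₂ : h₂ * h₂ = -1) (H₃ : h₃ * h₃ = -1)
    (H₄ : h₄ * h₄ = -1) (h12 : ¬Parallel h₁ h₂) (h23 : ¬Parallel h₂ h₃) (h34 : ¬Parallel h₃ h₄)
    (hd : Module.finrank ℝ (couplingSpace h₁ h₂ h₃) = 8)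
    (hg : IsGen (proj h₁) (proj h₄) g)
    (hc : IsGen.Coeffs (proj h₁) (proj h₂) (proj h₃) g α β α' β') : NonDeg α β α' β' := by
  obtain ⟨uα, uβ, uα', uβ'⟩ := hc.isUnit (isProj_proj H₁) (isProj_proj H₂) (isProj_proj H₃)
    (genPos_proj H₁ H₂ h12) (genPos_proj H₂ H₃ h23)
  rw [isUnit_dual] at uα uβ uα' uβ'
  have key := fun a₂ b₂ a₃ b₃ => hc.prod_eq_smul_iff (isProj_proj H₃) (isProj_proj H₄)
    (genPos_proj H₃ H₄ h34) hg a₂ b₂ a₃ b₃ 0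
  have hf : ∀ a b c d : ℂ, factor h₁ 1 0 * factor h₂ a b * factor h₃ c d =
      proj h₁ * ((TrivSqZeroExt.inl a : DualNumber ℂ) • proj h₂ +
        (TrivSqZeroExt.inl b : DualNumber ℂ) • (1 - proj h₂)) *
      ((TrivSqZeroExt.inl c : DualNumber ℂ) • proj h₃ +
        (TrivSqZeroExt.inl d : DualNumber ℂ) • (1 - proj h₃)) := by
    intro a b c d
    rw [factor_one_zero, factor, factor, mapDQ_algebraMap_self, mapDQ_algebraMap_self]
  refine ⟨fun h0 => ?_, fun h0 => ?_, fun h0 => ?_⟩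
  · refine uβ (fst_ne_zero_of_factor_mul hd (a := β.fst) (b := -α.fst) (c := 1) (d := 0)
      (by simp) ?_)
    refine (hf _ _ _ _).trans (((key _ _ _ _).mpr ⟨?_, ?_⟩).trans (quat_zero_smul _))
    · rw [ddet] at h0
      ext
      · simp; ring
      · simp; linear_combination -h0
    · simp
  · refine uβ' (fst_ne_zero_of_factor_mul hd (a := β'.fst) (b := -α'.fst) (c := 0) (d := 1)
      (by simp) ?_)
    refine (hf _ _ _ _).trans (((key _ _ _ _).mpr ⟨?_, ?_⟩).trans (quat_zero_smul _))
    · simp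
    · rw [ddet] at h0
      ext
      · simp; ring
      · simp; linear_combination -h0
  · have hcr := hc.cross_ratio (isProj_proj H₁) (isProj_proj H₂) (isProj_proj H₃) hg
      (genPos_proj H₁ H₂ h12)
    rw [tr_proj_mul H₂ H₃, tr_proj_mul_compl H₂ H₃] at hcr
    have := congrArg TrivSqZeroExt.fst hcr
    simp [dualHalf] at this
    have h1 : α.fst * β'.fst = 0 := by
      linear_combination this - (2⁻¹ * (1 + ((dcos h₂ h₃).fst : ℂ))) * h0
    exact (mul_ne_zero uα uβ') h1

theorem exists_roots (σ π : ℂ) : ∃ r s : ℂ, r + s = σ ∧ r * s = π := by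
  obtain ⟨w, hw⟩ := IsAlgClosed.exists_pow_nat_eq (σ ^ 2 - 4 * π) (n := 2) (by norm_num)
  exact ⟨(σ + w) / 2, (σ - w) / 2, by ring, by linear_combination (-1 / 4 : ℂ) * hw⟩

/-- The quad polynomial by its two roots. -/
theorem quadPoly_spec (H₁ : h₁ * h₁ = -1) (H₂ : h₂ * h₂ = -1) (H₃ : h₃ * h₃ = -1)
    (H₄ : h₄ * h₄ = -1) (h12 : ¬Parallel h₁ h₂) (h23 : ¬Parallel h₂ h₃) (h34 : ¬Parallel h₃ h₄)
    (hd : Module.finrank ℝ (couplingSpace h₁ h₂ h₃) = 8)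
    (hg : IsGen (proj h₁) (proj h₄) g)
    (hc : IsGen.Coeffs (proj h₁) (proj h₂) (proj h₃) g α β α' β') :
    ∃ r s : ℂ, quadPoly g h₁ h₂ h₃ h₄ = (X - C r) * (X - C s) ∧
      r + s = logd α + logd β' - bval h₂ h₃ + fval h₂ h₃ ∧
      r * s - ((r + s) / 2) ^ 2 =
        (1 - ((dcos h₂ h₃).fst : ℝ)) / 2 * ((Complex.I * offset h₁ h₂ h₃ + bval h₁ h₂ + bval h₂ h₃) *
          (Complex.I * offset h₂ h₃ h₄ + bval h₂ h₃ + bval h₃ h₄)) -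
        ((Complex.I * (offset h₁ h₂ h₃ + offset h₂ h₃ h₄) + bval h₁ h₂ + bval h₂ h₃ + bval h₃ h₄ -
          fval h₂ h₃) / 2) ^ 2 := by
  have P₁ := isProj_proj H₁
  have P₂ := isProj_proj H₂
  have P₃ := isProj_proj H₃
  have P₄ := isProj_proj H₄
  have G12 := genPos_proj H₁ H₂ h12
  have G23 := genPos_proj H₂ H₃ h23
  have G34 := genPos_proj H₃ H₄ h34
  have hn := nonDeg_of_coeffs H₁ H₂ H₃ H₄ h12 h23 h34 hd hg hc
  obtain ⟨uα, uβ, uα', uβ'⟩ := hc.isUnit P₁ P₂ P₃ G12 G23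
  have hcr := hc.cross_ratio P₁ P₂ P₃ hg G12
  -- The three relations `lδ`, `lδ'`, `lb` determine all logarithmic derivatives up to one common
  -- unknown, which is the freedom in the choice of the generator.
  have lδ : logd β - logd α =
      -(Complex.I * offset h₁ h₂ h₃) - bval h₁ h₂ - bval h₂ h₃ := by
    have e := hc.beta_mul P₂
    have uT := isUnit_of_mul_isUnit_right (e ▸ uβ.mul (G12.unit.mul G23.unit))
    have := congrArg logd e
    rw [logd_mul uβ (G12.unit.mul G23.unit), logd_mul G12.unit G23.unit, logd_mul uα uT,
      logd_tr_triple' H₁ H₂ H₃ h12 h23 uT, logd_tr_proj_mul H₁ H₂ h12,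
      logd_tr_proj_mul H₂ H₃ h23] at this
    linear_combination this
  have lδ' : logd α' - logd α =
      -(Complex.I * offset h₂ h₃ h₄) - bval h₂ h₃ - bval h₃ h₄ := by
    have e := hc.alpha'_mul P₂ P₄ G12.unit hg
    rw [GenPos.tr_compl_compl P₃ P₄] at e
    have uT := isUnit_of_mul_isUnit_right (e ▸ uα'.mul (G34.unit.mul G23.unit))
    have eT : tr (proj h₂ * (1 - proj h₃) * (1 - proj h₄) * proj h₃) =
        -tr (proj h₂ * (1 - proj h₃) * proj h₄ * proj h₃) := by
      have h0 : tr (proj h₂ * (1 - proj h₃) * proj h₃) = 0 := by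
        rw [mul_assoc, P₃.compl_mul, mul_zero, tr_zero]
      exact (quat_tr_mul_one_sub_mul _ _ _).trans (by rw [h0, zero_sub])
    rw [eT] at e uT
    have := congrArg logd e
    rw [logd_mul uα' (G34.unit.mul G23.unit), logd_mul G34.unit G23.unit, logd_mul uα uT, logd_neg,
      logd_tr_triple' H₂ H₃ H₄ h23 h34 (by simpa using uT.neg), logd_tr_proj_mul H₃ H₄ h34,
      logd_tr_proj_mul H₂ H₃ h23] at this
    linear_combination this
  have lb : logd α' + logd β - logd α - logd β' = -2 * bval h₂ h₃ := by
    have := congrArg logd hcr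
    rw [logd_mul (uα'.mul uβ) G23.unit, logd_mul uα' uβ, logd_neg,
      logd_mul (uα.mul uβ') G23.unit_compl, logd_mul uα uβ', logd_tr_proj_mul H₂ H₃ h23,
      logd_tr_proj_mul_compl H₂ H₃ h23] at this
    linear_combination this
  set c : ℂ := Complex.ofReal (dcos h₂ h₃).fst with hcdef
  have hf : (fval h₂ h₃ : ℂ) = bval h₂ h₃ * c := by rw [fval, hcdef]; push_cast; ring
  -- By the cross ratio the two products of leading coefficients are to the leading coefficient of
  -- the numerator as (1 - c)/2 and -(1 + c)/2 are to one. Each linear factor has a logarithmic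
  -- derivative as its root, so the monic polynomial is a weighted mean of two split quadratics.
  have hN : quadNum α β α' β' = C (β.fst * α'.fst - α.fst * β'.fst) *
      (C ((1 - c) / 2) * ((X - C (logd β)) * (X - C (logd α'))) +
        C ((1 + c) / 2) * ((X - C (logd α)) * (X - C (logd β')))) := by
    have h1 := congrArg TrivSqZeroExt.fst hcr
    rw [tr_proj_mul H₂ H₃, tr_proj_mul_compl H₂ H₃] at h1
    simp [dualHalf] at h1
    rw [← hcdef] at h1
    have k1 : (β.fst * α'.fst - α.fst * β'.fst) * ((1 - c) / 2) = β.fst * α'.fst := by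
      linear_combination -h1
    have k2 : (β.fst * α'.fst - α.fst * β'.fst) * ((1 + c) / 2) = -(α.fst * β'.fst) := by
      linear_combination h1
    have hs : ∀ d : DualNumber ℂ, IsUnit d → C d.fst * X - C d.snd = C d.fst * (X - C (logd d)) := by
      intro d hd
      rw [mul_sub, ← C_mul, logd, mul_div_cancel₀ _ (isUnit_dual.mp hd)]
    rw [quadNum, hs _ uα, hs _ uβ, hs _ uα', hs _ uβ', mul_add, ← mul_assoc (C _) (C _), ← C_mul,
      k1, ← mul_assoc (C _) (C ((1 + c) / 2)), ← C_mul, k2, C_mul, C_neg, C_mul]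
    ring
  obtain ⟨r, s, hr, hs⟩ := exists_roots
    ((1 - c) / 2 * (logd β + logd α') + (1 + c) / 2 * (logd α + logd β'))
    ((1 - c) / 2 * (logd β * logd α') + (1 + c) / 2 * (logd α * logd β'))
  have hQ : C ((1 - c) / 2) * ((X - C (logd β)) * (X - C (logd α'))) +
        C ((1 + c) / 2) * ((X - C (logd α)) * (X - C (logd β'))) = (X - C r) * (X - C s) := by
    have h1 : (X - C r) * (X - C s) = X ^ 2 - C (r + s) * X + C (r * s) := by
      rw [C_add, C_mul]; ring
    have h2 : C ((1 - c) / 2) + C ((1 + c) / 2) = 1 := by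
      rw [← C_add, ← C_1]; congr 1; ring
    rw [h1, hr, hs]
    simp only [C_add, C_mul]
    linear_combination X ^ 2 * h2
  refine ⟨r, s, ?_, ?_, ?_⟩
  · rw [quadPoly_eq H₃ H₄ h34 hg hc hn, hN, hQ]
    have hm : ((X - C r) * (X - C s)).Monic := (monic_X_sub_C r).mul (monic_X_sub_C s)
    refine Eq.trans ?_ hm.normalize_eq_self
    exact normalize_eq_normalize_iff_associated.mpr
      (associated_unit_mul_left _ _ (isUnit_C.mpr (isUnit_iff_ne_zero.mpr hn.lead)))
  · rw [hr, hf]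
    linear_combination (1 - c) / 2 * lb
  · rw [hs, hr, hf]
    have e1 : logd β = logd α -(Complex.I * offset h₁ h₂ h₃) - bval h₁ h₂ - bval h₂ h₃ := by
      linear_combination lδ
    have e2 : logd α' = logd α - (Complex.I * offset h₂ h₃ h₄) - bval h₂ h₃ - bval h₃ h₄ := by
      linear_combination lδ'
    have e3 : logd β' = logd α -(Complex.I * offset h₁ h₂ h₃) - bval h₁ h₂ - (Complex.I * offset h₂ h₃ h₄)
      - bval h₃ h₄ := by
      linear_combination lδ + lδ' - lb
    rw [e1, e2, e3]
    ring

end Roots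

/-- Six lines, cyclically consecutive ones not parallel, with coupling spaces of full dimension. -/
structure IsGeneric (h : ZMod 6 → DQ ℝ) : Prop where
  sq : ∀ i, h i * h i = -1
  par : ∀ i, ¬Parallel (h i) (h (i + 1))
  dim : ∀ i, Module.finrank ℝ (couplingSpace (h i) (h (i + 1)) (h (i + 2))) = 8

theorem paramS_eq (h : ZMod 6 → DQ ℝ) (k : ZMod 6) :
    paramS h k = offset (h (k - 1)) (h k) (h (k + 1)) := rfl

theorem sum_roots_two (r s r' s' : ℂ) :
    meanRoot ((X - C r) * (X - C s)) ((X - C r') * (X - C s')) = (r + s + r' + s') / 4 := by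
  have h : ∀ r s : ℂ, ((X - C r) * (X - C s)).roots = {r, s} := fun r s => by
    rw [roots_mul (mul_ne_zero (X_sub_C_ne_zero r) (X_sub_C_ne_zero s)), roots_X_sub_C,
      roots_X_sub_C]; rfl
  rw [meanRoot, h, h]
  simp only [Multiset.insert_eq_cons, Multiset.sum_add, Multiset.sum_cons, Multiset.sum_singleton,
    Multiset.card_add, Multiset.card_cons, Multiset.card_singleton]
  push_cast
  ring

theorem IsGeneric.par' {h : ZMod 6 → DQ ℝ} (H : IsGeneric h) {i j : ZMod 6} (hij : i + 1 = j) :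
    ¬Parallel (h i) (h j) := hij ▸ H.par i

theorem IsGeneric.dim' {h : ZMod 6 → DQ ℝ} (H : IsGeneric h) {i j l : ZMod 6} (hij : i + 1 = j)
    (hil : i + 2 = l) : Module.finrank ℝ (couplingSpace (h i) (h j) (h l)) = 8 :=
  hij ▸ hil ▸ H.dim i

/-- The two quad polynomials of opposite quads by their roots. -/
theorem IsGeneric.exists_roots {h : ZMod 6 → DQ ℝ} (H : IsGeneric h) (k : ZMod 6) {g : DQ ℂ}
    (hg : IsGen (proj (h k)) (proj (h (k + 3))) g) :
    ∃ r s r' s' : ℂ, quadPoly g (h k) (h (k + 1)) (h (k + 2)) (h (k + 3)) = (X - C r) * (X - C s) ∧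
      quadPoly (star g) (h (k + 3)) (h (k + 4)) (h (k + 5)) (h k) = (X - C r') * (X - C s') ∧
      r + s - (r' + s') = Complex.I * (paramS h k - paramS h (k + 3)) -
        fval (h (k + 5)) (h k) - fval (h k) (h (k + 1)) + fval (h (k + 2)) (h (k + 3)) +
        fval (h (k + 3)) (h (k + 4)) ∧
      r * s - ((r + s) / 2) ^ 2 =
        (1 - paramC h (k + 1)) / 2 * ((Complex.I * paramS h (k + 1) + paramB h k + paramB h (k + 1)) *
          (Complex.I * paramS h (k + 2) + paramB h (k + 1) + paramB h (k + 2))) -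
        ((Complex.I * (paramS h (k + 1) + paramS h (k + 2)) + paramB h k + paramB h (k + 1) +
          paramB h (k + 2) - paramB h (k + 1) * paramC h (k + 1)) / 2) ^ 2 := by
  have a1 : k + 1 + 1 = k + 2 := by ring
  have a2 : k + 2 + 1 = k + 3 := by ring
  have a3 : k + 3 + 1 = k + 4 := by ring
  have a4 : k + 4 + 1 = k + 5 := by ring
  have a5 : k + 5 + 1 = k := by rw [add_assoc]; exact add_zero k
  have a6 : k + 3 + 2 = k + 5 := by ring
  have m0 : k - 1 = k + 5 := by rw [← a5, add_sub_cancel_right, a5]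
  have m1 : k + 1 - 1 = k := by ring
  have m2 : k + 2 - 1 = k + 1 := by ring
  have m3 : k + 3 - 1 = k + 2 := by ring
  have P₁ := isProj_proj (H.sq k)
  have P₂ := isProj_proj (H.sq (k + 1))
  have P₃ := isProj_proj (H.sq (k + 2))
  have P₄ := isProj_proj (H.sq (k + 3))
  have P₅ := isProj_proj (H.sq (k + 4))
  have P₆ := isProj_proj (H.sq (k + 5))
  have h12 := H.par k
  have h23 := H.par' a1
  have h34 := H.par' a2
  have h45 := H.par' a3
  have h56 := H.par' a4
  have h61 := H.par' a5
  have G12 := genPos_proj (H.sq _) (H.sq _) h12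
  have G23 := genPos_proj (H.sq _) (H.sq _) h23
  have G34 := genPos_proj (H.sq _) (H.sq _) h34
  have G45 := genPos_proj (H.sq _) (H.sq _) h45
  have G56 := genPos_proj (H.sq _) (H.sq _) h56
  have G61 := genPos_proj (H.sq _) (H.sq _) h61
  have hg' := hg.star_gen P₁ P₄
  obtain ⟨α, β, α', β', hc⟩ := hg.exists_coeffs (e₂ := proj (h (k + 1))) P₁ P₃ P₄ G34
  obtain ⟨γ, δ, γ', δ', hc'⟩ := hg'.exists_coeffs (e₂ := proj (h (k + 4))) P₄ P₆ P₁ G61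
  obtain ⟨r, s, q1, q2, q3⟩ := quadPoly_spec (H.sq _) (H.sq _) (H.sq _) (H.sq _) h12 h23 h34
    (H.dim k) hg hc
  obtain ⟨r', s', q1', q2', -⟩ := quadPoly_spec (H.sq _) (H.sq _) (H.sq _) (H.sq _) h45 h56 h61
    (H.dim' a3 a6) hg' hc'
  refine ⟨r, s, r', s', q1, q1', ?_, ?_⟩
  -- Subtracting the logarithmic derivatives of the two closing identities eliminates `κ`; only the
  -- offsets and angles at `h k` and `h (k + 3)`, and the middle pair of each quad, are left.
  · obtain ⟨κ, k1, k2⟩ := IsGen.Coeffs.closing P₁ P₂ P₃ P₄ P₅ P₆ hc hc'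
    obtain ⟨uα, -, -, uβ'⟩ := hc.isUnit P₁ P₂ P₃ G12 G23
    obtain ⟨uγ, -, -, uδ'⟩ := hc'.isUnit P₄ P₅ P₆ G45 G56
    have uT : IsUnit (tr (proj (h (k + 5)) * proj (h k) * proj (h (k + 1)) * (1 - proj (h k)))) :=
      isUnit_tr_proj_triple (H.sq _) (H.sq _) (H.sq _) h61 h12
    have uκ : IsUnit κ := isUnit_of_mul_isUnit_right (k1 ▸ G23.unit.mul uT)
    have uT' := isUnit_of_mul_isUnit_right (k2 ▸ (uγ.mul uδ').mul uκ)
    have l1 := congrArg logd k1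
    have l2 := congrArg logd k2
    rw [logd_mul G23.unit uT, logd_mul (uα.mul uβ') uκ, logd_mul uα uβ',
      logd_tr_triple (H.sq _) (H.sq _) (H.sq _) h61 h12 uT,
      logd_tr_proj_mul (H.sq _) (H.sq _) h23] at l1
    rw [logd_mul G56.unit uT', logd_mul (uγ.mul uδ') uκ, logd_mul uγ uδ',
      logd_tr_triple (H.sq _) (H.sq _) (H.sq _) h34 h45 uT',
      logd_tr_proj_mul (H.sq _) (H.sq _) h56] at l2
    rw [q2, q2', paramS_eq, paramS_eq, m0, m3, a3]
    linear_combination l2 - l1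
  · rw [q3]
    simp only [paramS_eq, paramB_eq, paramC_eq, m1, m2, a1, a2]
    rw [fval]; push_cast; ring

/-- After the shift the centre of the roots is a quarter of the difference of the two root sums, and
the discriminant is untouched; neither depends on `g`. An arbitrary generator is allowed because the
opposite quad is later used with a conjugate generator. -/
theorem IsGeneric.quadPoly_comp_eq {h : ZMod 6 → DQ ℝ} (H : IsGeneric h) (k : ZMod 6) {g : DQ ℂ}
    (hg : IsGen (proj (h k)) (proj (h (k + 3))) g) :
    (quadPoly g (h k) (h (k + 1)) (h (k + 2)) (h (k + 3))).comp
      (X + C (meanRoot (quadPoly g (h k) (h (k + 1)) (h (k + 2)) (h (k + 3)))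
        (quadPoly (star g) (h (k + 3)) (h (k + 4)) (h (k + 5)) (h k)))) =
      quadFormula (paramB h) (paramC h) (paramS h) k := by
  obtain ⟨r, s, r', s', q1, q2, q3, q4⟩ := H.exists_roots k hg
  rw [q1, q2, sum_roots_two, quadFormula]
  have a5 : k + 5 + 1 = k := by rw [add_assoc]; exact add_zero k
  have a2 : k + 2 + 1 = k + 3 := by ring
  have a3 : k + 3 + 1 = k + 4 := by ring
  have hf : ∀ j, paramB h j * paramC h j = fval (h j) (h (j + 1)) := fun j => by
    rw [paramB_eq, paramC_eq, fval]
  have e1 : (⟨(paramB h k * paramC h k - paramB h (k + 2) * paramC h (k + 2) -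
      paramB h (k + 3) * paramC h (k + 3) + paramB h (k + 5) * paramC h (k + 5)) / 4,
      (paramS h (k + 3) - paramS h k) / 4⟩ : ℂ) = (r + s + r' + s') / 4 - (r + s) / 2 := by
    rw [hf, hf, hf, hf, a5, a2, a3]
    rw [Complex.mk_eq_add_mul_I]
    push_cast
    linear_combination (1 / 4 : ℂ) * q3
  have e2 : (⟨(paramS h (k + 1) ^ 2 + paramS h (k + 2) ^ 2 + paramB h (k + 1) ^ 2
      - (paramB h (k + 1) * paramC h (k + 1)) ^ 2 - paramB h k ^ 2 - paramB h (k + 2) ^ 2) / 4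
      - paramC h (k + 1) / 2 * (paramB h k * paramB h (k + 2) - paramS h (k + 1) * paramS h (k + 2)),
      -(paramS h (k + 1) * (paramB h k + paramB h (k + 2) * paramC h (k + 1)) +
        paramS h (k + 2) * (paramB h (k + 2) + paramB h k * paramC h (k + 1))) / 2⟩ : ℂ) =
      r * s - ((r + s) / 2) ^ 2 := by
    rw [q4, Complex.mk_eq_add_mul_I]
    push_cast
    linear_combination (-(paramS h (k + 1) : ℂ) * paramS h (k + 2) * ((1 - paramC h (k + 1)) / 2) + ((paramS h (k + 1) + paramS h (k + 2)) / 2) ^ 2) * Complex.I_sq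
  rw [e1, e2]
  simp only [mul_comp, sub_comp, X_comp, C_comp]
  have : C (r * s - ((r + s) / 2) ^ 2) = C r * C s - (C ((r + s) / 2)) ^ 2 := by
    rw [C_sub, C_mul, C_pow]
  rw [this, C_sub]
  have h2 : C r + C s = 2 * C ((r + s) / 2) := by
    rw [← C_add, ← C_ofNat, ← C_mul]; congr 1; ring
  linear_combination (-(X + C ((r + s + r' + s') / 4))) * h2

theorem IsGeneric.isGen_lineGenerator {h : ZMod 6 → DQ ℝ} (H : IsGeneric h) (k : ZMod 6) :
    IsGen (proj (h k)) (proj (h (k + 3))) (lineGenerator (h k) (h (k + 3))) :=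
  Linkage.isGen_lineGenerator (H.sq k) (H.sq (k + 1)) (H.sq _) (H.par k)

theorem IsGeneric.invQuadPlus_eq {h : ZMod 6 → DQ ℝ} (H : IsGeneric h) (k : ZMod 6) :
    invQuadPlus h k = quadFormula (paramB h) (paramC h) (paramS h) k :=
  H.quadPoly_comp_eq k (H.isGen_lineGenerator k)

end Linkage

end

noncomputable section
namespace Linkage

open Quaternion Polynomial

theorem DQ.add_zero {R : Type*} [CommRing R] (q : DQ R) : q + 0 = q := _root_.add_zero q

theorem DQ.zero_add {R : Type*} [CommRing R] (q : DQ R) : 0 + q = q := _root_.zero_add q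

/-! ### Reversing lines -/

/-- The linkage with some of its lines reversed. -/
def signed (s : ZMod 6 → Bool) (h : ZMod 6 → DQ ℝ) : ZMod 6 → DQ ℝ :=
  fun i => if s i then -h i else h i

theorem neg_mem_submodule {W : Submodule ℝ (DQ ℝ)} {q : DQ ℝ} (hq : q ∈ W) : -q ∈ W := by
  have := W.smul_mem (-1 : ℝ) hq
  rwa [DQ.neg_smul, DQ.one_smul] at this

theorem couplingSpace_neg_left_le (a b c : DQ ℝ) : couplingSpace (-a) b c ≤ couplingSpace a b c := by
  rw [couplingSpace, Submodule.span_le]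
  have h : ∀ q ∈ ({1, a, b, c, a * b, a * c, b * c, a * b * c} : Set (DQ ℝ)),
      q ∈ couplingSpace a b c := fun q hq => Submodule.subset_span hq
  simp only [Set.mem_insert_iff, Set.mem_singleton_iff, forall_eq_or_imp, forall_eq] at h
  obtain ⟨h0, h1, h2, h3, h4, h5, h6, h7⟩ := h
  rintro q (rfl | rfl | rfl | rfl | rfl | rfl | rfl | rfl) <;> simp only [DQ.neg_mul, SetLike.mem_coe]
  exacts [h0, neg_mem_submodule h1, h2, h3, neg_mem_submodule h4, neg_mem_submodule h5, h6, neg_mem_submodule h7]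

theorem couplingSpace_neg_mid_le (a b c : DQ ℝ) : couplingSpace a (-b) c ≤ couplingSpace a b c := by
  rw [couplingSpace, Submodule.span_le]
  have h : ∀ q ∈ ({1, a, b, c, a * b, a * c, b * c, a * b * c} : Set (DQ ℝ)),
      q ∈ couplingSpace a b c := fun q hq => Submodule.subset_span hq
  simp only [Set.mem_insert_iff, Set.mem_singleton_iff, forall_eq_or_imp, forall_eq] at h
  obtain ⟨h0, h1, h2, h3, h4, h5, h6, h7⟩ := h
  rintro q (rfl | rfl | rfl | rfl | rfl | rfl | rfl | rfl) <;>
    simp only [DQ.neg_mul, DQ.mul_neg, SetLike.mem_coe]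
  exacts [h0, h1, neg_mem_submodule h2, h3, neg_mem_submodule h4, h5, neg_mem_submodule h6, neg_mem_submodule h7]

theorem couplingSpace_neg_right_le (a b c : DQ ℝ) : couplingSpace a b (-c) ≤ couplingSpace a b c := by
  rw [couplingSpace, Submodule.span_le]
  have h : ∀ q ∈ ({1, a, b, c, a * b, a * c, b * c, a * b * c} : Set (DQ ℝ)),
      q ∈ couplingSpace a b c := fun q hq => Submodule.subset_span hq
  simp only [Set.mem_insert_iff, Set.mem_singleton_iff, forall_eq_or_imp, forall_eq] at h
  obtain ⟨h0, h1, h2, h3, h4, h5, h6, h7⟩ := h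
  rintro q (rfl | rfl | rfl | rfl | rfl | rfl | rfl | rfl) <;>
    simp only [DQ.mul_neg, SetLike.mem_coe]
  exacts [h0, h1, h2, neg_mem_submodule h3, h4, neg_mem_submodule h5, neg_mem_submodule h6, neg_mem_submodule h7]

theorem couplingSpace_neg_left (a b c : DQ ℝ) : couplingSpace (-a) b c = couplingSpace a b c :=
  le_antisymm (couplingSpace_neg_left_le a b c) (by
    have := couplingSpace_neg_left_le (-a) b c
    rwa [DQ.neg_neg] at this)

theorem couplingSpace_neg_mid (a b c : DQ ℝ) : couplingSpace a (-b) c = couplingSpace a b c :=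
  le_antisymm (couplingSpace_neg_mid_le a b c) (by
    have := couplingSpace_neg_mid_le a (-b) c
    rwa [DQ.neg_neg] at this)

theorem couplingSpace_neg_right (a b c : DQ ℝ) : couplingSpace a b (-c) = couplingSpace a b c :=
  le_antisymm (couplingSpace_neg_right_le a b c) (by
    have := couplingSpace_neg_right_le a b (-c)
    rwa [DQ.neg_neg] at this)

theorem IsGeneric.signed {h : ZMod 6 → DQ ℝ} (H : IsGeneric h) (s : ZMod 6 → Bool) :
    IsGeneric (signed s h) := by
  have hsq : ∀ i, Linkage.signed s h i * Linkage.signed s h i = -1 := fun i => by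
    rw [Linkage.signed]; split_ifs
    · exact sq_neg_eq (H.sq i)
    · exact H.sq i
  refine ⟨hsq, fun i => not_parallel_of_dcos (hsq _) (hsq _) ?_, fun i => ?_⟩
  · have := dcos_sq_ne_one (H.sq i) (H.sq (i + 1)) (H.par i)
    simp only [Linkage.signed]
    split_ifs <;>
    simpa only [dcos_neg_left, dcos_neg_right, TrivSqZeroExt.fst_neg, neg_sq, neg_neg] using this
  · have e : couplingSpace (Linkage.signed s h i) (Linkage.signed s h (i + 1))
        (Linkage.signed s h (i + 2)) = couplingSpace (h i) (h (i + 1)) (h (i + 2)) := by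
      simp only [Linkage.signed]
      split_ifs <;> simp only [couplingSpace_neg_left, couplingSpace_neg_mid,
        couplingSpace_neg_right]
    rw [e]
    exact H.dim i

theorem dir_neg (h : DQ ℝ) : dir (-h) = -dir h := by
  ext i; fin_cases i <;> simp [dir]

theorem moment_neg (h : DQ ℝ) : moment (-h) = -moment h := by
  ext i; fin_cases i <;> simp [moment]

theorem basePoint_neg (h : DQ ℝ) : basePoint (-h) = basePoint h := by
  rw [basePoint, basePoint, dir_neg, moment_neg]; simp

theorem footParam_neg_left (h h' : DQ ℝ) : footParam (-h) h' = -footParam h h' := by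
  simp only [footParam, basePoint_neg, dir_neg, dotProduct_neg, neg_dotProduct, neg_sq]
  ring

theorem footParam_neg_right (h h' : DQ ℝ) : footParam h (-h') = footParam h h' := by
  simp only [footParam, basePoint_neg, dir_neg, dotProduct_neg, neg_sq]
  ring

theorem bval_neg_left (h h' : DQ ℝ) : bval (-h) h' = -bval h h' := by
  simp [bval, dcos_neg_left, neg_div]

theorem bval_neg_right (h h' : DQ ℝ) : bval h (-h') = -bval h h' := by
  simp [bval, dcos_neg_right, neg_div]

/-- The sign of the reversal. -/
def sgn (s : Bool) : ℝ := if s then -1 else 1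

theorem paramB_signed (s : ZMod 6 → Bool) (h : ZMod 6 → DQ ℝ) (k : ZMod 6) :
    paramB (signed s h) k = sgn (s k) * sgn (s (k + 1)) * paramB h k := by
  simp only [paramB_eq, signed, sgn]
  split_ifs <;> simp [bval_neg_left, bval_neg_right]

theorem paramC_signed (s : ZMod 6 → Bool) (h : ZMod 6 → DQ ℝ) (k : ZMod 6) :
    paramC (signed s h) k = sgn (s k) * sgn (s (k + 1)) * paramC h k := by
  simp only [paramC_eq, signed, sgn]
  split_ifs <;> simp [dcos_neg_left, dcos_neg_right]

theorem paramS_signed (s : ZMod 6 → Bool) (h : ZMod 6 → DQ ℝ) (k : ZMod 6) :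
    paramS (signed s h) k = sgn (s k) * paramS h k := by
  simp only [paramS, signed, sgn]
  split_ifs <;> simp [footParam_neg_left, footParam_neg_right] <;> ring

/-- The odd indices. -/
def oddIdx : ZMod 6 → Bool := fun i => decide (Odd i.val)

theorem neg_one_pow_mul {M : Type*} [Ring M] (n : ℕ) (q : M) :
    (-1) ^ n * q = if Odd n then -q else q := by
  split_ifs with hn
  · rw [hn.neg_one_pow, neg_mul, one_mul]
  · rw [(Nat.not_odd_iff_even.mp hn).neg_one_pow, one_mul]

theorem flipOdd_eq (h : ZMod 6 → DQ ℝ) : flipOdd h = signed oddIdx h := by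
  funext i
  refine (neg_one_pow_mul _ _).trans ?_
  simp [signed, oddIdx]

theorem sgn_oddIdx (i : ZMod 6) : sgn (oddIdx i) = (-1) ^ i.val := by
  rw [sgn, oddIdx]
  by_cases h : Odd i.val
  · simp [h, h.neg_one_pow]
  · simp [h, (Nat.not_odd_iff_even.mp h).neg_one_pow]

theorem sgn_oddIdx_mul (i : ZMod 6) : sgn (oddIdx i) * sgn (oddIdx (i + 1)) = -1 := by
  have : ∀ i : ZMod 6, oddIdx (i + 1) = !oddIdx i := by decide
  rw [this, sgn, sgn]
  cases oddIdx i <;> simp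

theorem IsGeneric.invQuadMinus_eq {h : ZMod 6 → DQ ℝ} (H : IsGeneric h) (k : ZMod 6) :
    invQuadMinus h k = quadFormula (fun j => -paramB h j) (fun j => -paramC h j)
      (fun j => (-1) ^ j.val * paramS h j) k := by
  rw [invQuadMinus, flipOdd_eq, (H.signed oddIdx).invQuadPlus_eq]
  congr 1
  · funext j; rw [paramB_signed, sgn_oddIdx_mul, neg_one_mul]
  · funext j; rw [paramC_signed, sgn_oddIdx_mul, neg_one_mul]
  · funext j; rw [paramS_signed, sgn_oddIdx]

/-! ### Moving the linkage -/

section Chain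

variable {M : Type*} [Monoid M] (x : ZMod 6 → M) (a : ZMod 6) (m : ℕ)

theorem chain_zero : chain x a 0 = 1 := rfl

theorem chain_succ : chain x a (m + 1) = chain x a m * x (a + m) := by
  simp [chain, List.range_succ]

theorem chain_one : chain x a 1 = x a := by simp [chain]

theorem chain_succ' : chain x a (m + 1) = x a * chain x (a + 1) m := by
  induction m with
  | zero => simp [chain_one, chain_zero]
  | succ m ih =>
    rw [chain_succ, ih, chain_succ, mul_assoc]
    congr 3
    push_cast; ring

theorem isUnit_chain (hx : ∀ i, IsUnit (x i)) : IsUnit (chain x a m) := by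
  induction m with
  | zero => exact isUnit_one
  | succ m ih => rw [chain_succ]; exact ih.mul (hx _)

/-- A cyclic shift conjugates the full product by an invertible factor, and a central element is
fixed by conjugation. -/
theorem chain_six_eq (hx : ∀ i, IsUnit (x i)) {c : M} (hc : ∀ q, c * q = q * c)
    (h : chain x 1 6 = c) (a : ZMod 6) : chain x a 6 = c := by
  have step : ∀ a, chain x a 6 = c → chain x (a + 1) 6 = c := by
    intro a ha
    have h6 : a + 1 + ((5 : ℕ) : ZMod 6) = a := by
      have : ((5 : ℕ) : ZMod 6) = 5 := rfl
      rw [this, add_assoc]; exact add_zero a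
    rw [chain_succ'] at ha
    rw [chain_succ, h6]
    apply (hx a).mul_left_cancel
    rw [← mul_assoc, ha, hc]
  have key : ∀ n : ℕ, chain x (1 + (n : ZMod 6)) 6 = c := by
    intro n
    induction n with
    | zero => simpa using h
    | succ n ih =>
      have := step _ ih
      rwa [add_assoc, ← Nat.cast_succ] at this
  have := key (a - 1).val
  rwa [ZMod.natCast_zmod_val, add_sub_cancel] at this

end Chain

section Conj

variable {M : Type*} [Ring M]

theorem ringInverse_eq {g v : M} (h1 : g * v = 1) (h2 : v * g = 1) : Ring.inverse g = v :=
  Ring.inverse_unit ⟨g, v, h1, h2⟩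

theorem conj_mul_eq {g v ρ σ c d g' : M} (h1 : g * v = 1) (h2 : v * g = 1) (h3 : ρ * σ = 1)
    (h4 : σ * ρ = 1) (hc : ∀ q, c * q = q * c) (hcd : c * d = 1) (hg' : g' = c * (g * ρ)) (q : M) :
    g' * q * Ring.inverse g' = g * (ρ * q * σ) * v := by
  have hdc : d * c = 1 := by rw [← hc, hcd]
  have e1 : c * (g * ρ) * (σ * v * d) = 1 := by
    have : c * (g * ρ) * (σ * v * d) = c * (g * (ρ * σ) * v) * d := by simp only [mul_assoc]
    rw [this, h3, mul_one, h1, mul_one, hcd]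
  have e2 : σ * v * d * (c * (g * ρ)) = 1 := by
    have : σ * v * d * (c * (g * ρ)) = σ * (v * (d * c) * g) * ρ := by simp only [mul_assoc]
    rw [this, hdc, mul_one, h2, mul_one, h4]
  have e3 : c * (g * ρ) * q * (σ * v * d) = c * (g * (ρ * q * σ) * v) * d := by
    simp only [mul_assoc]
  rw [hg', ringInverse_eq e1 e2, e3, hc, mul_assoc, hcd, mul_one]

/-- Consecutive frames differ by the factor at the joint between them, up to a central element. As
`x i` commutes with `h i`, a line may be moved with the frame on either side of it. So three
neighbouring lines share one conjugation, the last being first rotated about the middle one. -/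
theorem moved_spec {x h : ZMod 6 → M} (hx : ∀ i, ∃ σ, x i * σ = 1 ∧ σ * x i = 1)
    (hxh : ∀ i, x i * h i = h i * x i) {c d : M} (hc : ∀ q, c * q = q * c)
    (hd : ∀ q, d * q = q * d) (hcd : c * d = 1) (h6 : chain x 1 6 = c) (b i : ZMod 6)
    {mv : ZMod 6 → M} (hmv : ∀ i, mv i = chain x (b + 1) (i - (b + 1)).val * h i *
      Ring.inverse (chain x (b + 1) (i - (b + 1)).val)) :
    ∃ g v, g * v = 1 ∧ v * g = 1 ∧ mv (i - 1) = g * h (i - 1) * v ∧ mv i = g * h i * v ∧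
      ∀ σ, x i * σ = 1 → σ * x i = 1 → mv (i + 1) = g * (x i * h (i + 1) * σ) * v := by
  have hu : ∀ i, IsUnit (x i) := fun i => by
    obtain ⟨σ, h1, h2⟩ := hx i
    exact ⟨⟨x i, σ, h1, h2⟩, rfl⟩
  have hdc : d * c = 1 := by rw [← hc, hcd]
  have step : ∀ i, ∃ c d : M, (∀ q, c * q = q * c) ∧ c * d = 1 ∧
      chain x (b + 1) (i + 1 - (b + 1)).val = c * (chain x (b + 1) (i - (b + 1)).val * x i) := by
    intro i
    -- At `i = b` the index wraps around: the frame jumps back to the identity after a full turn,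
    -- and the central element `d` accounts for this.
    by_cases hib : i = b
    · subst hib
      have v1 : (i + 1 - (i + 1)).val = 0 := by simp
      have v2 : ∀ i : ZMod 6, (i - (i + 1)).val = 5 := by decide
      have v3 : ∀ i : ZMod 6, i + 1 + ((5 : ℕ) : ZMod 6) = i := by decide
      refine ⟨d, c, hd, hdc, ?_⟩
      have := chain_succ x (i + 1) 5
      rw [v3, chain_six_eq x hu hc h6] at this
      rw [v1, v2, ← this, hdc, chain_zero]
    · have v1 : ∀ i b : ZMod 6, i ≠ b → (i + 1 - (b + 1)).val = (i - (b + 1)).val + 1 := by decide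
      refine ⟨1, 1, fun q => by simp, by simp, ?_⟩
      rw [v1 i b hib, chain_succ, ZMod.natCast_zmod_val, add_sub_cancel, one_mul]
  set g := chain x (b + 1) (i - (b + 1)).val with hg
  obtain ⟨u, hu'⟩ := isUnit_chain x (b + 1) (i - (b + 1)).val hu
  have hinv : Ring.inverse g = ↑u⁻¹ := by rw [hg, ← hu', Ring.inverse_unit]
  have hgv : g * ↑u⁻¹ = 1 := by rw [hg, ← hu']; simp
  have hvg : ↑u⁻¹ * g = 1 := by rw [hg, ← hu']; simp
  refine ⟨g, ↑u⁻¹, hgv, hvg, ?_, ?_, ?_⟩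
  · obtain ⟨c', d', hc', hcd', e⟩ := step (i - 1)
    obtain ⟨σ, h1, h2⟩ := hx (i - 1)
    obtain ⟨w, hw⟩ := isUnit_chain x (b + 1) (i - 1 - (b + 1)).val hu
    rw [sub_add_cancel, ← hg] at e
    have := conj_mul_eq (g := chain x (b + 1) (i - 1 - (b + 1)).val) (v := ↑w⁻¹)
      (by rw [← hw]; simp) (by rw [← hw]; simp) h1 h2 hc' hcd' e (h (i - 1))
    rw [hinv, hxh, mul_assoc (h (i - 1)), h1, mul_one] at this
    rw [this, hmv, ← hw, Ring.inverse_unit]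
  · rw [hmv, ← hg, hinv]
  · intro σ h1 h2
    obtain ⟨c', d', hc', hcd', e⟩ := step i
    rw [hmv, conj_mul_eq hgv hvg h1 h2 hc' hcd' e]

end Conj

section ConjQuat

variable {T : Type*} [CommRing T]

theorem re_mul_comm (p q : ℍ[T]) : (p * q).re = (q * p).re := by simp; ring

theorem re_conj {g v : ℍ[T]} (h : v * g = 1) (q : ℍ[T]) : (g * q * v).re = q.re := by
  rw [re_mul_comm, ← mul_assoc, h, one_mul]

theorem tr_conj {g v : ℍ[T]} (h : v * g = 1) (q : ℍ[T]) : tr (g * q * v) = tr q := by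
  rw [tr, tr, re_conj h]

theorem conj_mul_conj {M : Type*} [Monoid M] {g v : M} (h : v * g = 1) (p q : M) :
    g * p * v * (g * q * v) = g * (p * q) * v := by
  have : g * p * v * (g * q * v) = g * p * (v * g) * (q * v) := by simp only [mul_assoc]
  rw [this, h, mul_one]; simp only [mul_assoc]

theorem conj_conj {M : Type*} [Monoid M] (g v ρ σ p : M) :
    g * (ρ * p * σ) * v = g * ρ * p * (σ * v) := by simp only [mul_assoc]

theorem halfProj_conj {c ι : T} {g v : ℍ[T]} (h : g * v = 1) (x : ℍ[T]) :
    halfProj c ι (g * x * v) = g * halfProj c ι x * v := by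
  rw [halfProj, halfProj, mul_smul_comm, smul_mul_assoc, mul_add, mul_one, add_mul, h,
    mul_smul_comm, smul_mul_assoc]

theorem IsProj.mul_lin {e x : ℍ[T]} (he : IsProj e) {ι : T} (hx : x = ι • (1 - e) - ι • e) (p q : T) :
    e * (p • (1 : ℍ[T]) + q • x) = (p - q * ι) • e := by
  rw [hx, mul_add, mul_smul_comm, mul_one, mul_smul_comm, mul_sub, mul_smul_comm, mul_smul_comm,
    he.mul_compl, he.idem]
  module

theorem IsProj.lin_mul_compl {e x : ℍ[T]} (he : IsProj e) {ι : T} (hx : x = ι • (1 - e) - ι • e)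
    (p q : T) : (p • (1 : ℍ[T]) + q • x) * (1 - e) = (p + q * ι) • (1 - e) := by
  rw [hx, add_mul, smul_mul_assoc, one_mul, smul_mul_assoc, sub_mul, smul_mul_assoc, smul_mul_assoc,
    he.mul_compl, he.compl.idem]
  module

/-- The rotation is absorbed on its left by `b` and on its right by `1 - b`, on which it acts by
scalars; the outer conjugation disappears by cyclicity. -/
theorem tr_triple_conj {g v ρ σ a b c : ℍ[T]} {l m : T} (h : v * g = 1) (hρ : b * ρ = l • b)
    (hσ : σ * (1 - b) = m • (1 - b)) (hgv : g * v = 1) :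
    tr (g * a * v * (g * b * v) * (g * (ρ * c * σ) * v) * (1 - g * b * v)) =
      l * m * tr (a * b * c * (1 - b)) := by
  have e : 1 - g * b * v = g * (1 - b) * v := by rw [mul_sub, sub_mul, mul_one, hgv]
  rw [e, conj_mul_conj h, conj_mul_conj h, conj_mul_conj h, tr_conj h]
  have : a * b * (ρ * c * σ) * (1 - b) = a * (b * ρ) * c * (σ * (1 - b)) := by
    simp only [mul_assoc]
  rw [this, hρ, hσ, mul_smul_comm, mul_smul_comm, smul_mul_assoc, smul_mul_assoc, tr_smul, tr_smul]
  ring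

end ConjQuat

theorem dcos_conj {g v : DQ ℝ} (h : v * g = 1) (a b : DQ ℝ) :
    dcos (g * a * v) (g * b * v) = dcos a b := by
  rw [dcos, dcos, conj_mul_conj h]
  exact congrArg _ (re_conj h _)

theorem proj_conj {g v : DQ ℝ} (h : g * v = 1) (a : DQ ℝ) :
    proj (g * a * v) = toC g * proj a * toC v := by
  rw [proj, toC_mul, toC_mul]
  exact halfProj_conj (by rw [← toC_mul, h, toC_one]) _

theorem toC_lin (p q : ℝ) (b : DQ ℝ) : toC (p • 1 + q • b) =
    (TrivSqZeroExt.inl (p : ℂ) : DualNumber ℂ) • (1 : DQ ℂ) +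
      (TrivSqZeroExt.inl (q : ℂ) : DualNumber ℂ) • toC b := by
  rw [toC, mapDQ_add, mapDQ_smul', mapDQ_smul', mapDQ_one, smul_eq_inl_smul, smul_eq_inl_smul]
  rfl

theorem sq_conj {M : Type*} [Ring M] {g v a : M} (hvg : v * g = 1) (hgv : g * v = 1)
    (ha : a * a = -1) : g * a * v * (g * a * v) = -1 := by
  rw [conj_mul_conj hvg, ha, mul_neg, mul_one, neg_mul, hgv]

theorem not_parallel_conj {g v a b : DQ ℝ} (hgv : g * v = 1) (hvg : v * g = 1) (ha : a * a = -1)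
    (hb : b * b = -1) (hp : ¬Parallel a b) : ¬Parallel (g * a * v) (g * b * v) := by
  refine not_parallel_of_dcos (sq_conj hvg hgv ha) (sq_conj hvg hgv hb) ?_
  rw [dcos_conj hvg]
  exact dcos_sq_ne_one ha hb hp

/-- Feet of normals need not be followed. The motion multiplies the trace of the triple by a complex
constant, so its logarithmic derivative is unchanged; the angle terms are unchanged as well, and the
offset is what remains. -/
theorem offset_conj {g v a b c σ : DQ ℝ} {p q p' q' : ℝ} (hgv : g * v = 1) (hvg : v * g = 1)
    (ha : a * a = -1) (hb : b * b = -1) (hc : c * c = -1) (hab : ¬Parallel a b)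
    (hbc : ¬Parallel b c) (h1 : (p • 1 + q • b) * σ = 1) (h2 : σ * (p • 1 + q • b) = 1)
    (hσ : σ = p' • 1 + q' • b) (hbρ : (p • 1 + q • b) * b * σ = b) :
    offset (g * a * v) (g * b * v) (g * ((p • 1 + q • b) * c * σ) * v) = offset a b c := by
  set ρ : DQ ℝ := p • 1 + q • b with hρ
  have gρ : g * ρ * (σ * v) = 1 := by
    have : g * ρ * (σ * v) = g * (ρ * σ) * v := by simp only [mul_assoc]
    rw [this, h1, DQ.mul_one, hgv]
  have ρg : σ * v * (g * ρ) = 1 := by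
    have : σ * v * (g * ρ) = σ * (v * g) * ρ := by simp only [mul_assoc]
    rw [this, hvg, DQ.mul_one, h2]
  have eb : g * b * v = g * ρ * b * (σ * v) := by rw [← conj_conj, hbρ]
  have ec := conj_conj g v ρ σ c
  have Ha := sq_conj hvg hgv ha
  have Hb := sq_conj hvg hgv hb
  have Hc := sq_conj ρg gρ hc
  have Hab := not_parallel_conj hgv hvg ha hb hab
  have Hbc := not_parallel_conj gρ ρg hb hc hbc
  have f1 : fval (g * a * v) (g * b * v) = fval a b := by
    rw [fval, fval, bval, bval, dcos_conj hvg]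
  have f2 : fval (g * ρ * b * (σ * v)) (g * ρ * c * (σ * v)) = fval b c := by
    rw [fval, fval, bval, bval, dcos_conj ρg]
  rw [← eb, ← ec] at Hbc f2
  rw [← ec] at Hc
  have u := isUnit_tr_proj_triple ha hb hc hab hbc
  have u' := isUnit_tr_proj_triple Ha Hb Hc Hab Hbc
  have l := logd_tr_triple ha hb hc hab hbc u
  have l' := logd_tr_triple Ha Hb Hc Hab Hbc u'
  have Pb := isProj_proj hb
  have key : ∃ z : ℂ, tr (proj (g * a * v) * proj (g * b * v) * proj (g * (ρ * c * σ) * v) *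
      (1 - proj (g * b * v))) =
      TrivSqZeroExt.inl z * tr (proj a * proj b * proj c * (1 - proj b)) := by
    have e1 : proj (ρ * c * σ) = toC ρ * proj c * toC σ := proj_conj h1 c
    rw [proj_conj hgv, proj_conj hgv, proj_conj hgv, e1]
    refine ⟨(p - q * Complex.I) * (p' + q' * Complex.I), (tr_triple_conj (by rw [← toC_mul, hvg, toC_one])
      (l := TrivSqZeroExt.inl (p - q * Complex.I)) (m := TrivSqZeroExt.inl (p' + q' * Complex.I))
      ?_ ?_ (by rw [← toC_mul, hgv, toC_one])).trans ?_⟩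
    · rw [hρ, toC_lin]
      refine (Pb.mul_lin (toC_eq b) _ _).trans ?_
      congr 1
      ext <;> simp [dualI]
    · rw [hσ, toC_lin]
      refine (Pb.lin_mul_compl (toC_eq b) _ _).trans ?_
      congr 1
      ext <;> simp [dualI]
    · rw [TrivSqZeroExt.inl_mul]
  obtain ⟨z, hz⟩ := key
  have uz : IsUnit (TrivSqZeroExt.inl z : DualNumber ℂ) := isUnit_of_mul_isUnit_left (hz ▸ u')
  have := congrArg logd hz
  have lz : logd (TrivSqZeroExt.inl z) = 0 := by simp [logd]
  rw [logd_mul uz u, l, l', lz, f1, f2, zero_add, sub_left_inj, sub_left_inj] at this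
  have := mul_left_cancel₀ Complex.I_ne_zero this
  exact_mod_cast this

theorem quat_lin_mul_lin {A T : Type*} [CommRing A] [CommRing T] [Algebra A T] {h : ℍ[T]}
    (hh : h * h = -1) (p q p' q' : A) :
    (p • (1 : ℍ[T]) + q • h) * (p' • 1 + q' • h) = (p * p' - q * q') • 1 + (p * q' + q * p') • h := by
  rw [add_mul, mul_add, mul_add, smul_mul_smul_comm, smul_mul_smul_comm, smul_mul_smul_comm,
    smul_mul_smul_comm, hh, mul_one, one_mul, mul_one]
  module

theorem lin_mul_lin {h : DQ ℝ} (hh : h * h = -1) (p q p' q' : ℝ) :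
    (p • (1 : DQ ℝ) + q • h) * (p' • 1 + q' • h) = (p * p' - q * q') • 1 + (p * q' + q * p') • h :=
  quat_lin_mul_lin hh p q p' q'

theorem lin_inv {h : DQ ℝ} (hh : h * h = -1) {p q : ℝ} (hpq : p ^ 2 + q ^ 2 ≠ 0) :
    ∃ p' q' : ℝ, (p • 1 + q • h) * (p' • 1 + q' • h) = 1 ∧
      (p' • 1 + q' • h) * (p • 1 + q • h) = 1 := by
  refine ⟨p / (p ^ 2 + q ^ 2), -q / (p ^ 2 + q ^ 2), ?_, ?_⟩
  · rw [lin_mul_lin hh]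
    have e1 : p * (p / (p ^ 2 + q ^ 2)) - q * (-q / (p ^ 2 + q ^ 2)) = 1 := by field_simp; ring
    have e2 : p * (-q / (p ^ 2 + q ^ 2)) + q * (p / (p ^ 2 + q ^ 2)) = 0 := by field_simp; ring
    rw [e1, e2, DQ.one_smul, DQ.zero_smul, DQ.add_zero]
  · rw [lin_mul_lin hh]
    have e1 : p / (p ^ 2 + q ^ 2) * p - -q / (p ^ 2 + q ^ 2) * q = 1 := by field_simp; ring
    have e2 : p / (p ^ 2 + q ^ 2) * q + -q / (p ^ 2 + q ^ 2) * p = 0 := by field_simp; ring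
    rw [e1, e2, DQ.one_smul, DQ.zero_smul, DQ.add_zero]

theorem rot_eq_lin (h : DQ ℝ) (t : OnePoint ℝ) :
    ∃ p q : ℝ, p ^ 2 + q ^ 2 ≠ 0 ∧ rot h t = p • 1 + q • h := by
  cases t with
  | infty => exact ⟨1, 0, by norm_num, by
      rw [DQ.one_smul, DQ.zero_smul, DQ.add_zero]; rfl⟩
  | coe t => exact ⟨t, -1, by positivity, by
      rw [DQ.neg_smul, DQ.one_smul, ← scalar_eq_smul, ← sub_eq_add_neg]; rfl⟩

theorem finrank_eq_eight_iff {V : Type*} [AddCommMonoid V] [Module ℝ V] (e : V ≃ₗ[ℝ] (Fin 8 → ℝ))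
    (W : Submodule ℝ V) : Module.finrank ℝ W = 8 ↔ W = ⊤ := by
  have ht : (⊤ : Submodule ℝ V).map (e : V →ₗ[ℝ] (Fin 8 → ℝ)) = ⊤ := by
    rw [Submodule.map_top, LinearMap.range_eq_top]; exact e.surjective
  rw [(e.submoduleMap W).finrank_eq]
  constructor
  · intro h
    have := Submodule.eq_top_of_finrank_eq (h.trans (by simp : 8 = Module.finrank ℝ (Fin 8 → ℝ)))
    exact Submodule.map_injective_of_injective e.injective (this.trans ht.symm)
  · rintro rfl
    rw [ht, finrank_top]; simp

theorem couplingSpace_eq_top_iff {a b c : DQ ℝ} :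
    Module.finrank ℝ (couplingSpace a b c) = 8 ↔ couplingSpace a b c = ⊤ := 
  finrank_eq_eight_iff coordEquiv (couplingSpace a b c)

/-- Rotating the third line about the middle one replaces the middle algebra, spanned by `1` and
`b`, by itself times `σ`. So the bijection `q ↦ g q (σ v)` carries the old coupling space into the
new one, which is therefore everything. -/
theorem finrank_couplingSpace_conj {g v a b c σ : DQ ℝ} {p q p' q' : ℝ} (hgv : g * v = 1)
    (hvg : v * g = 1) (hb : b * b = -1) (h1 : (p • 1 + q • b) * σ = 1)
    (h2 : σ * (p • 1 + q • b) = 1) (hσ : σ = p' • 1 + q' • b)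
    (hd : Module.finrank ℝ (couplingSpace a b c) = 8) :
    Module.finrank ℝ (couplingSpace (g * a * v) (g * b * v)
      (g * ((p • 1 + q • b) * c * σ) * v)) = 8 := by
  rw [couplingSpace_eq_top_iff] at hd ⊢
  set ρ : DQ ℝ := p • 1 + q • b with hρ
  set W := couplingSpace (g * a * v) (g * b * v) (g * (ρ * c * σ) * v) with hW
  obtain ⟨w0, w1, w2, w3, w4, w5, w6, w7⟩ : (1 ∈ W) ∧ (g * a * v ∈ W) ∧ (g * b * v ∈ W) ∧
      (g * (ρ * c * σ) * v ∈ W) ∧ (g * a * v * (g * b * v) ∈ W) ∧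
      (g * a * v * (g * (ρ * c * σ) * v) ∈ W) ∧ (g * b * v * (g * (ρ * c * σ) * v) ∈ W) ∧
      (g * a * v * (g * b * v) * (g * (ρ * c * σ) * v) ∈ W) := by
    refine ⟨?_, ?_, ?_, ?_, ?_, ?_, ?_, ?_⟩ <;> exact Submodule.subset_span (by simp)
  rw [conj_mul_conj hvg] at w4 w5 w6 w7
  rw [conj_mul_conj hvg] at w7
  have e1 : g * 1 * v = 1 := by rw [DQ.mul_one, hgv]
  rw [← e1] at w0
  -- the products with a factor in the algebra of `b`
  have lin : ∀ x z : DQ ℝ, g * (x * z) * v ∈ W → g * (x * b * z) * v ∈ W → ∀ r s : ℝ,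
      g * (x * (r • 1 + s • b) * z) * v ∈ W := by
    intro x z hx hxb r s
    have : g * (x * (r • 1 + s • b) * z) * v = r • (g * (x * z) * v) + s • (g * (x * b * z) * v) := by
      rw [mul_add, DQ.mul_smul, DQ.mul_smul, DQ.mul_one, add_mul, DQ.smul_mul, DQ.smul_mul, mul_add,
        DQ.mul_smul, DQ.mul_smul, add_mul, DQ.smul_mul, DQ.smul_mul]
    rw [this]
    exact W.add_mem (W.smul_mem r hx) (W.smul_mem s hxb)
  have L : ∀ x ∈ ({1, a} : Set (DQ ℝ)), ∀ r s : ℝ, ∀ y ∈ ({1, ρ * c * σ} : Set (DQ ℝ)),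
      g * (x * (r • 1 + s • b) * y) * v ∈ W := by
    rintro x (rfl | rfl) r s y (rfl | rfl)
    · exact lin _ _ (by simpa only [DQ.mul_one] using w0)
        (by simpa only [DQ.mul_one, DQ.one_mul] using w2) r s
    · exact lin _ _ (by simpa only [DQ.one_mul] using w3)
        (by simpa only [DQ.mul_one, DQ.one_mul] using w6) r s
    · exact lin _ _ (by simpa only [DQ.mul_one] using w1)
        (by simpa only [DQ.mul_one, DQ.one_mul] using w4) r s
    · exact lin _ _ w5 w7 r s
  let E : DQ ℝ →ₗ[ℝ] DQ ℝ :=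
    { toFun := fun q => g * q * (σ * v)
      map_add' := fun p q => by rw [mul_add, add_mul]
      map_smul' := fun r q => by rw [DQ.mul_smul, DQ.smul_mul]; rfl }
  have hE : couplingSpace a b c ≤ W.comap E := by
    rw [couplingSpace, Submodule.span_le]
    have e : ∀ x z : DQ ℝ, ∀ r s : ℝ, g * (x * (r • 1 + s • b) * z) * (σ * v) =
        g * (x * ((r • 1 + s • b) * σ) * (ρ * z * σ)) * v := by
      intro x z r s
      have : g * (x * ((r • 1 + s • b) * σ) * (ρ * z * σ)) * v =
          g * (x * (r • 1 + s • b) * ((σ * ρ) * z)) * (σ * v) := by simp only [mul_assoc]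
      rw [this, h2, DQ.one_mul]
    have e' : ∀ x ∈ ({1, a} : Set (DQ ℝ)), ∀ r s : ℝ, ∀ z ∈ ({1, c} : Set (DQ ℝ)),
        E (x * (r • 1 + s • b) * z) ∈ W := by
      intro x hx r s z hz
      change g * (x * (r • 1 + s • b) * z) * (σ * v) ∈ W
      rw [e, hσ, lin_mul_lin hb, ← hσ]
      refine L x hx _ _ _ ?_
      rcases hz with rfl | rfl
      · left; rw [DQ.mul_one, h1]
      · right; rfl
    have o1 : (1 : ℝ) • (1 : DQ ℝ) + (0 : ℝ) • b = 1 := by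
      rw [DQ.one_smul, DQ.zero_smul, DQ.add_zero]
    have o2 : (0 : ℝ) • (1 : DQ ℝ) + (1 : ℝ) • b = b := by
      rw [DQ.one_smul, DQ.zero_smul, DQ.zero_add]
    have f1 := fun x hx z hz => e' x hx 1 0 z hz
    have f2 := fun x hx z hz => e' x hx 0 1 z hz
    rw [o1] at f1
    rw [o2] at f2
    have m1 : (1 : DQ ℝ) ∈ ({1, a} : Set (DQ ℝ)) := Or.inl rfl
    have ma : a ∈ ({1, a} : Set (DQ ℝ)) := Or.inr rfl
    have n1 : (1 : DQ ℝ) ∈ ({1, c} : Set (DQ ℝ)) := Or.inl rfl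
    have nc : c ∈ ({1, c} : Set (DQ ℝ)) := Or.inr rfl
    have t1 := f1 1 m1 1 n1
    have t2 := f1 a ma 1 n1
    have t3 := f2 1 m1 1 n1
    have t4 := f1 1 m1 c nc
    have t5 := f2 a ma 1 n1
    have t6 := f1 a ma c nc
    have t7 := f2 1 m1 c nc
    have t8 := f2 a ma c nc
    simp only [DQ.mul_one, DQ.one_mul] at t1 t2 t3 t4 t5 t6 t7 t8
    rintro x (rfl | rfl | rfl | rfl | rfl | rfl | rfl | rfl)
    exacts [t1, t2, t3, t4, t5, t6, t7, t8]
  rw [hd, top_le_iff] at hE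
  rw [eq_top_iff]
  intro w _
  have : v * w * (g * ρ) ∈ W.comap E := by rw [hE]; trivial
  have h3 : E (v * w * (g * ρ)) = w := by
    change g * (v * w * (g * ρ)) * (σ * v) = w
    have : g * (v * w * (g * ρ)) * (σ * v) = (g * v) * w * (g * (ρ * σ) * v) := by
      simp only [mul_assoc]
    rw [this, h1, hgv, DQ.mul_one, hgv, DQ.one_mul, DQ.mul_one]
  rw [Submodule.mem_comap, h3] at this
  exact this

/-! ### Parameters of the moved linkage. -/

section Moved

variable {h : ZMod 6 → DQ ℝ} (H : IsGeneric h) {r : ZMod 6 → OnePoint ℝ} (hr : r ∈ configSet h)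
  (b : ZMod 6)

theorem scalar_comm (a : ℝ) (q : DQ ℝ) : scalar a * q = q * scalar a :=
  (Quaternion.coe_commutes _ _)

theorem scalar_mul_scalar (a b : ℝ) : (scalar a * scalar b : DQ ℝ) = scalar (a * b) := by
  rw [scalar, scalar, scalar, TrivSqZeroExt.inl_mul, Quaternion.coe_mul]

theorem scalar_one : (scalar 1 : DQ ℝ) = 1 := by
  rw [scalar, TrivSqZeroExt.inl_one, Quaternion.coe_one]

theorem exists_moved_conj (H : IsGeneric h) (hr : r ∈ configSet h) (b i : ZMod 6) :
    ∃ (g v σ : DQ ℝ) (p q p' q' : ℝ), g * v = 1 ∧ v * g = 1 ∧ (p • 1 + q • h i) * σ = 1 ∧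
      σ * (p • 1 + q • h i) = 1 ∧ σ = p' • 1 + q' • h i ∧ (p • 1 + q • h i) * h i * σ = h i ∧
      moved h r b (i - 1) = g * h (i - 1) * v ∧ moved h r b i = g * h i * v ∧
      moved h r b (i + 1) = g * ((p • 1 + q • h i) * h (i + 1) * σ) * v := by
  choose p q hpq hrot using fun i => rot_eq_lin (h i) (r i)
  choose p' q' h1 h2 using fun i => lin_inv (H.sq i) (hpq i)
  obtain ⟨a, ha, h6⟩ := hr
  have hcomm : ∀ i, rot (h i) (r i) * h i = h i * rot (h i) (r i) := fun i => by
    rw [hrot, add_mul, mul_add, DQ.smul_mul, DQ.mul_smul, DQ.smul_mul, DQ.mul_smul, DQ.one_mul,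
      DQ.mul_one]
  obtain ⟨g, v, hgv, hvg, m1, m2, m3⟩ := moved_spec (x := fun i => rot (h i) (r i)) (h := h)
    (fun i => ⟨_, by rw [hrot]; exact h1 i, by rw [hrot]; exact h2 i⟩) hcomm
    (c := scalar a) (d := scalar a⁻¹) (scalar_comm a) (scalar_comm a⁻¹)
    (by rw [scalar_mul_scalar, mul_inv_cancel₀ ha, scalar_one]) h6 b i (mv := moved h r b)
    (fun i => rfl)
  have m3' := m3 (p' i • 1 + q' i • h i) (by simp only [hrot]; exact h1 i)
    (by simp only [hrot]; exact h2 i)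
  simp only [hrot] at m3' hcomm
  refine ⟨g, v, _, p i, q i, p' i, q' i, hgv, hvg, h1 i, h2 i, rfl, ?_, m1, m2, m3'⟩
  rw [hcomm, mul_assoc, h1, DQ.mul_one]

theorem IsGeneric.moved (H : IsGeneric h) (hr : r ∈ configSet h) (b : ZMod 6) :
    IsGeneric (moved h r b) where
  sq i := by
    obtain ⟨g, v, σ, p, q, p', q', hgv, hvg, -, -, -, -, -, m, -⟩ := exists_moved_conj H hr b i
    rw [m]; exact sq_conj hvg hgv (H.sq i)
  par i := by
    obtain ⟨g, v, σ, p, q, p', q', hgv, hvg, -, -, -, -, m0, m, -⟩ :=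
      exists_moved_conj H hr b (i + 1)
    rw [add_sub_cancel_right] at m0
    rw [m, m0]
    exact not_parallel_conj hgv hvg (H.sq _) (H.sq _) (H.par i)
  dim i := by
    obtain ⟨g, v, σ, p, q, p', q', hgv, hvg, h1, h2, h3, h4, m0, m, m1⟩ :=
      exists_moved_conj H hr b (i + 1)
    have e : i + 1 + 1 = i + 2 := by ring
    rw [add_sub_cancel_right] at m0
    rw [e] at m1
    rw [m, m0, m1]
    exact finrank_couplingSpace_conj hgv hvg (H.sq _) h1 h2 h3 (H.dim i)

theorem dcos_moved (H : IsGeneric h) (hr : r ∈ configSet h) (b i : ZMod 6) :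
    dcos (Linkage.moved h r b i) (Linkage.moved h r b (i + 1)) = dcos (h i) (h (i + 1)) := by
  obtain ⟨g, v, σ, p, q, p', q', hgv, hvg, -, -, -, -, m0, m, -⟩ :=
    exists_moved_conj H hr b (i + 1)
  rw [add_sub_cancel_right] at m0
  rw [m, m0, dcos_conj hvg]

theorem paramB_moved (H : IsGeneric h) (hr : r ∈ configSet h) (b : ZMod 6) :
    paramB (Linkage.moved h r b) = paramB h := by
  funext k
  rw [paramB_eq, paramB_eq, bval, bval, dcos_moved H hr]

theorem paramC_moved (H : IsGeneric h) (hr : r ∈ configSet h) (b : ZMod 6) :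
    paramC (Linkage.moved h r b) = paramC h := by
  funext k
  rw [paramC_eq, paramC_eq, dcos_moved H hr]

theorem paramS_moved (H : IsGeneric h) (hr : r ∈ configSet h) (b : ZMod 6) :
    paramS (Linkage.moved h r b) = paramS h := by
  funext k
  obtain ⟨g, v, σ, p, q, p', q', hgv, hvg, h1, h2, h3, h4, m0, m, m1⟩ := exists_moved_conj H hr b k
  rw [paramS_eq, paramS_eq, m, m0, m1]
  exact offset_conj hgv hvg (H.sq _) (H.sq _) (H.sq _) (H.par' (sub_add_cancel k 1)) (H.par k)
    h1 h2 h3 h4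

/-- The invariant quad polynomials do not change under motions. -/
theorem IsGeneric.invQuad_moved (H : IsGeneric h) (hr : r ∈ configSet h) (b k : ZMod 6) :
    invQuadPlus (Linkage.moved h r b) k = invQuadPlus h k ∧
      invQuadMinus (Linkage.moved h r b) k = invQuadMinus h k := by
  have H' := H.moved hr b
  rw [H'.invQuadPlus_eq, H.invQuadPlus_eq, H'.invQuadMinus_eq, H.invQuadMinus_eq,
    paramB_moved H hr, paramC_moved H hr, paramS_moved H hr]
  exact ⟨rfl, rfl⟩

end Moved

end Linkage

end

noncomputable section
namespace Linkage

open Finset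

/-! ### A bound for the orders of an element at several places -/

section Places

variable {K R : Type*} [Field K] [CommRing R] [Algebra K R]

/-- More vectors than generators of the quotient are dependent modulo the subspace. -/
theorem exists_dependence {κ τ : Type*} [Fintype κ] [Fintype τ] (J : Submodule K R) (u : τ → R)
    (hspan : ∀ r : R, ∃ c : τ → K, r - ∑ k, c k • u k ∈ J) (hcard : Fintype.card τ < Fintype.card κ)
    (y : κ → R) : ∃ l : κ → K, l ≠ 0 ∧ ∑ x, l x • y x ∈ J := by
  choose c hc using fun x => hspan (y x)
  let φ : (κ → K) →ₗ[K] (τ → K) :=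
    { toFun := fun l k => ∑ x, l x * c x k
      map_add' := fun l l' => by ext k; simp [add_mul, sum_add_distrib]
      map_smul' := fun a l => by ext k; simp [mul_assoc, mul_sum] }
  -- There are more unknown coefficients than linear conditions.
  have hk : LinearMap.ker φ ≠ ⊥ := LinearMap.ker_ne_bot_of_finrank_lt (by simpa using hcard)
  obtain ⟨l, hl, hl0⟩ := (Submodule.ne_bot_iff _).mp hk
  refine ⟨l, hl0, ?_⟩
  have h1 : ∑ x, l x • y x = ∑ x, l x • (y x - ∑ k, c x k • u k) := by
    simp only [smul_sub, sum_sub_distrib]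
    have : ∑ x, l x • ∑ k, c x k • u k = ∑ k, φ l k • u k := by
      simp only [smul_sum, smul_smul, φ, LinearMap.coe_mk, AddHom.coe_mk, sum_smul]
      exact sum_comm
    rw [this, LinearMap.mem_ker.mp hl]; simp
  rw [h1]
  exact sum_mem fun x _ => J.smul_mem _ (hc x)

variable {ι : Type*} (v : ι → AddValuation R (WithTop ℤ))

/-- A generic combination has the smaller of the two orders at all places. -/
theorem exists_generic [Fintype ι] [Infinite K] (hconst : ∀ i (c : K), c ≠ 0 → v i (algebraMap K R c) = 0)
    (a b : R) : ∃ c : K, ∀ i, v i (a + c • b) = min (v i a) (v i b) := by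
  classical
  have hsm : ∀ i (c : K) (x : R), c ≠ 0 → v i (c • x) = v i x := fun i c x hc => by
    rw [Algebra.smul_def, (v i).map_mul, hconst i c hc, zero_add]
  have hle : ∀ i (c : K), min (v i a) (v i b) ≤ v i (a + c • b) := fun i c => by
    refine le_trans ?_ ((v i).map_add _ _)
    refine le_min (min_le_left _ _) ?_
    by_cases hc : c = 0
    · simp [hc]
    · rw [hsm i c b hc]; exact min_le_right _ _
  -- At one place there is at most one bad constant: two of them would, by subtraction, make both
  -- `a` and `b` exceed the smaller of their orders.
  have hfin : ∀ i, {c : K | min (v i a) (v i b) < v i (a + c • b)}.Finite := by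
    intro i
    refine Set.Subsingleton.finite fun c hc c' hc' => ?_
    by_contra hne
    simp only [Set.mem_ofPred_eq] at hc hc'
    have h1 : min (v i a) (v i b) < v i b := by
      have e : (c - c') • b = (a + c • b) - (a + c' • b) := by rw [sub_smul]; ring
      refine lt_of_lt_of_eq ?_ (hsm i (c - c') b (sub_ne_zero.mpr hne))
      rw [e]
      exact lt_of_lt_of_le (lt_min hc hc') ((v i).map_sub _ _)
    have h2 : min (v i a) (v i b) < v i a := by
      have e : a = (a + c • b) - c • b := by ring
      rw [e]
      refine lt_of_lt_of_le (lt_min (by rw [← e]; exact hc) ?_) ((v i).map_sub _ _)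
      rw [← e]
      by_cases h0 : c = 0
      · rw [h0, zero_smul, (v i).map_zero]; exact lt_of_lt_of_le h1 le_top
      · rw [hsm i c b h0]; exact h1
    exact absurd (lt_min h2 h1) (lt_irrefl _)
  obtain ⟨c, hc⟩ := (Set.finite_iUnion hfin).infinite_compl.nonempty
  refine ⟨c, fun i => le_antisymm ?_ (hle i c)⟩
  by_contra h
  exact hc (Set.mem_iUnion.mpr ⟨i, not_le.mp h⟩)

/-- The order as an integer. -/
def iord (w : AddValuation R (WithTop ℤ)) (x : R) : ℤ := (w x).untopD 0

variable {w : AddValuation R (WithTop ℤ)} {x y : R}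

theorem coe_iord (hx : w x ≠ ⊤) : ((iord w x : ℤ) : WithTop ℤ) = w x := by
  lift w x to ℤ using hx with n hn
  simp [iord, ← hn]

theorem iord_mul (hx : w x ≠ ⊤) (hy : w y ≠ ⊤) : iord w (x * y) = iord w x + iord w y := by
  have h : w (x * y) = w x + w y := w.map_mul x y
  have hxy : w (x * y) ≠ ⊤ := by rw [h]; exact WithTop.add_ne_top.mpr ⟨hx, hy⟩
  rw [← coe_iord hx, ← coe_iord hy, ← coe_iord hxy] at h
  exact_mod_cast h

theorem ne_top_mul (hx : w x ≠ ⊤) (hy : w y ≠ ⊤) : w (x * y) ≠ ⊤ := by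
  rw [w.map_mul]; exact WithTop.add_ne_top.mpr ⟨hx, hy⟩

theorem iord_one : iord w (1 : R) = 0 := by simp [iord]

theorem ne_top_one : w (1 : R) ≠ ⊤ := by simp

theorem pow_spec (hx : w x ≠ ⊤) (n : ℕ) : w (x ^ n) ≠ ⊤ ∧ iord w (x ^ n) = n * iord w x := by
  induction n with
  | zero => simp [iord_one]
  | succ n ih =>
    rw [pow_succ]
    refine ⟨ne_top_mul ih.1 hx, ?_⟩
    rw [iord_mul ih.1 hx, ih.2]; push_cast; ring

theorem prod_spec {τ : Type*} (s : Finset τ) (x : τ → R) (hx : ∀ k ∈ s, w (x k) ≠ ⊤) :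
    w (∏ k ∈ s, x k) ≠ ⊤ ∧ iord w (∏ k ∈ s, x k) = ∑ k ∈ s, iord w (x k) := by
  classical
  induction s using Finset.induction_on with
  | empty => simp [iord_one]
  | insert a s ha ih =>
    obtain ⟨h1, h2⟩ := ih fun k hk => hx k (mem_insert_of_mem hk)
    have h3 := hx a (mem_insert_self a s)
    rw [prod_insert ha, sum_insert ha, iord_mul h3 h1, h2]
    exact ⟨ne_top_mul h3 h1, rfl⟩

theorem prod_eq_top {τ : Type*} {s : Finset τ} {x : τ → R} {k : τ} (hk : k ∈ s) (hx : w (x k) = ⊤) :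
    w (∏ k ∈ s, x k) = ⊤ := by
  classical
  rw [← mul_prod_erase s x hk, w.map_mul, hx, top_add]

/-- A finite family of pairwise distinct normalized places that are finite on the ring. -/
structure IsPlaces (K : Type*) [Field K] [Algebra K R] (v : ι → AddValuation R (WithTop ℤ)) :
    Prop where
  const : ∀ i (c : K), c ≠ 0 → v i (algebraMap K R c) = 0
  nonneg : ∀ i r, 0 ≤ v i r
  normalized : ∀ i, ∃ f g, v i g ≠ ⊤ ∧ v i f = v i g + 1
  supp : ∀ i j, (∀ r, v i r = ⊤ ↔ v j r = ⊤) ∨ ∃ r, v j r = ⊤ ∧ v i r ≠ ⊤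
  sep : ∀ i j, i ≠ j → (∀ r, v i r = ⊤ ↔ v j r = ⊤) → ∃ a b, v i a < v i b ∧ v j b < v j a

variable {v}

theorem IsPlaces.iord_nonneg (hv : IsPlaces K v) (i : ι) (r : R) : 0 ≤ iord (v i) r := by
  have h := hv.nonneg i r
  by_cases hr : v i r = ⊤
  · simp [iord, hr]
  · rw [← coe_iord hr] at h
    exact_mod_cast h

/-- Elements with prescribed orders at the places. -/
theorem IsPlaces.exists_approx [Fintype ι] [Infinite K] (hv : IsPlaces K v) (d : ι → ℕ) :
    ∃ (D : ι → ℤ) (b : ι → ℕ → R), ∀ i s, s < d i →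
      v i (b i s) = ((D i + s : ℤ) : WithTop ℤ) ∧
        ∀ j, j ≠ i → ((D j + d j : ℤ) : WithTop ℤ) ≤ v j (b i s) := by
  classical
  choose f g hg hfg using hv.normalized
  -- Places with equal support lie on the same component; orders on different components are
  -- separated by elements vanishing on a component.
  let C : ι → Finset ι := fun i => univ.filter fun l => ∀ r, v i r = ⊤ ↔ v l r = ⊤
  have memC : ∀ {i l}, l ∈ C i ↔ ∀ r, v i r = ⊤ ↔ v l r = ⊤ := fun {i l} => by simp [C]
  have selfC : ∀ i, i ∈ C i := fun i => memC.mpr fun r => Iff.rfl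
  have eqC : ∀ {i l}, l ∈ C i → C l = C i := by
    intro i l h
    rw [memC] at h
    ext j
    rw [memC, memC]
    exact ⟨fun h' r => (h r).trans (h' r), fun h' r => (h r).symm.trans (h' r)⟩
  have ftrans : ∀ {i l} {r : R}, l ∈ C i → v i r ≠ ⊤ → v l r ≠ ⊤ := fun h hr h' =>
    hr ((memC.mp h _).mpr h')
  -- elements supported on one class
  have hE : ∀ i, ∃ e, v i e ≠ ⊤ ∧ ∀ j, j ∉ C i → v j e = ⊤ := by
    intro i
    have : ∀ j, ∃ e, v i e ≠ ⊤ ∧ (j ∉ C i → v j e = ⊤) := by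
      intro j
      by_cases hj : j ∈ C i
      · exact ⟨1, ne_top_one, fun h => absurd hj h⟩
      · obtain ⟨r, h1, h2⟩ := (hv.supp i j).resolve_left (fun h => hj (memC.mpr h))
        exact ⟨r, h2, fun _ => h1⟩
    choose e he using this
    refine ⟨∏ j, e j, (prod_spec _ _ fun j _ => (he j).1).1, fun j hj => ?_⟩
    exact prod_eq_top (mem_univ j) ((he j).2 hj)
  choose E hE1 hE2 using hE
  -- separating quotients
  have hsep : ∀ i j, ∃ a s, v i s ≠ ⊤ ∧ v i a = v i s ∧ (∀ l, v l s ≤ v l a) ∧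
      (j ∈ C i → j ≠ i → v j s < v j a) := by
    intro i j
    by_cases hj : j ∈ C i ∧ j ≠ i
    · obtain ⟨a, b, h1, h2⟩ := hv.sep i j hj.2.symm (memC.mp hj.1)
      obtain ⟨c, hc⟩ := exists_generic v hv.const a b
      refine ⟨a, a + c • b, ?_, ?_, fun l => ?_, fun _ _ => ?_⟩
      · rw [hc, min_eq_left h1.le]; exact ne_top_of_lt h1
      · rw [hc, min_eq_left h1.le]
      · rw [hc]; exact min_le_left _ _
      · rw [hc, min_eq_right h2.le]; exact h2
    · exact ⟨1, 1, ne_top_one, rfl, fun _ => le_rfl, fun h h' => absurd ⟨h, h'⟩ hj⟩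
  choose a s hs has hsa hsj using hsep
  let N : ℕ := ∑ i, d i
  -- The exponent is large enough to outweigh the poles of powers of `f i / g i` at the other
  -- places, with `d j` to spare.
  let M : ℕ := ∑ i, ∑ j, N * (iord (v j) (g i)).toNat + ∑ j, d j
  -- The product of `W l` over a class is a common denominator. Relative to it the elements chosen
  -- below are `(f i / g i) ^ k` times powers of `a i j / s i j`: of order `k` at `i`, and highly
  -- divisible at the other places of the class.
  let W : ι → R := fun i => E i * g i ^ N * ∏ j, s i j ^ M
  have hW : ∀ {i j}, j ∈ C i → v j (W i) ≠ ⊤ ∧ iord (v j) (W i) =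
      iord (v j) (E i) + N * iord (v j) (g i) + ∑ l, M * iord (v j) (s i l) := by
    intro i j hj
    have e1 := ftrans hj (hE1 i)
    have e2 := pow_spec (ftrans hj (hg i)) N
    have e3 := prod_spec (w := v j) univ (fun l => s i l ^ M)
      fun l _ => (pow_spec (ftrans hj (hs i l)) M).1
    refine ⟨ne_top_mul (ne_top_mul e1 e2.1) e3.1, ?_⟩
    rw [iord_mul (ne_top_mul e1 e2.1) e3.1, iord_mul e1 e2.1, e2.2, e3.2]
    congr 1
    exact sum_congr rfl fun l _ => (pow_spec (ftrans hj (hs i l)) M).2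
  have hrest : ∀ {i j}, j ∈ C i → v j (∏ l ∈ (C i).erase i, W l) ≠ ⊤ := by
    intro i j hj
    refine (prod_spec _ _ fun l hl => (hW ?_).1).1
    have hl' := mem_of_mem_erase hl
    rw [eqC hl']; exact hj
  have hD : ∀ {i j}, j ∈ C i → iord (v j) (∏ l ∈ C j, W l) =
      iord (v j) (W i) + iord (v j) (∏ l ∈ (C i).erase i, W l) := by
    intro i j hj
    rw [eqC hj, ← mul_prod_erase _ _ (selfC i), iord_mul (hW hj).1 (hrest hj)]
  refine ⟨fun i => iord (v i) (∏ l ∈ C i, W l), fun i k => E i * (f i ^ k * g i ^ (N - k)) *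
    (∏ j, a i j ^ M) * ∏ l ∈ (C i).erase i, W l, fun i k hk => ?_⟩
  have hkN : k ≤ N := hk.le.trans (single_le_sum (f := d) (fun _ _ => Nat.zero_le _) (mem_univ i))
  have hf : v i (f i) ≠ ⊤ := by
    rw [hfg]; exact WithTop.add_ne_top.mpr ⟨hg i, WithTop.one_ne_top⟩
  have hall : ∀ {j}, j ∈ C i → v j (E i * (f i ^ k * g i ^ (N - k)) * (∏ j, a i j ^ M) *
      ∏ l ∈ (C i).erase i, W l) ≠ ⊤ ∧ iord (v j) (E i * (f i ^ k * g i ^ (N - k)) *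
      (∏ j, a i j ^ M) * ∏ l ∈ (C i).erase i, W l) = iord (v j) (E i) + (k * iord (v j) (f i) +
        (N - k : ℕ) * iord (v j) (g i)) + ∑ l, M * iord (v j) (a i l) +
        iord (v j) (∏ l ∈ (C i).erase i, W l) := by
    intro j hj
    have e1 := ftrans hj (hE1 i)
    have e2 := pow_spec (ftrans hj hf) k
    have e3 := pow_spec (ftrans hj (hg i)) (N - k)
    have ha : ∀ l, v j (a i l) ≠ ⊤ := fun l => ftrans hj (by rw [has]; exact hs i l)
    have e4 := prod_spec (w := v j) univ (fun l => a i l ^ M) fun l _ => (pow_spec (ha l) M).1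
    have e5 := hrest hj
    have n1 := ne_top_mul e2.1 e3.1
    have n2 := ne_top_mul e1 n1
    have n3 := ne_top_mul n2 e4.1
    refine ⟨ne_top_mul n3 e5, ?_⟩
    rw [iord_mul n3 e5, iord_mul n2 e4.1, iord_mul e1 n1, iord_mul e2.1 e3.1, e2.2, e3.2, e4.2]
    congr 2
    exact sum_congr rfl fun l _ => (pow_spec (ha l) M).2
  have hNk : ((N - k : ℕ) : ℤ) = N - k := by push_cast [hkN]; ring
  refine ⟨?_, fun j hji => ?_⟩
  · obtain ⟨h1, h2⟩ := hall (selfC i)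
    beta_reduce
    rw [← coe_iord h1, h2, WithTop.coe_eq_coe, hD (selfC i), (hW (selfC i)).2, hNk]
    have h3 : iord (v i) (f i) = iord (v i) (g i) + 1 := by
      have := hfg i
      rw [← coe_iord hf, ← coe_iord (hg i)] at this
      exact_mod_cast this
    have h4 : ∀ l, iord (v i) (a i l) = iord (v i) (s i l) := fun l => by rw [iord, has, iord]
    simp only [h3, h4]
    ring
  · by_cases hj : j ∈ C i
    · obtain ⟨h1, h2⟩ := hall hj
      beta_reduce
      rw [← coe_iord h1, h2, WithTop.coe_le_coe, hD hj, (hW hj).2, hNk]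
      have ha : ∀ l, v j (a i l) ≠ ⊤ := fun l => ftrans hj (by rw [has]; exact hs i l)
      have hs' : ∀ l, v j (s i l) ≠ ⊤ := fun l => ftrans hj (hs i l)
      have k1 : ∀ l, iord (v j) (s i l) ≤ iord (v j) (a i l) := fun l => by
        have := hsa i l j
        rw [← coe_iord (ha l), ← coe_iord (hs' l)] at this
        exact_mod_cast this
      have k2 : iord (v j) (s i j) + 1 ≤ iord (v j) (a i j) := by
        have := hsj i j hj hji
        rw [← coe_iord (ha j), ← coe_iord (hs' j)] at this
        have : iord (v j) (s i j) < iord (v j) (a i j) := by exact_mod_cast this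
        omega
      have k3 : ∑ l, (M : ℤ) * iord (v j) (s i l) + M ≤ ∑ l, (M : ℤ) * iord (v j) (a i l) := by
        rw [← add_sum_erase univ (fun l => (M : ℤ) * iord (v j) (s i l)) (mem_univ j),
          ← add_sum_erase univ (fun l => (M : ℤ) * iord (v j) (a i l)) (mem_univ j)]
        have : ∑ l ∈ univ.erase j, (M : ℤ) * iord (v j) (s i l) ≤
            ∑ l ∈ univ.erase j, (M : ℤ) * iord (v j) (a i l) :=
          sum_le_sum fun l _ => mul_le_mul_of_nonneg_left (k1 l) (by positivity)
        have h5 : (M : ℤ) * (iord (v j) (s i j) + 1) ≤ M * iord (v j) (a i j) :=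
          mul_le_mul_of_nonneg_left k2 (by positivity)
        linarith
      have k4 : (N : ℤ) * iord (v j) (g i) + d j ≤ M := by
        have h6 : N * (iord (v j) (g i)).toNat ≤ ∑ i, ∑ j, N * (iord (v j) (g i)).toNat :=
          (single_le_sum (f := fun j => N * (iord (v j) (g i)).toNat) (fun _ _ => Nat.zero_le _)
            (mem_univ j)).trans
          (single_le_sum (f := fun i => ∑ j, N * (iord (v j) (g i)).toNat)
            (fun _ _ => Nat.zero_le _) (mem_univ i))
        have h7 : d j ≤ ∑ j, d j := single_le_sum (f := d) (fun _ _ => Nat.zero_le _) (mem_univ j)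
        have h8 : N * (iord (v j) (g i)).toNat + d j ≤ M := add_le_add h6 h7
        have h9 : ((iord (v j) (g i)).toNat : ℤ) = iord (v j) (g i) :=
          Int.toNat_of_nonneg (hv.iord_nonneg j _)
        rw [← h9]
        exact_mod_cast h8
      have k5 : (0 : ℤ) ≤ k * iord (v j) (f i) :=
        mul_nonneg (by positivity) (hv.iord_nonneg j _)
      have k6 : (k : ℤ) * iord (v j) (g i) ≤ N * iord (v j) (g i) :=
        mul_le_mul_of_nonneg_right (by exact_mod_cast hkN) (hv.iord_nonneg j _)
      rw [sub_mul]
      linarith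
    · rw [(v j).map_mul, (v j).map_mul, (v j).map_mul, hE2 i j hj]
      simp

/-- Powers of an element modulo which a ring is spanned by finitely many elements. -/
theorem exists_span_pow {n : ℕ} {t : R} {I : Ideal R} (u : Fin n → R)
    (hspan : ∀ r, ∃ (c : Fin n → K) (q : R), r - ∑ k, c k • u k - t * q ∈ I) (m : ℕ) (r : R) :
    ∃ (c : Fin m × Fin n → K) (q : R),
      r - ∑ k, c k • (t ^ (k.1 : ℕ) * u k.2) - t ^ m * q ∈ I := by
  induction m with
  | zero => exact ⟨0, r, by simp⟩
  | succ m ih =>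
    obtain ⟨c, q, h⟩ := ih
    obtain ⟨c', q', h'⟩ := hspan q
    refine ⟨fun k => Fin.snoc (α := fun _ => Fin n → K) (fun l k => c (l, k)) c' k.1 k.2, q', ?_⟩
    have := I.add_mem h (I.mul_mem_left (t ^ m) h')
    convert this using 1
    rw [Fintype.sum_prod_type, Fintype.sum_prod_type, Fin.sum_univ_castSucc]
    simp only [Fin.snoc_castSucc, Fin.snoc_last, Fin.val_castSucc, Fin.val_last]
    have e : t ^ m * ∑ k, c' k • u k = ∑ k, c' k • (t ^ m * u k) := by
      rw [mul_sum]; exact sum_congr rfl fun k _ => by rw [mul_smul_comm]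
    rw [mul_sub, mul_sub, e]
    ring

/-- The submodule generated by an ideal and the multiples of an element. -/
def idealSup (K : Type*) [Field K] [Algebra K R] (I : Ideal R) (t : R) : Submodule K R :=
  (I ⊔ Ideal.span {t}).restrictScalars K

theorem mem_idealSup {I : Ideal R} {t r : R} : r ∈ idealSup K I t ↔ ∃ q, r - t * q ∈ I := by
  rw [idealSup, Submodule.restrictScalars_mem, Submodule.mem_sup]
  constructor
  · rintro ⟨a, ha, b, hb, rfl⟩
    obtain ⟨q, rfl⟩ := Ideal.mem_span_singleton.mp hb
    exact ⟨q, by simpa using ha⟩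
  · rintro ⟨q, hq⟩
    exact ⟨_, hq, t * q, Ideal.mem_span_singleton.mpr (dvd_mul_right _ _), by ring⟩

/-- A sum with a unique term of smallest order is not of larger order. -/
theorem IsPlaces.not_le_sum (hv : IsPlaces K v) {κ : Type*} [Fintype κ] (i : ι) (A : ℤ)
    (y : κ → R) (l : κ → K) (x₀ : κ) (h0 : l x₀ ≠ 0) (h1 : v i (y x₀) = (A : WithTop ℤ))
    (h2 : ∀ x, x ≠ x₀ → l x ≠ 0 → ((A + 1 : ℤ) : WithTop ℤ) ≤ v i (y x)) :
    ¬ ((A + 1 : ℤ) : WithTop ℤ) ≤ v i (∑ x, l x • y x) := by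
  classical
  intro h3
  have hsm : ∀ (c : K) (x : R), c ≠ 0 → v i (c • x) = v i x := fun c x hc => by
    rw [Algebra.smul_def, (v i).map_mul, hv.const i c hc, zero_add]
  have e : l x₀ • y x₀ = ∑ x, l x • y x - ∑ x ∈ univ.erase x₀, l x • y x := by
    rw [← add_sum_erase _ _ (mem_univ x₀)]; ring
  have h4 : ((A + 1 : ℤ) : WithTop ℤ) ≤ v i (∑ x ∈ univ.erase x₀, l x • y x) := by
    refine (v i).map_le_sum fun x hx => ?_
    by_cases hl : l x = 0
    · simp [hl]
    · exact (h2 x (ne_of_mem_erase hx) hl).trans (hsm _ _ hl).ge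
  have h5 : ((A + 1 : ℤ) : WithTop ℤ) ≤ v i (l x₀ • y x₀) := by
    rw [e]; exact (le_min h3 h4).trans ((v i).map_sub _ _)
  rw [hsm _ _ h0, h1, WithTop.coe_le_coe] at h5
  omega

/-- The orders of an element at several places are bounded by the length modulo the element. -/
theorem IsPlaces.sum_le [Fintype ι] [Infinite K] (hv : IsPlaces K v) {n : ℕ} {t : R} {I : Ideal R}
    (hI : ∀ r ∈ I, ∀ i, v i r = ⊤) (ht : ∀ i, 0 < v i t) (u : Fin n → R)
    (hspan : ∀ r, ∃ (c : Fin n → K) (q : R), r - ∑ k, c k • u k - t * q ∈ I) :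
    (∀ i, v i t ≠ ⊤) ∧ ∑ i, iord (v i) t ≤ n := by
  classical
  -- If `t` vanished identically on a component, an element of positive order there would have `n +
  -- 1` powers that are dependent modulo the support; but distinct powers have distinct finite
  -- orders.
  have hfin : ∀ i, v i t ≠ ⊤ := by
    intro i htop
    obtain ⟨f, g, hg, hfg⟩ := hv.normalized i
    have hf : v i f ≠ ⊤ := by
      rw [hfg]; exact WithTop.add_ne_top.mpr ⟨hg, WithTop.one_ne_top⟩
    have hf1 : 1 ≤ iord (v i) f := by
      rw [← coe_iord hf, ← coe_iord hg] at hfg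
      have h1 : iord (v i) f = iord (v i) g + 1 := by exact_mod_cast hfg
      have := hv.iord_nonneg i g
      omega
    obtain ⟨l, hl0, hl⟩ := exists_dependence (idealSup K I t) u
      (fun r => by
        obtain ⟨c, q, h⟩ := hspan r
        exact ⟨c, mem_idealSup.mpr ⟨q, h⟩⟩) (by simp) (fun k : Fin (n + 1) => f ^ (k : ℕ))
    obtain ⟨q, hq⟩ := mem_idealSup.mp hl
    have hS : v i (∑ x, l x • f ^ (x : ℕ)) = ⊤ := by
      have h1 := hI _ hq i
      have h2 : v i (t * q) = ⊤ := by rw [(v i).map_mul, htop, top_add]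
      have := (v i).map_add (∑ x, l x • f ^ (x : ℕ) - t * q) (t * q)
      rw [h1, h2, sub_add_cancel, min_self, top_le_iff] at this
      exact this
    obtain ⟨x, hx⟩ := Function.ne_iff.mp hl0
    obtain ⟨x₀, hx₀, hmin⟩ := exists_min_image (univ.filter fun x => l x ≠ 0) (fun x => (x : ℕ))
      ⟨x, by simpa using hx⟩
    simp only [mem_filter, mem_univ, true_and] at hx₀ hmin
    refine hv.not_le_sum i (x₀ * iord (v i) f) (fun k : Fin (n + 1) => f ^ (k : ℕ)) l x₀ hx₀ ?_ ?_ ?_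
    · obtain ⟨h1, h2⟩ := pow_spec hf (x₀ : ℕ)
      rw [← coe_iord h1, h2]
    · intro y hy hly
      obtain ⟨h1, h2⟩ := pow_spec hf (y : ℕ)
      rw [← coe_iord h1, h2, WithTop.coe_le_coe]
      have h3 : (x₀ : ℕ) < y := lt_of_le_of_ne (hmin y hly) fun h => hy (Fin.ext h.symm)
      have h4 : ((x₀ : ℕ) : ℤ) + 1 ≤ (y : ℕ) := by exact_mod_cast h3
      nlinarith
    · rw [hS]; exact le_top
  refine ⟨hfin, ?_⟩
  let d : ι → ℕ := fun i => (iord (v i) t).toNat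
  have hd : ∀ i, (d i : ℤ) = iord (v i) t := fun i => Int.toNat_of_nonneg (hv.iord_nonneg i t)
  have hd1 : ∀ i, 1 ≤ d i := fun i => by
    have := ht i
    rw [← coe_iord (hfin i)] at this
    have h1 : 0 < iord (v i) t := by exact_mod_cast this
    have := hd i
    omega
  obtain ⟨D, b, hb⟩ := hv.exists_approx d
  -- Because each `d i` is at least one, the power `t ^ c` has order at least `D i` at every place
  -- and compensates for the common denominators.
  let c : ℕ := ∑ i, (D i).toNat
  have hc : ∀ i, D i ≤ c := fun i => by
    have : (D i).toNat ≤ c :=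
      single_le_sum (f := fun i => (D i).toNat) (fun _ _ => Nat.zero_le _) (mem_univ i)
    have h2 := Int.self_le_toNat (D i)
    omega
  -- The elements `t ^ l * b i s` with `l < m` number `m ∑ d i`, while `(m + c) n` elements span
  -- modulo `t ^ (m + c)` and `I`. A nontrivial dependence is impossible by comparing orders.
  have hbound : ∀ m : ℕ, m * ∑ i, d i ≤ (m + c) * n := by
    intro m
    by_contra hlt
    obtain ⟨l, hl0, hl⟩ := exists_dependence (idealSup K I (t ^ (m + c)))
      (fun k : Fin (m + c) × Fin n => t ^ (k.1 : ℕ) * u k.2)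
      (fun r => by
        obtain ⟨c', q, h⟩ := exists_span_pow u hspan (m + c) r
        exact ⟨c', mem_idealSup.mpr ⟨q, h⟩⟩)
      (by simpa using hlt) (fun k : Fin m × (Σ i, Fin (d i)) => t ^ (k.1 : ℕ) * b k.2.1 k.2.2)
    obtain ⟨q, hq⟩ := mem_idealSup.mp hl
    let N : ℕ := ∑ i, d i
    have hN : ∀ x : Fin m × (Σ i, Fin (d i)), (x.2.2 : ℕ) < N := fun x =>
      x.2.2.2.trans_le (single_le_sum (f := d) (fun _ _ => Nat.zero_le _) (mem_univ _))
    obtain ⟨x, hx⟩ := Function.ne_iff.mp hl0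
    -- Since `s < N`, minimizing `l * N + s` is lexicographic: first the power of `t`, then the
    -- order `s`. At the place of the minimal term every other occurring term has larger order.
    obtain ⟨x₀, hx₀, hmin⟩ := exists_min_image (univ.filter fun x => l x ≠ 0)
      (fun x => (x.1 : ℕ) * N + (x.2.2 : ℕ)) ⟨x, by simpa using hx⟩
    simp only [mem_filter, mem_univ, true_and] at hx₀ hmin
    obtain ⟨l₀, i, s₀⟩ := x₀
    have htp : ∀ k : ℕ, v i (t ^ k) = ((k * d i : ℤ) : WithTop ℤ) := fun k => by
      obtain ⟨h1, h2⟩ := pow_spec (hfin i) k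
      rw [← coe_iord h1, h2, hd]
    refine hv.not_le_sum i (l₀ * d i + D i + (s₀ : ℕ))
      (fun k : Fin m × (Σ i, Fin (d i)) => t ^ (k.1 : ℕ) * b k.2.1 k.2.2) l ⟨l₀, i, s₀⟩ hx₀ ?_ ?_ ?_
    · simp only
      rw [(v i).map_mul, htp, (hb i s₀ s₀.2).1, ← WithTop.coe_add, WithTop.coe_eq_coe]
      ring
    · rintro ⟨l', j, s'⟩ hne hlx
      simp only
      have hm := hmin _ hlx
      simp only at hm
      have hs0 : ((s₀ : ℕ) : ℤ) + 1 ≤ d i := by exact_mod_cast s₀.2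
      have hle : (l₀ : ℕ) ≤ l' := by
        by_contra hcon
        have h1 : (l' : ℕ) + 1 ≤ l₀ := by omega
        have h2 := hN (l', ⟨j, s'⟩)
        simp only at h2
        have h3 : ((l' : ℕ) + 1) * N ≤ l₀ * N := Nat.mul_le_mul_right _ h1
        rw [add_mul, one_mul] at h3
        omega
      have hle' : ((l₀ : ℕ) : ℤ) ≤ (l' : ℕ) := by exact_mod_cast hle
      have hdi : (0 : ℤ) ≤ d i := by positivity
      have hmul : ((l₀ : ℕ) : ℤ) * d i ≤ (l' : ℕ) * d i := mul_le_mul_of_nonneg_right hle' hdi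
      rw [(v i).map_mul, htp]
      by_cases hji : i = j
      · subst hji
        rw [(hb i s' s'.2).1, ← WithTop.coe_add, WithTop.coe_le_coe]
        rcases hle.eq_or_lt with h | h
        · have hl' : l₀ = l' := Fin.ext h
          subst hl'
          have h1 : (s₀ : ℕ) ≤ s' := by simpa using hm
          have h2 : (s₀ : ℕ) ≠ s' := fun h3 => hne (by
            have : s₀ = s' := Fin.ext h3
            rw [this])
          have h4 : ((s₀ : ℕ) : ℤ) + 1 ≤ (s' : ℕ) := by
            exact_mod_cast lt_of_le_of_ne h1 h2
          linarith
        · have h1 : ((l₀ : ℕ) : ℤ) + 1 ≤ (l' : ℕ) := by exact_mod_cast h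
          have h2 : (((l₀ : ℕ) : ℤ) + 1) * d i ≤ (l' : ℕ) * d i := mul_le_mul_of_nonneg_right h1 hdi
          have h3 : (0 : ℤ) ≤ (s' : ℕ) := by positivity
          linarith
      · refine le_trans ?_ (add_le_add_right ((hb j s' s'.2).2 i hji) _)
        rw [← WithTop.coe_add, WithTop.coe_le_coe]
        linarith
    · have h1 : v i (t ^ (m + c) * q) ≥ (((m + c : ℕ) * d i : ℤ) : WithTop ℤ) := by
        rw [(v i).map_mul, htp]
        exact le_add_of_nonneg_right (hv.nonneg i q)
      have h2 := (v i).map_add (∑ x, l x • (t ^ (x.1 : ℕ) * b x.2.1 x.2.2) - t ^ (m + c) * q)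
        (t ^ (m + c) * q)
      rw [hI _ hq i, sub_add_cancel, min_eq_right le_top] at h2
      refine le_trans ?_ (h1.le.trans h2)
      rw [WithTop.coe_le_coe]
      have h3 : ((l₀ : ℕ) : ℤ) + 1 ≤ m := by exact_mod_cast l₀.2
      have h4 : ((s₀ : ℕ) : ℤ) + 1 ≤ d i := by exact_mod_cast s₀.2
      have h5 : (((l₀ : ℕ) : ℤ) + 1) * d i ≤ m * d i :=
        mul_le_mul_of_nonneg_right h3 (by positivity)
      have h6 : (c : ℤ) * 1 ≤ c * d i :=
        mul_le_mul_of_nonneg_left (by exact_mod_cast hd1 i) (by positivity)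
      have h7 := hc i
      push_cast
      linarith
  have hfinal : ∑ i, d i ≤ n := by
    by_contra hcon
    have h1 : n + 1 ≤ ∑ i, d i := by omega
    -- For this `m` a total of at least `n + 1` already contradicts the linear bound.
    have h2 := hbound (c * n + 1)
    have h3 : (c * n + 1) * (n + 1) ≤ (c * n + 1) * ∑ i, d i := Nat.mul_le_mul_left _ h1
    nlinarith
  have : (∑ i, iord (v i) t) = ((∑ i, d i : ℕ) : ℤ) := by
    push_cast
    exact sum_congr rfl fun i _ => (hd i).symm
  rw [this]
  exact_mod_cast hfinal

end Places

end Linkage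

end

noncomputable section
namespace Linkage

open Quaternion Polynomial

/-! ### Closed chains of six factors near a bond -/

/-- The element `l` is invertible in the big ring, hence no zero divisor in the finite-dimensional
algebra `A`; there it is a unit, and inverses are unique. -/
theorem mem_of_mul_eq_one {K S : Type*} [Field K] [CommRing S] [Algebra K S] (A : Subalgebra K S)
    [Module.Finite K A] {y l : S} (hl : l ∈ A) (h : y * l = 1) : y ∈ A := by
  have : IsArtinianRing A := IsArtinianRing.of_finite K A
  have hu : IsUnit (⟨l, hl⟩ : A) := by
    refine IsArtinianRing.isUnit_of_mem_nonZeroDivisors (mem_nonZeroDivisors_iff_right.mpr ?_)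
    rintro ⟨z, hz⟩ h0
    have h1 : z * l = 0 := congrArg Subtype.val h0
    have h2 : z = 0 := by
      calc z = z * l * y := by rw [mul_assoc, mul_comm l, h, mul_one]
        _ = 0 := by rw [h1, zero_mul]
    exact Subtype.ext h2
  obtain ⟨⟨m, hm⟩, hm1⟩ := hu.exists_right_inv
  have h1 : l * m = 1 := congrArg Subtype.val hm1
  have h2 : y = m := by
    calc y = y * (l * m) := by rw [h1, mul_one]
      _ = m := by rw [← mul_assoc, h, one_mul]
  rwa [h2]

/-- All products of parameters are `y₀` times elements of `A`, and the normalizations recover each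
parameter from such products. Normalization also writes 1 as `y₀` times an element of `A`, which
puts `y₀` itself into `A`. -/
theorem QuadSol.mem_of_finite {S : Type*} [CommRing S] [Algebra ℂ S] (A : Subalgebra ℂ S)
    [Module.Finite ℂ A] {α β α' β' : DualNumber ℂ} (hn : NonDeg α β α' β')
    {y₀ y₁ a₂ b₂ a₃ b₃ : S}
    (h : QuadSol (mapDual (algebraMap ℂ S) α) (mapDual (algebraMap ℂ S) β)
      (mapDual (algebraMap ℂ S) α') (mapDual (algebraMap ℂ S) β') y₀ y₁ a₂ b₂ a₃ b₃)
    {p₂ q₂ p₃ q₃ : ℂ} (h2 : p₂ • a₂ + q₂ • b₂ = 1) (h3 : p₃ • a₃ + q₃ • b₃ = 1) {x : S}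
    (hx : x ∈ A) (hy : y₁ = y₀ * x) : a₂ ∈ A ∧ b₂ ∈ A ∧ a₃ ∈ A ∧ b₃ ∈ A := by
  have hmul : ∀ {d c c' : ℂ} {m : S}, d ≠ 0 →
      algebraMap ℂ S d * m = y₀ * (algebraMap ℂ S c + algebraMap ℂ S c' * x) →
      ∃ n ∈ A, m = y₀ * n := by
    intro d c c' m hd hm
    refine ⟨algebraMap ℂ S d⁻¹ * (algebraMap ℂ S c + algebraMap ℂ S c' * x),
      A.mul_mem (A.algebraMap_mem _) (A.add_mem (A.algebraMap_mem _)
        (A.mul_mem (A.algebraMap_mem _) hx)), ?_⟩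
    have e : algebraMap ℂ S d⁻¹ * algebraMap ℂ S d = 1 := by
      rw [← map_mul, inv_mul_cancel₀ hd, map_one]
    calc m = algebraMap ℂ S d⁻¹ * (algebraMap ℂ S d * m) := by rw [← mul_assoc, e, one_mul]
      _ = _ := by rw [hm]; ring
  have dd : ∀ α β : DualNumber ℂ, ddet (mapDual (algebraMap ℂ S) α) (mapDual (algebraMap ℂ S) β) =
      algebraMap ℂ S (ddet α β) := fun α β => by simp [ddet]
  obtain ⟨n₁, m₁, e₁⟩ := hmul (m := a₂ * a₃) (c := β.snd) (c' := -β.fst) hn.det (by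
    have := h.a₂a₃
    rw [dd, fst_mapDual, snd_mapDual, hy] at this
    rw [this, map_neg]; ring)
  obtain ⟨n₂, m₂, e₂⟩ := hmul (m := b₂ * a₃) (c := -α.snd) (c' := α.fst) hn.det (by
    have := h.b₂a₃
    rw [dd, fst_mapDual, snd_mapDual, hy] at this
    rw [this, map_neg]; ring)
  obtain ⟨n₃, m₃, e₃⟩ := hmul (m := a₂ * b₃) (c := β'.snd) (c' := -β'.fst) hn.det' (by
    have := h.a₂b₃
    rw [dd, fst_mapDual, snd_mapDual, hy] at this
    rw [this, map_neg]; ring)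
  obtain ⟨n₄, m₄, e₄⟩ := hmul (m := b₂ * b₃) (c := -α'.snd) (c' := α'.fst) hn.det' (by
    have := h.b₂b₃
    rw [dd, fst_mapDual, snd_mapDual, hy] at this
    rw [this, map_neg]; ring)
  simp only [Algebra.smul_def] at h2 h3
  have E₁ : a₂ = y₀ * (algebraMap ℂ S p₃ * n₁ + algebraMap ℂ S q₃ * n₃) := by
    calc a₂ = a₂ * (algebraMap ℂ S p₃ * a₃ + algebraMap ℂ S q₃ * b₃) := by rw [h3, mul_one]
      _ = _ := by linear_combination algebraMap ℂ S p₃ * e₁ + algebraMap ℂ S q₃ * e₃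
  have E₂ : b₂ = y₀ * (algebraMap ℂ S p₃ * n₂ + algebraMap ℂ S q₃ * n₄) := by
    calc b₂ = b₂ * (algebraMap ℂ S p₃ * a₃ + algebraMap ℂ S q₃ * b₃) := by rw [h3, mul_one]
      _ = _ := by linear_combination algebraMap ℂ S p₃ * e₂ + algebraMap ℂ S q₃ * e₄
  have E₃ : a₃ = y₀ * (algebraMap ℂ S p₂ * n₁ + algebraMap ℂ S q₂ * n₂) := by
    calc a₃ = a₃ * (algebraMap ℂ S p₂ * a₂ + algebraMap ℂ S q₂ * b₂) := by rw [h2, mul_one]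
      _ = _ := by linear_combination algebraMap ℂ S p₂ * e₁ + algebraMap ℂ S q₂ * e₂
  have E₄ : b₃ = y₀ * (algebraMap ℂ S p₂ * n₃ + algebraMap ℂ S q₂ * n₄) := by
    calc b₃ = b₃ * (algebraMap ℂ S p₂ * a₂ + algebraMap ℂ S q₂ * b₂) := by rw [h2, mul_one]
      _ = _ := by linear_combination algebraMap ℂ S p₂ * e₃ + algebraMap ℂ S q₂ * e₄
  have mem : ∀ {c c' : ℂ} {m m' : S}, m ∈ A → m' ∈ A →
      algebraMap ℂ S c * m + algebraMap ℂ S c' * m' ∈ A := fun h h' =>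
    A.add_mem (A.mul_mem (A.algebraMap_mem _) h) (A.mul_mem (A.algebraMap_mem _) h')
  have hy0 : y₀ ∈ A := by
    refine mem_of_mul_eq_one A (l := algebraMap ℂ S p₂ * (algebraMap ℂ S p₃ * n₁ +
      algebraMap ℂ S q₃ * n₃) + algebraMap ℂ S q₂ * (algebraMap ℂ S p₃ * n₂ +
      algebraMap ℂ S q₃ * n₄)) (mem (mem m₁ m₃) (mem m₂ m₄)) ?_
    rw [← h2]
    linear_combination (-algebraMap ℂ S p₂) * E₁ - algebraMap ℂ S q₂ * E₂
  rw [E₁, E₂, E₃, E₄]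
  exact ⟨A.mul_mem hy0 (mem m₁ m₃), A.mul_mem hy0 (mem m₂ m₄), A.mul_mem hy0 (mem m₁ m₂),
    A.mul_mem hy0 (mem m₃ m₄)⟩

section GenericT

variable {T : Type*} [CommRing T] {e x y : ℍ[T]}

theorem IsProj.lin_mul_star (he : IsProj e) (a b : T) :
    (b • e + a • (1 - e)) * (a • e + b • (1 - e)) = (a * b) • (1 : ℍ[T]) := by
  rw [add_mul, mul_add, mul_add, smul_mul_smul_comm, smul_mul_smul_comm, smul_mul_smul_comm,
    smul_mul_smul_comm, he.idem, he.compl.idem, he.mul_compl, he.compl_mul]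
  module

theorem IsProj.star_mul_eq_zero (he : IsProj e) (h : e * x = x) : star x * e = 0 := by
  have h1 : (1 - e) * x = 0 := by rw [sub_mul, one_mul, h, sub_self]
  have h2 := congrArg star h1
  rwa [star_mul, he.star_compl, star_zero] at h2

theorem IsProj.mul_mul_self (he : IsProj e) (x y : ℍ[T]) : e * (e * x * y) = e * x * y := by
  rw [← mul_assoc, ← mul_assoc, he.idem]

theorem quat_star_smul_smul (c d : T) (x : ℍ[T]) : c • star (d • x) = (c * d) • star x := by
  rw [Quaternion.star_smul, smul_smul]

end GenericT

section Core

variable {S : Type*} [CommRing S] [Algebra ℂ S]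

theorem factor_one_zero' (h : DQ ℝ) : factor h (1 : S) 0 = mapDQ (algebraMap ℂ S) (proj h) := by
  rw [factor, TrivSqZeroExt.inl_one, TrivSqZeroExt.inl_zero]
  exact quat_one_smul_add_zero_smul _ _

theorem factor_mul_factor {h : DQ ℝ} (hh : h * h = -1) (a b : S) :
    factor h b a * factor h a b = (a * b) • (1 : DQ S) := by
  rw [smul_eq_inl_smul, TrivSqZeroExt.inl_mul]
  exact (isProj_mapDQ _ (isProj_proj hh)).lin_mul_star _ _

variable {h : ZMod 6 → DQ ℝ} {k : ZMod 6}

/-- The equations of a quad for a closed product of three factors. -/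
theorem IsGeneric.quadSol (H : IsGeneric h) {i j l : ZMod 6} (hij : k + 1 = i) (hil : k + 2 = j)
    (hl : k + 3 = l) {g : DQ ℂ} (hg : IsGen (proj (h k)) (proj (h l)) g) {a b a' b' : S}
    {d : DualNumber S}
    (hX : mapDQ (algebraMap ℂ S) (proj (h k)) * factor (h i) a b * factor (h j) a' b' =
      d • mapDQ (algebraMap ℂ S) g) :
    ∃ α β α' β' : DualNumber ℂ, NonDeg α β α' β' ∧
      quadPoly g (h k) (h i) (h j) (h l) = normalize (quadNum α β α' β') ∧
      QuadSol (mapDual (algebraMap ℂ S) α) (mapDual (algebraMap ℂ S) β)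
        (mapDual (algebraMap ℂ S) α') (mapDual (algebraMap ℂ S) β') d.fst d.snd a b a' b' := by
  have eij : i + 1 = j := by rw [← hij, ← hil]; ring
  have ejl : j + 1 = l := by rw [← hl, ← hil]; ring
  obtain ⟨α, β, α', β', hc⟩ := hg.exists_coeffs (e₂ := proj (h i)) (isProj_proj (H.sq _))
    (isProj_proj (H.sq j)) (isProj_proj (H.sq _)) (genPos_proj (H.sq _) (H.sq _) (H.par' ejl))
  have hn := nonDeg_of_coeffs (H.sq _) (H.sq _) (H.sq _) (H.sq _) (H.par' hij) (H.par' eij)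
    (H.par' ejl) (H.dim' hij hil) hg hc
  refine ⟨α, β, α', β', hn, quadPoly_eq (H.sq _) (H.sq _) (H.par' ejl) hg hc hn, ?_⟩
  exact quadSol_iff.mp (((coeffs_mapDQ _ hc).prod_eq_smul_iff
    (isProj_mapDQ _ (isProj_proj (H.sq _))) (isProj_mapDQ _ (isProj_proj (H.sq _)))
    (genPos_mapDQ _ (genPos_proj (H.sq _) (H.sq _) (H.par' ejl))) (isGen_mapDQ _ hg) _ _ _ _ _).mp hX)

/-- The polynomial of the common roots of the quad polynomials of opposite quads. -/
def commonPoly (h : ZMod 6 → DQ ℝ) (k : ZMod 6) : ℂ[X] :=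
  EuclideanDomain.gcd (invQuadPlus h k) (invQuadPlus h (k + 3))

/-- The mean root is symmetric in the two quads and independent of the generator used, so one shift
`w` serves for both invariant polynomials and hence for their gcd. -/
theorem aeval_commonPoly (H : IsGeneric h) {x : S}
    (hQ : aeval x (quadPoly (lineGenerator (h k) (h (k + 3))) (h k) (h (k + 1)) (h (k + 2))
      (h (k + 3))) = 0)
    (hQ' : aeval x (quadPoly (star (lineGenerator (h k) (h (k + 3)))) (h (k + 3)) (h (k + 4))
      (h (k + 5)) (h k)) = 0) :
    ∃ w : ℂ, aeval (x - algebraMap ℂ S w) (commonPoly h k) = 0 := by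
  have a1 : k + 3 + 1 = k + 4 := by ring
  have a2 : k + 3 + 2 = k + 5 := by ring
  have a3 : k + 3 + 3 = k := by rw [add_assoc]; exact add_zero k
  have a4 : k + 3 + 4 = k + 1 := by rw [add_assoc]; rfl
  have a5 : k + 3 + 5 = k + 2 := by rw [add_assoc]; rfl
  set g := lineGenerator (h k) (h (k + 3)) with hg
  have hG : IsGen (proj (h k)) (proj (h (k + 3))) g := H.isGen_lineGenerator k
  have hG' : IsGen (proj (h (k + 3))) (proj (h (k + 3 + 3))) (star g) := by
    rw [a3]
    exact hG.star_gen (isProj_proj (H.sq _)) (isProj_proj (H.sq _))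
  have e' := H.quadPoly_comp_eq (k + 3) hG'
  have ess : star (star g) = g := star_star (g : ℍ[DualNumber ℂ])
  rw [ess, a1, a2, a3, a4, a5, ← H.invQuadPlus_eq] at e'
  have hm : ∀ P Q : ℂ[X], meanRoot P Q = meanRoot Q P := fun P Q => by
    rw [meanRoot, meanRoot, add_comm]
  have e := (H.quadPoly_comp_eq k hG).trans (H.invQuadPlus_eq k).symm
  rw [hm] at e'
  obtain ⟨w, hw⟩ : ∃ w, w = meanRoot (quadPoly g (h k) (h (k + 1)) (h (k + 2)) (h (k + 3)))
    (quadPoly (star g) (h (k + 3)) (h (k + 4)) (h (k + 5)) (h k)) := ⟨_, rfl⟩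
  rw [← hw] at e e'
  refine ⟨w, ?_⟩
  rw [commonPoly, EuclideanDomain.gcd_eq_gcd_ab, map_add, map_mul, map_mul, ← e', ← e, aeval_comp,
    aeval_comp, map_add, aeval_X, aeval_C, sub_add_cancel, hQ, hQ', zero_mul, zero_mul, add_zero]

theorem aeval_normalize {x : S} {P : ℂ[X]} (hP : aeval x P = 0) : aeval x (normalize P) = 0 := by
  obtain ⟨q, hq⟩ := (dvd_normalize_iff (a := P) (b := P)).mpr dvd_rfl
  rw [hq, map_mul, hP, zero_mul]

/-- At t_k = t_{k+3} = i one dual number `d` describes both halves of the closed chain, relative to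
`g` and to `star g`. Its ratio x solves both quads, and by `mem_of_finite` any finite algebra
containing x contains all parameters. -/
theorem IsGeneric.exists_root (H : IsGeneric h) (k : ZMod 6) {a b : ZMod 6 → S}
    {p q : ZMod 6 → ℂ} (hpq : ∀ j, p j • a j + q j • b j = 1) (ak : a k = 1) (bk : b k = 0)
    (ak3 : a (k + 3) = 1) {μ μ' : S} (hμ : μ * μ' = 1)
    (hX : factor (h k) (a k) (b k) * factor (h (k + 1)) (a (k + 1)) (b (k + 1)) *
        factor (h (k + 2)) (a (k + 2)) (b (k + 2)) =
      μ • star (factor (h (k + 3)) (a (k + 3)) (b (k + 3)) *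
        factor (h (k + 4)) (a (k + 4)) (b (k + 4)) *
        factor (h (k + 5)) (a (k + 5)) (b (k + 5)))) :
    ∃ x : S, aeval x (commonPoly h k) = 0 ∧
      ∀ A : Subalgebra ℂ S, Module.Finite ℂ A → x ∈ A → ∀ j, a j ∈ A ∧ b j ∈ A := by
  have a1 : k + 3 + 1 = k + 4 := by ring
  have a2 : k + 3 + 2 = k + 5 := by ring
  have a3 : k + 3 + 3 = k := by rw [add_assoc]; exact add_zero k
  have a4 : k + 4 + 1 = k + 5 := by ring
  have a5 : k + 4 + 2 = k := by rw [add_assoc]; exact add_zero k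
  have P : ∀ j, IsProj (mapDQ (algebraMap ℂ S) (proj (h j))) := fun j =>
    isProj_mapDQ _ (isProj_proj (H.sq j))
  set Y : DQ S := factor (h (k + 3)) (a (k + 3)) (b (k + 3)) *
    factor (h (k + 4)) (a (k + 4)) (b (k + 4)) * factor (h (k + 5)) (a (k + 5)) (b (k + 5)) with hY
  rw [ak, bk, factor_one_zero'] at hX
  set X : DQ S := mapDQ (algebraMap ℂ S) (proj (h k)) * factor (h (k + 1)) (a (k + 1)) (b (k + 1)) *
        factor (h (k + 2)) (a (k + 2)) (b (k + 2)) with hXdef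
  have hYX : Y = μ' • star X := by
    rw [hX, DQ.star_smul, DQ.smul_smul, mul_comm, hμ, DQ.one_smul]
    exact (star_star (_ : ℍ[DualNumber S])).symm
  have hEX : mapDQ (algebraMap ℂ S) (proj (h k)) * X = X := (P k).mul_mul_self _ _
  have hYE : Y * mapDQ (algebraMap ℂ S) (proj (h k)) = 0 := by
    rw [hYX, DQ.smul_mul, (P k).star_mul_eq_zero hEX, DQ.smul_zero]
  -- Since `Y` is killed by the projection of `h k`, multiplying by the conjugate of its first
  -- factor leaves `b (k + 3)` times a product on which some functional takes the value one.
  have bk3 : b (k + 3) = 0 := by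
    obtain ⟨φ, hφ⟩ := exists_functional (H.dim' a4 a5) ![p (k + 4), p (k + 5), 1]
      ![q (k + 4), q (k + 5), 0]
    have h1 := hφ S (a (k + 4)) (b (k + 4)) (a (k + 5)) (b (k + 5)) 1 0
    simp only [Matrix.cons_val_zero, Matrix.cons_val_one, Matrix.cons_val] at h1
    rw [hpq, hpq, one_smul, zero_smul, add_zero, mul_one, mul_one, factor_one_zero'] at h1
    have h2 : b (k + 3) • (factor (h (k + 4)) (a (k + 4)) (b (k + 4)) *
        factor (h (k + 5)) (a (k + 5)) (b (k + 5)) * mapDQ (algebraMap ℂ S) (proj (h k))) = 0 := by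
      have h3 : factor (h (k + 3)) (b (k + 3)) (a (k + 3)) *
          (Y * mapDQ (algebraMap ℂ S) (proj (h k))) = 0 := by
        rw [hYE]; exact mul_zero (_ : ℍ[DualNumber S])
      rw [hY, ← mul_assoc, mul_assoc (factor (h (k + 3)) (a (k + 3)) (b (k + 3))), ← mul_assoc (factor (h (k + 3)) (b (k + 3)) (a (k + 3))),
        factor_mul_factor (H.sq _), ak3, one_mul, DQ.smul_mul, DQ.one_mul, DQ.smul_mul] at h3
      exact h3
    have h4 := congrArg (ev φ) h2
    rwa [map_smul, h1, map_zero, smul_eq_mul, mul_one] at h4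
  rw [ak3, bk3, factor_one_zero'] at hY
  have hXE : X * mapDQ (algebraMap ℂ S) (proj (h (k + 3))) = 0 := by
    have hEY : mapDQ (algebraMap ℂ S) (proj (h (k + 3))) * Y = Y := by
      rw [hY]; exact (P (k + 3)).mul_mul_self _ _
    rw [hX, DQ.smul_mul, (P (k + 3)).star_mul_eq_zero hEY, DQ.smul_zero]
  obtain ⟨g, hgdef⟩ : ∃ g, g = lineGenerator (h k) (h (k + 3)) := ⟨_, rfl⟩
  have hg : IsGen (proj (h k)) (proj (h (k + 3))) g := by
    rw [hgdef]; exact H.isGen_lineGenerator k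
  obtain ⟨d, hd⟩ := (isGen_mapDQ (algebraMap ℂ S) hg).exists_smul (P k) (P (k + 3)) hEX hXE
  have hd' : Y = (TrivSqZeroExt.inl μ' * d) • mapDQ (algebraMap ℂ S) (star g) := by
    rw [hYX, hd, smul_eq_inl_smul, mapDQ_star]
    exact quat_star_smul_smul _ _ _
  obtain ⟨α, β, α', β', hn, hQ, hs⟩ := H.quadSol rfl rfl rfl hg (hXdef.symm.trans hd)
  obtain ⟨γ, δ, γ', δ', hn', hQ', hs'⟩ := H.quadSol a1 a2 a3
    (hg.star_gen (isProj_proj (H.sq _)) (isProj_proj (H.sq _))) (hY.symm.trans hd')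
  have hpq' : ∀ j, algebraMap ℂ S (p j) * a j + algebraMap ℂ S (q j) * b j = 1 := fun j => by
    rw [← Algebra.smul_def, ← Algebra.smul_def, hpq]
  obtain ⟨hu, ha⟩ := hs.aeval_quadNum hn (hpq' _) (hpq' _)
  obtain ⟨-, ha'⟩ := hs'.aeval_quadNum hn' (hpq' _) (hpq' _)
  obtain ⟨u, hu⟩ := hu
  obtain ⟨x, hx⟩ : ∃ x, d.snd = d.fst * x := ⟨↑u⁻¹ * d.snd, by rw [← mul_assoc, ← hu]; simp⟩
  have hx' : (TrivSqZeroExt.inl μ' * d).snd = (TrivSqZeroExt.inl μ' * d).fst * x := by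
    simp [hx, mul_assoc]
  have r1 := aeval_normalize (ha x hx)
  have r2 := aeval_normalize (ha' x hx')
  rw [← hQ, hgdef] at r1
  rw [← hQ', hgdef] at r2
  obtain ⟨w, hw⟩ := aeval_commonPoly H r1 r2
  refine ⟨_, hw, fun A hA hmem => ?_⟩
  have hxA : x ∈ A := by
    have := A.add_mem hmem (A.algebraMap_mem w)
    rwa [sub_add_cancel] at this
  obtain ⟨m1, m2, m3, m4⟩ := hs.mem_of_finite A hn (hpq _) (hpq _) hxA hx
  obtain ⟨n1, n2, n3, n4⟩ := hs'.mem_of_finite A hn' (hpq _) (hpq _) hxA hx'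
  have cases6 : ∀ k j : ZMod 6, j = k ∨ j = k + 1 ∨ j = k + 2 ∨ j = k + 3 ∨ j = k + 4 ∨
    j = k + 5 := by decide
  intro j
  rcases cases6 k j with rfl | rfl | rfl | rfl | rfl | rfl
  · rw [ak, bk]; exact ⟨A.one_mem, A.zero_mem⟩
  · exact ⟨m1, m2⟩
  · exact ⟨m3, m4⟩
  · rw [ak3, bk3]; exact ⟨A.one_mem, A.zero_mem⟩
  · exact ⟨n1, n2⟩
  · exact ⟨n3, n4⟩

theorem quadFormula_monic (b c s : ZMod 6 → ℝ) (k : ZMod 6) : (quadFormula b c s k).Monic := by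
  simp only [quadFormula]
  refine ((monic_X_add_C _).pow 2).add_of_left (degree_C_le.trans_lt ?_)
  rw [degree_pow, degree_X_add_C]; decide

theorem IsGeneric.commonPoly_ne_zero (H : IsGeneric h) (k : ZMod 6) : commonPoly h k ≠ 0 := by
  intro h0
  refine (quadFormula_monic (paramB h) (paramC h) (paramS h) k).ne_zero ?_
  rw [← H.invQuadPlus_eq]
  exact (EuclideanDomain.gcd_eq_zero_iff.mp h0).1

theorem exists_sum_pow {x : S} {G : ℂ[X]} (hG : G ≠ 0) (hx : aeval x G = 0) (r : S)
    (hr : r ∈ Algebra.adjoin ℂ {x}) :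
    ∃ c : Fin G.natDegree → ℂ, r = ∑ i, c i • x ^ (i : ℕ) := by
  obtain ⟨f, rfl⟩ := Algebra.adjoin_singleton_eq_range_aeval ℂ x ▸ hr
  refine ⟨fun i => (f % G).coeff i, ?_⟩
  have e : aeval x f = aeval x (f % G) := by
    conv_lhs => rw [← EuclideanDomain.div_add_mod f G, map_add, map_mul, hx, zero_mul, zero_add]
  refine e.trans ?_
  rw [Fin.sum_univ_eq_sum_range fun i => (f % G).coeff i • x ^ i]
  -- A nonzero constant `G` divides everything, and the remainder is zero; the degree bound for
  -- remainders needs positive degree.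
  by_cases h0 : G.natDegree = 0
  · have : f % G = 0 := by
      have hlt := EuclideanDomain.mod_lt f hG
      obtain ⟨c, rfl⟩ := natDegree_eq_zero.mp h0
      have hc : c ≠ 0 := fun hc => hG (by rw [hc, C_0])
      exact EuclideanDomain.mod_eq_zero.mpr ((isUnit_C.mpr (isUnit_iff_ne_zero.mpr hc)).dvd)
    rw [this, h0]; simp
  · rw [aeval_eq_sum_range' (natDegree_mod_lt f h0)]

/-- The powers of x span its finite algebra up to the degree of the gcd, and that algebra contains
all generators of `S`. -/
theorem IsGeneric.exists_span (H : IsGeneric h) (k : ZMod 6) {a b : ZMod 6 → S}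
    {p q : ZMod 6 → ℂ} (hpq : ∀ j, p j • a j + q j • b j = 1) (ak : a k = 1) (bk : b k = 0)
    (ak3 : a (k + 3) = 1) (htop : Algebra.adjoin ℂ (Set.range a ∪ Set.range b) = ⊤)
    {μ μ' : S} (hμ : μ * μ' = 1)
    (hX : factor (h k) (a k) (b k) * factor (h (k + 1)) (a (k + 1)) (b (k + 1)) *
        factor (h (k + 2)) (a (k + 2)) (b (k + 2)) =
      μ • star (factor (h (k + 3)) (a (k + 3)) (b (k + 3)) *
        factor (h (k + 4)) (a (k + 4)) (b (k + 4)) *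
        factor (h (k + 5)) (a (k + 5)) (b (k + 5)))) :
    ∃ u : Fin (commonPoly h k).natDegree → S, ∀ r : S,
      ∃ c : Fin (commonPoly h k).natDegree → ℂ, r = ∑ i, c i • u i := by
  obtain ⟨x, hx, hA⟩ := H.exists_root k hpq ak bk ak3 hμ hX
  have h0 := H.commonPoly_ne_zero k
  refine ⟨fun i => x ^ (i : ℕ), fun r => exists_sum_pow h0 hx r ?_⟩
  have hfin : Module.Finite ℂ (Algebra.adjoin ℂ {x}) := by
    have : IsIntegral ℂ x := by
      refine IsAlgebraic.isIntegral ⟨_, h0, hx⟩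
    exact Algebra.finite_adjoin_simple_of_isIntegral this
  have h1 := hA _ hfin (Algebra.self_mem_adjoin_singleton ℂ x)
  have h2 : Algebra.adjoin ℂ (Set.range a ∪ Set.range b) ≤ Algebra.adjoin ℂ {x} := by
    refine Algebra.adjoin_le ?_
    rintro _ (⟨j, rfl⟩ | ⟨j, rfl⟩)
    · exact (h1 j).1
    · exact (h1 j).2
  rw [htop] at h2
  exact h2 trivial

end Core

end Linkage

end

noncomputable section
namespace Linkage

open Quaternion

/-! ### Generators modulo the equations of closed chains -/

section Span

variable {R S : Type*} [CommRing R] [Algebra ℂ R] [CommRing S] [Algebra ℂ S]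

theorem factor_smul (h : DQ ℝ) (a b : S) :
    factor h a b = a • mapDQ (algebraMap ℂ S) (proj h) +
      b • (1 - mapDQ (algebraMap ℂ S) (proj h)) := by
  rw [smul_eq_inl_smul, smul_eq_inl_smul]; rfl

theorem mapDQ_factor (f : R →ₐ[ℂ] S) (h : DQ ℝ) (a b : R) :
    mapDQ (f : R →+* S) (factor h a b) = factor h (f a) (f b) := by
  have e : mapDQ (f : R →+* S) (mapDQ (algebraMap ℂ R) (proj h)) =
      mapDQ (algebraMap ℂ S) (proj h) := by
    rw [mapDQ_mapDQ, f.comp_algebraMap]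
  rw [factor_smul, factor_smul, mapDQ_add, mapDQ_smul', mapDQ_smul', mapDQ_sub, mapDQ_one, e]
  rfl

theorem factor_neg (h : DQ ℝ) (a b : S) : factor (-h) a b = factor h b a := by
  have e : (1 : DQ S) - (1 - mapDQ (algebraMap ℂ S) (proj h)) = mapDQ (algebraMap ℂ S) (proj h) :=
    sub_sub_cancel (1 : ℍ[DualNumber S]) _
  rw [factor_smul, factor_smul, proj_neg, mapDQ_sub, mapDQ_one, e]
  exact add_comm (_ : ℍ[DualNumber S]) _

theorem smul_factor (h : DQ ℝ) (c a b : S) : c • factor h a b = factor h (c * a) (c * b) := by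
  rw [factor_smul, factor_smul, DQ.smul_add, DQ.smul_smul, DQ.smul_smul]

theorem exists_ev_star (ψ : Fin 8 → ℂ) :
    ∃ φ : Fin 8 → ℂ, ∀ (S : Type*) [CommRing S] [Algebra ℂ S] (q : DQ S),
      ev φ (star q) = ev ψ q := by
  refine ⟨![ψ 0, -ψ 1, -ψ 2, -ψ 3, ψ 4, -ψ 5, -ψ 6, -ψ 7], fun S _ _ q => ?_⟩
  simp [ev_apply, Fin.sum_univ_eight, coord]

/-- The functional `ψ` with `ψ y = 1` gives x = ψ(x) y; applying the functional that is one on `x`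
shows that the ratio is a unit. -/
theorem exists_smul_of_minors {x y : DQ S}
    (h : ∀ c d, coord x c * coord y d = coord x d * coord y c) {φ ψ : Fin 8 → ℂ}
    (hx : ev φ x = 1) (hy : ev ψ y = 1) : ∃ μ μ' : S, μ * μ' = 1 ∧ x = μ • y := by
  have e : x = ev ψ x • y := by
    apply coord_injective
    ext c
    rw [coord_smul, Pi.smul_apply, smul_eq_mul, ev_apply, Finset.sum_mul]
    calc coord x c = coord x c * ev ψ y := by rw [hy, mul_one]
      _ = _ := by
        rw [ev_apply, Finset.mul_sum]
        exact Finset.sum_congr rfl fun d _ => by linear_combination algebraMap ℂ S (ψ d) * h c d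
  refine ⟨ev ψ x, ev φ y, ?_, e⟩
  have := congrArg (ev φ) e
  rw [map_smul, hx, smul_eq_mul] at this
  exact this.symm

theorem exists_functional_chain {h : ZMod 6 → DQ ℝ} (H : IsGeneric h) {i j l : ZMod 6}
    (hij : i + 1 = j) (hil : i + 2 = l) {a b : ZMod 6 → S} {p q : ZMod 6 → ℂ}
    (hpq : ∀ j, p j • a j + q j • b j = 1) :
    ∃ φ : Fin 8 → ℂ, ev φ (factor (h i) (a i) (b i) * factor (h j) (a j) (b j) *
      factor (h l) (a l) (b l)) = 1 := by
  obtain ⟨φ, hφ⟩ := exists_functional (H.dim' hij hil) ![p i, p j, p l] ![q i, q j, q l]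
  refine ⟨φ, ?_⟩
  rw [hφ]
  simp only [Matrix.cons_val_zero, Matrix.cons_val_one, Matrix.cons_val]
  rw [hpq, hpq, hpq, mul_one, mul_one]

variable {h : ZMod 6 → DQ ℝ}

/-- Pass to the quotient by `I` and `b k`. There the minors vanish, so the halves of the chain are
proportional, and `exists_span` applies; lifting the spanning elements costs a multiple of `b k`. -/
theorem IsGeneric.exists_span_mod (H : IsGeneric h) (k : ZMod 6) {a b : ZMod 6 → R}
    {p q : ZMod 6 → ℂ} (hpq : ∀ j, p j • a j + q j • b j = 1) (ak : a k = 1)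
    (ak3 : a (k + 3) = 1) (htop : Algebra.adjoin ℂ (Set.range a ∪ Set.range b) = ⊤) {I : Ideal R}
    (hI : ∀ c d, coord (factor (h k) (a k) (b k) * factor (h (k + 1)) (a (k + 1)) (b (k + 1)) *
        factor (h (k + 2)) (a (k + 2)) (b (k + 2))) c *
      coord (star (factor (h (k + 3)) (a (k + 3)) (b (k + 3)) *
        factor (h (k + 4)) (a (k + 4)) (b (k + 4)) *
        factor (h (k + 5)) (a (k + 5)) (b (k + 5)))) d -
      coord (factor (h k) (a k) (b k) * factor (h (k + 1)) (a (k + 1)) (b (k + 1)) *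
        factor (h (k + 2)) (a (k + 2)) (b (k + 2))) d *
      coord (star (factor (h (k + 3)) (a (k + 3)) (b (k + 3)) *
        factor (h (k + 4)) (a (k + 4)) (b (k + 4)) *
        factor (h (k + 5)) (a (k + 5)) (b (k + 5)))) c ∈ I) :
    ∃ u : Fin (commonPoly h k).natDegree → R, ∀ r : R,
      ∃ (c : Fin (commonPoly h k).natDegree → ℂ) (q : R), r - ∑ i, c i • u i - b k * q ∈ I := by
  set J : Ideal R := I ⊔ Ideal.span {b k} with hJ
  let f : R →ₐ[ℂ] R ⧸ J := Ideal.Quotient.mkₐ ℂ J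
  have hf : ∀ r, f r = 0 ↔ r ∈ J := fun r => Ideal.Quotient.eq_zero_iff_mem
  have hpq' : ∀ j, p j • f (a j) + q j • f (b j) = 1 := fun j => by
    rw [← map_smul, ← map_smul, ← map_add, hpq, map_one]
  have bk : f (b k) = 0 := (hf _).mpr
    (Ideal.mem_sup_right (Ideal.subset_span (Set.mem_singleton _)))
  have htop' : Algebra.adjoin ℂ (Set.range (fun j => f (a j)) ∪ Set.range fun j => f (b j)) = ⊤ := by
    have h1 := congrArg (Subalgebra.map f) htop
    rw [AlgHom.map_adjoin, Set.image_union, ← Set.range_comp, ← Set.range_comp, Algebra.map_top,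
      (AlgHom.range_eq_top f).mpr (Ideal.Quotient.mkₐ_surjective ℂ J)] at h1
    exact h1
  obtain ⟨φ, hφ⟩ := exists_functional_chain H (i := k) rfl rfl hpq'
  obtain ⟨ψ', hψ'⟩ := exists_functional_chain H (i := k + 3) (j := k + 4) (l := k + 5) (by ring)
    (by ring) hpq'
  obtain ⟨ψ, hψ⟩ := exists_ev_star ψ'
  obtain ⟨μ, μ', hμ, hX⟩ := exists_smul_of_minors (S := R ⧸ J) (fun c d => by
    have h1 := (hf _).mpr (Ideal.mem_sup_left (hI c d) : _ ∈ J)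
    have h2 : ∀ (q : DQ R) (c), f (coord q c) = coord (mapDQ (f : R →+* R ⧸ J) q) c := fun q c =>
      (coord_mapDQ _ _ _).symm
    rw [map_sub, map_mul, map_mul, h2, h2, h2, h2, mapDQ_star] at h1
    simp only [mapDQ_mul, mapDQ_factor] at h1
    exact sub_eq_zero.mp h1) hφ ((hψ _ _).trans hψ')
  obtain ⟨u, hu⟩ := H.exists_span k hpq' (by rw [ak, map_one]) bk (by rw [ak3, map_one]) htop' hμ hX
  choose u' hu' using fun i => Ideal.Quotient.mkₐ_surjective ℂ J (u i)
  refine ⟨u', fun r => ?_⟩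
  obtain ⟨c, hc⟩ := hu (f r)
  have h1 : r - ∑ i, c i • u' i ∈ J := by
    rw [← hf, map_sub, map_sum, hc, sub_eq_zero]
    exact Finset.sum_congr rfl fun i _ => by rw [map_smul, ← hu']
  obtain ⟨q, hq⟩ := mem_idealSup.mp (show r - ∑ i, c i • u' i ∈ idealSup ℂ I (b k) from h1)
  exact ⟨c, q, hq⟩

end Span

/-! ### The equations of the configuration curve -/

section ConfigIdeal

variable {h : ZMod 6 → DQ ℝ}

theorem iSub_smul (h : DQ ℝ) : iSub h = (2 * Complex.I) • proj h := by
  rw [iSub_eq, smul_eq_inl_smul]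
  congr 1
  ext <;> simp [dualI]

theorem iAdd_smul (h : DQ ℝ) : iAdd h = (2 * Complex.I) • (1 - proj h) := by
  rw [iAdd_eq, smul_eq_inl_smul]
  congr 1
  ext <;> simp [dualI]

theorem smul_add_smul_smul {S : Type*} [CommRing S] (c z : S) (p q : DQ S) :
    c • p + z • c • q = c • (p + z • q) := by
  rw [DQ.smul_add, DQ.smul_smul, DQ.smul_smul, mul_comm]

theorem rotation_eq_factor {S : Type*} [CommRing S] [Algebra ℂ S] (h : DQ ℝ) (z : S) :
    mapDQ (algebraMap ℂ S) (iSub h) + scalar z * mapDQ (algebraMap ℂ S) (iAdd h) =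
      algebraMap ℂ S (2 * Complex.I) • factor h 1 z := by
  rw [scalar_mul, iSub_smul, iAdd_smul, mapDQ_smul', mapDQ_smul', mapDQ_sub, mapDQ_one,
    smul_add_smul_smul, factor_smul, DQ.one_smul]

theorem rotFactor_eq (h : ZMod 6 → DQ ℝ) (j : ZMod 6) :
    rotFactor h j = algebraMap ℂ (MvPolynomial (ZMod 6) ℂ) (2 * Complex.I) •
      factor (S := MvPolynomial (ZMod 6) ℂ) (h j) 1 (MvPolynomial.X j) := by
  rw [← rotation_eq_factor, iSub, iAdd, mapDQ_sub, mapDQ_add, mapDQ_scalar, mapDQ_mapDQ]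
  rfl

theorem quat_mul_star_comm {T : Type*} [CommRing T] (x y : ℍ[T]) {n a : T}
    (hn : y * star y = (n : ℍ[T])) (ha : x * y = (a : ℍ[T])) : n • x = a • star y := by
  rw [← Quaternion.mul_coe_eq_smul, ← hn, ← mul_assoc, ha, Quaternion.coe_mul_eq_smul]

theorem exists_factor_eq_smul (h : DQ ℝ) (t : OnePoint ℝ) :
    ∃ ν : ℂ, factor h 1 (zCoord t) = ν • toC (rot h t) := by
  have key : factor h 1 (zCoord t) =
      (2⁻¹ * (1 + zCoord t)) • (1 : DQ ℂ) + (2⁻¹ * (Complex.I * (1 - zCoord t))) • toC h := by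
    rw [factor_eq, mapDQ_algebraMap_self]; rfl
  rw [key]
  cases t with
  | infty =>
    refine ⟨1, ?_⟩
    have e1 : zCoord OnePoint.infty = 1 := rfl
    have e2 : rot h OnePoint.infty = 1 := rfl
    have e3 : (2⁻¹ * (1 + 1) : ℂ) = 1 := by norm_num
    rw [e1, e2, e3, sub_self, mul_zero, mul_zero, DQ.zero_smul, DQ.add_zero, toC_one]
  | coe t =>
    have e1 : zCoord (t : OnePoint ℝ) = ((t : ℂ) - Complex.I) / ((t : ℂ) + Complex.I) := rfl
    have e2 : rot h (t : OnePoint ℝ) = scalar t - h := rfl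
    have hne : (t : ℂ) + Complex.I ≠ 0 := fun h0 => by
      have := congrArg Complex.im h0
      simp at this
    refine ⟨1 / ((t : ℂ) + Complex.I), ?_⟩
    have e3 : toC (scalar t - h) = (t : ℂ) • (1 : DQ ℂ) + (-1 : ℂ) • toC h := by
      rw [DQ.neg_smul, DQ.one_smul, toC, mapDQ_sub, mapDQ_scalar, scalar_eq_smul]
      exact sub_eq_add_neg (_ : ℍ[DualNumber ℂ]) _
    rw [e1, e2, e3, DQ.smul_add, DQ.smul_smul, DQ.smul_smul]
    congr 2
    · field_simp; ring
    · field_simp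
      linear_combination 2 * Complex.I_mul_I

theorem quat_star_add {T : Type*} [CommRing T] (x y : ℍ[T]) : star (x + y) = star x + star y :=
  star_add x y

theorem exists_mul_star_rot {h : DQ ℝ} (hh : h * h = -1) (t : OnePoint ℝ) :
    ∃ n : ℝ, rot h t * star (rot h t) = scalar n := by
  obtain ⟨p, q, -, e⟩ := rot_eq_lin h t
  refine ⟨p ^ 2 + q ^ 2, ?_⟩
  have e1 : star (p • (1 : DQ ℝ) + q • h) = p • 1 + (-q) • h := by
    refine (quat_star_add _ _).trans ?_
    rw [DQ.star_smul, DQ.star_smul, star_eq_neg_of_sq hh, DQ.smul_neg, DQ.neg_smul]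
    congr 2
    exact star_one ℍ[DualNumber ℝ]
  rw [e, e1, lin_mul_lin hh, scalar_eq_smul]
  have e2 : p * -q + q * p = 0 := by ring
  have e3 : p * p - q * -q = p ^ 2 + q ^ 2 := by ring
  rw [e2, e3, DQ.zero_smul, DQ.add_zero]

theorem quat_mul_mul_star {T : Type*} [CommRing T] {x y z : ℍ[T]} {a b c : T}
    (hx : x * star x = (a : ℍ[T])) (hy : y * star y = (b : ℍ[T])) (hz : z * star z = (c : ℍ[T])) :
    x * y * z * star (x * y * z) = ((a * b * c : T) : ℍ[T]) := by
  rw [star_mul, star_mul]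
  calc x * y * z * (star z * (star y * star x)) = x * (y * (z * star z) * star y) * star x := by
        simp only [mul_assoc]
    _ = _ := by
      rw [hz, ← Quaternion.coe_commutes, mul_assoc (c : ℍ[T]), hy, ← Quaternion.coe_mul,
        ← Quaternion.coe_commutes, mul_assoc, hx, ← Quaternion.coe_mul]
      congr 1; ring

/-- The full product is real, also when read from `k` on. Multiplication by the conjugate of the
last three factors moves them to the other side, because each factor times its conjugate is real. -/
theorem IsGeneric.smul_eq_smul_star (H : IsGeneric h) {t : ZMod 6 → OnePoint ℝ}
    (ht : t ∈ configSet h) (k : ZMod 6) :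
    ∃ n a : ℝ, a ≠ 0 ∧ n • (rot (h k) (t k) * rot (h (k + 1)) (t (k + 1)) *
        rot (h (k + 2)) (t (k + 2))) =
      a • star (rot (h (k + 3)) (t (k + 3)) * rot (h (k + 4)) (t (k + 4)) *
        rot (h (k + 5)) (t (k + 5))) := by
  obtain ⟨a, ha, h6⟩ := ht
  have hu : ∀ i, IsUnit (rot (h i) (t i)) := fun i => by
    obtain ⟨p, q, hpq, e⟩ := rot_eq_lin (h i) (t i)
    obtain ⟨p', q', h1, h2⟩ := lin_inv (H.sq i) hpq
    rw [e]
    exact ⟨⟨_, _, h1, h2⟩, rfl⟩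
  have hk := chain_six_eq (fun i => rot (h i) (t i)) hu (scalar_comm a) h6 k
  have e : chain (fun i => rot (h i) (t i)) k 6 = rot (h k) (t k) * rot (h (k + 1)) (t (k + 1)) *
      rot (h (k + 2)) (t (k + 2)) * (rot (h (k + 3)) (t (k + 3)) * rot (h (k + 4)) (t (k + 4)) *
        rot (h (k + 5)) (t (k + 5))) := by
    have c0 : k + ((0 : ℕ) : ZMod 6) = k := by rw [Nat.cast_zero, add_zero]
    simp only [chain_succ, chain_zero, c0]
    rw [DQ.one_mul]
    simp only [mul_assoc]
    rfl
  rw [e] at hk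
  obtain ⟨n₁, e₁⟩ := exists_mul_star_rot (H.sq (k + 3)) (t (k + 3))
  obtain ⟨n₂, e₂⟩ := exists_mul_star_rot (H.sq (k + 4)) (t (k + 4))
  obtain ⟨n₃, e₃⟩ := exists_mul_star_rot (H.sq (k + 5)) (t (k + 5))
  refine ⟨n₁ * n₂ * n₃, a, ha, ?_⟩
  rw [smul_eq_inl_smul, smul_eq_inl_smul, TrivSqZeroExt.inl_mul, TrivSqZeroExt.inl_mul]
  exact quat_mul_star_comm _ _ (quat_mul_mul_star e₁ e₂ e₃) hk

/-- The rotation factors with the coordinates of the configuration curve as parameters. -/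
def curveFactor (h : ZMod 6 → DQ ℝ) (j : ZMod 6) : DQ (MvPolynomial (ZMod 6) ℂ) :=
  factor (h j) 1 (MvPolynomial.X j)

theorem IsGeneric.minor_mem_configIdeal (H : IsGeneric h) (k : ZMod 6) (c d : Fin 8) :
    coord (curveFactor h k * curveFactor h (k + 1) * curveFactor h (k + 2)) c *
      coord (star (curveFactor h (k + 3) * curveFactor h (k + 4) * curveFactor h (k + 5))) d -
    coord (curveFactor h k * curveFactor h (k + 1) * curveFactor h (k + 2)) d *
      coord (star (curveFactor h (k + 3) * curveFactor h (k + 4) * curveFactor h (k + 5))) c ∈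
    configIdeal h := by
  rw [configIdeal, MvPolynomial.mem_vanishingIdeal_iff]
  rintro _ ⟨t, ht, rfl⟩
  set f := MvPolynomial.aeval (R := ℂ) (S₁ := ℂ) fun i => zCoord (t i) with hf
  have h2 : ∀ (q : DQ (MvPolynomial (ZMod 6) ℂ)) (c), f (coord q c) =
      coord (mapDQ (f : MvPolynomial (ZMod 6) ℂ →+* ℂ) q) c := fun q c => (coord_mapDQ _ _ _).symm
  choose ν hν using fun j => exists_factor_eq_smul (h j) (t j)
  have h3 : ∀ j, mapDQ (f : MvPolynomial (ZMod 6) ℂ →+* ℂ) (curveFactor h j) =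
      ν j • toC (rot (h j) (t j)) := fun j => by
    rw [curveFactor, mapDQ_factor, map_one, hf, MvPolynomial.aeval_X, hν]
  obtain ⟨n, a, ha, e⟩ := H.smul_eq_smul_star ht k
  rw [map_sub, map_mul, map_mul, h2, h2, h2, h2, mapDQ_star]
  simp only [mapDQ_mul, h3, DQ.smul_mul, DQ.mul_smul, DQ.smul_smul, DQ.star_smul, ← toC_mul]
  rw [toC, toC, ← mapDQ_star]
  simp only [coord_smul, Pi.smul_apply, coord_mapDQ, smul_eq_mul]
  have e' := fun c => congrFun (congrArg coord e) c
  simp only [coord_smul, Pi.smul_apply, smul_eq_mul] at e'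
  have e1 : ∀ c, (algebraMap ℝ ℂ) (coord (star (rot (h (k + 3)) (t (k + 3)) *
      rot (h (k + 4)) (t (k + 4)) * rot (h (k + 5)) (t (k + 5)))) c) = algebraMap ℝ ℂ (n / a) *
      algebraMap ℝ ℂ (coord (rot (h k) (t k) * rot (h (k + 1)) (t (k + 1)) *
        rot (h (k + 2)) (t (k + 2))) c) := fun c => by
    rw [← map_mul]
    congr 1
    field_simp
    linear_combination -(e' c)
  rw [e1, e1]
  ring

end ConfigIdeal

end Linkage

end

noncomputable section
namespace Linkage

open Quaternion

/-! ### Orders of products of rotation factors -/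

section Orders

variable {R : Type*} [CommRing R]

/-- The smallest order of the coordinates. -/
def ordDQ (v : AddValuation R (WithTop ℤ)) (q : DQ R) : WithTop ℤ :=
  Finset.univ.inf fun c : Fin 8 => v (coord q c)

variable {v : AddValuation R (WithTop ℤ)}

theorem le_ordDQ {n : WithTop ℤ} {q : DQ R} : n ≤ ordDQ v q ↔ ∀ c, n ≤ v (coord q c) := by
  simp [ordDQ, Finset.le_inf_iff]

theorem ordDQ_le (q : DQ R) (c : Fin 8) : ordDQ v q ≤ v (coord q c) := le_ordDQ.mp le_rfl c

theorem le_ordDQ_add {n : WithTop ℤ} {p q : DQ R} (hp : n ≤ ordDQ v p) (hq : n ≤ ordDQ v q) :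
    n ≤ ordDQ v (p + q) := by
  refine le_ordDQ.mpr fun c => ?_
  rw [coord_add, Pi.add_apply]
  exact (le_min (le_ordDQ.mp hp c) (le_ordDQ.mp hq c)).trans (v.map_add _ _)

theorem ordDQ_smul (x : R) (q : DQ R) : v x + ordDQ v q ≤ ordDQ v (x • q) := by
  refine le_ordDQ.mpr fun c => ?_
  rw [coord_smul, Pi.smul_apply, smul_eq_mul, v.map_mul]
  gcongr
  exact ordDQ_le q c

variable [Algebra ℂ R] (hv : ∀ a : ℂ, 0 ≤ v (algebraMap ℂ R a))

include hv

theorem ordDQ_le_ev (φ : Fin 8 → ℂ) (q : DQ R) : ordDQ v q ≤ v (ev φ q) := by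
  rw [ev_apply]
  refine v.map_le_sum fun c _ => ?_
  rw [v.map_mul]
  exact (ordDQ_le q c).trans (le_add_of_nonneg_left (hv _))

theorem ordDQ_le_mul (a b : DQ ℂ) (q : DQ R) :
    ordDQ v q ≤ ordDQ v (mapDQ (algebraMap ℂ R) a * q * mapDQ (algebraMap ℂ R) b) := by
  refine le_ordDQ.mpr fun c => ?_
  obtain ⟨ψ, hψ⟩ := exists_ev_mul (Pi.single c 1) a b
  have e : ∀ q : DQ R, ev (Pi.single c 1) q = coord q c := fun q => by
    rw [ev_apply, Finset.sum_eq_single c] <;> simp +contextual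
  rw [← e, ← hψ]
  exact ordDQ_le_ev hv ψ q

theorem ordDQ_le_mul_right (b : DQ ℂ) (q : DQ R) :
    ordDQ v q ≤ ordDQ v (q * mapDQ (algebraMap ℂ R) b) := by
  have := ordDQ_le_mul hv 1 b q
  rwa [mapDQ_one, DQ.one_mul] at this

theorem ordDQ_le_mul_left (a : DQ ℂ) (q : DQ R) :
    ordDQ v q ≤ ordDQ v (mapDQ (algebraMap ℂ R) a * q) := by
  have := ordDQ_le_mul hv a 1 q
  rwa [mapDQ_one, DQ.mul_one] at this

theorem ordDQ_mul_factor (h : DQ ℝ) (z : R) (q : DQ R) :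
    ordDQ v q + min (v z) 0 ≤ ordDQ v (q * factor h 1 z) := by
  have e : q * factor h 1 z = q * mapDQ (algebraMap ℂ R) (proj h) +
      z • (q * mapDQ (algebraMap ℂ R) (1 - proj h)) := by
    rw [factor_smul, DQ.one_smul, mul_add, DQ.mul_smul, mapDQ_sub, mapDQ_one]
  rw [e]
  refine le_ordDQ_add ?_ ?_
  · refine le_trans ?_ (ordDQ_le_mul_right hv _ q)
    exact add_le_of_nonpos_right (min_le_right _ _)
  · refine le_trans ?_ (ordDQ_smul _ _)
    rw [add_comm]
    exact add_le_add (min_le_left _ _) (ordDQ_le_mul_right hv _ q)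

/-- Multiplication by the conjugate factor turns `factor h 1 z` into the scalar `z`; as `z` has no
pole, this multiplication cannot lower orders. -/
theorem ordDQ_factor_mul_le {h : DQ ℝ} (hh : h * h = -1) {z : R} (hz : 0 ≤ v z) (q : DQ R)
    (φ : Fin 8 → ℂ) : ordDQ v (factor h 1 z * q) ≤ v z + v (ev φ q) := by
  have e : factor h z 1 * (factor h 1 z * q) = z • q := by
    rw [← mul_assoc, factor_mul_factor hh, one_mul, DQ.smul_mul, DQ.one_mul]
  have e' : v z + v (ev φ q) = v (ev φ (z • q)) := by rw [map_smul, smul_eq_mul, v.map_mul]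
  rw [e']
  refine le_trans ?_ (ordDQ_le_ev hv φ _)
  rw [← e]
  generalize factor h 1 z * q = w
  rw [factor_smul, DQ.one_smul, add_mul, DQ.smul_mul]
  refine le_ordDQ_add ?_ ?_
  · refine le_trans ?_ (ordDQ_smul _ _)
    exact (ordDQ_le_mul_left hv (proj h) w).trans (le_add_of_nonneg_left hz)
  · have := ordDQ_le_mul_left hv (1 - proj h) w
    rwa [mapDQ_sub, mapDQ_one] at this

omit hv in
-- In each of the three factors the functional reads off the coefficient `1` or `z`, whichever has
-- the smaller order.
theorem exists_ev_factor_eq {h₁ h₂ h₃ : DQ ℝ}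
    (hd : Module.finrank ℝ (couplingSpace h₁ h₂ h₃) = 8) (z₁ z₂ z₃ : R) :
    ∃ φ : Fin 8 → ℂ, v (ev φ (factor h₁ 1 z₁ * factor h₂ 1 z₂ * factor h₃ 1 z₃)) =
      min (v z₁) 0 + min (v z₂) 0 + min (v z₃) 0 := by
  have h1 : ∀ z : R, ∃ p q : ℂ, v (p • 1 + q • z) = min (v z) 0 := by
    intro z
    rcases le_total (v z) 0 with hz | hz
    · exact ⟨0, 1, by rw [min_eq_left hz, zero_smul, one_smul, zero_add]⟩
    · exact ⟨1, 0, by rw [min_eq_right hz, zero_smul, one_smul, add_zero, v.map_one]⟩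
  obtain ⟨p₁, q₁, e₁⟩ := h1 z₁
  obtain ⟨p₂, q₂, e₂⟩ := h1 z₂
  obtain ⟨p₃, q₃, e₃⟩ := h1 z₃
  obtain ⟨φ, hφ⟩ := exists_functional hd ![p₁, p₂, p₃] ![q₁, q₂, q₃]
  refine ⟨φ, ?_⟩
  rw [hφ]
  simp only [Matrix.cons_val_zero, Matrix.cons_val_one, Matrix.cons_val]
  rw [v.map_mul, v.map_mul, e₁, e₂, e₃]

omit hv in
theorem factor_one_one (h : DQ ℝ) : factor h (1 : R) 1 = 1 := by
  rw [factor_smul, DQ.one_smul, DQ.one_smul]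
  exact add_sub_cancel (_ : ℍ[DualNumber R]) 1

end Orders

namespace CurvePoint

variable {h : ZMod 6 → DQ ℝ} (p : CurvePoint h)

theorem const_nonneg (a : ℂ) : 0 ≤ p.v (algebraMap ℂ (MvPolynomial (ZMod 6) ℂ) a) := by
  by_cases ha : a = 0
  · rw [ha, map_zero, p.v.map_zero]; exact le_top
  · exact (p.trivial_on_const a ha).ge

/-- The pole order of a factor, as a nonpositive number. -/
def pole (j : ZMod 6) : ℤ := (min (p.v (MvPolynomial.X j)) 0).untopD 0

theorem coe_pole (j : ZMod 6) : ((p.pole j : ℤ) : WithTop ℤ) = min (p.v (MvPolynomial.X j)) 0 := by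
  have h : min (p.v (MvPolynomial.X j)) 0 ≠ ⊤ := ne_top_of_le_ne_top WithTop.zero_ne_top
    (min_le_right _ _)
  rw [pole]
  lift min (p.v (MvPolynomial.X j)) 0 to ℤ using h with n
  rfl

theorem pole_nonpos (j : ZMod 6) : p.pole j ≤ 0 := by
  have : ((p.pole j : ℤ) : WithTop ℤ) ≤ (0 : ℤ) := by rw [coe_pole]; exact min_le_right _ _
  exact WithTop.coe_le_coe.mp this

theorem pole_eq_zero {j : ZMod 6} (hj : 0 ≤ p.v (MvPolynomial.X j)) : p.pole j = 0 := by
  have : ((p.pole j : ℤ) : WithTop ℤ) = (0 : ℤ) := by rw [coe_pole]; exact min_eq_right hj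
  exact WithTop.coe_eq_coe.mp this

theorem ordDQ_one : 0 ≤ ordDQ p.v 1 := by
  refine le_ordDQ.mpr fun c => ?_
  rw [← mapDQ_one (algebraMap ℂ (MvPolynomial (ZMod 6) ℂ)), coord_mapDQ]
  exact p.const_nonneg _

theorem le_ordDQ_chain (a : ZMod 6) (m : ℕ) :
    ((∑ l ∈ Finset.range m, p.pole (a + (l : ZMod 6)) : ℤ) : WithTop ℤ) ≤
      ordDQ p.v (chain (curveFactor h) a m) := by
  induction m with
  | zero => rw [chain_zero]; exact p.ordDQ_one
  | succ m ih =>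
    rw [chain_succ, Finset.sum_range_succ, WithTop.coe_add, coe_pole]
    exact (add_le_add_left ih _).trans (ordDQ_mul_factor p.const_nonneg _ _ _)

theorem chain_smul {γ : MvPolynomial (ZMod 6) ℂ} {x y : ZMod 6 → DQ (MvPolynomial (ZMod 6) ℂ)}
    (hxy : ∀ j, x j = γ • y j) (a : ZMod 6) (m : ℕ) : chain x a m = γ ^ m • chain y a m := by
  induction m with
  | zero => rw [chain_zero, chain_zero, pow_zero, DQ.one_smul]
  | succ m ih => rw [chain_succ, chain_succ, ih, hxy, DQ.smul_mul, DQ.mul_smul, DQ.smul_smul, pow_succ]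

theorem vanishingOrder_eq (a : ZMod 6) (m : ℕ) :
    p.vanishingOrder a m = (ordDQ p.v (chain (curveFactor h) a m)).untopD 0 -
      ∑ l ∈ Finset.range m, p.pole (a + (l : ZMod 6)) := by
  have e : ∀ c, p.v (coord (chain (rotFactor h) a m) c) = p.v (coord (chain (curveFactor h) a m) c) := by
    intro c
    rw [chain_smul (rotFactor_eq h), coord_smul, Pi.smul_apply, smul_eq_mul, p.v.map_mul, ← map_pow]
    have : p.v (algebraMap ℂ (MvPolynomial (ZMod 6) ℂ) ((2 * Complex.I) ^ m)) = 0 :=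
      p.trivial_on_const _ (by simp)
    rw [this, zero_add]
    rfl
  simp only [vanishingOrder, e]
  rfl

theorem vanishingOrder_nonneg (a : ZMod 6) (m : ℕ) : 0 ≤ p.vanishingOrder a m := by
  rw [vanishingOrder_eq]
  have h1 := p.le_ordDQ_chain a m
  have h2 : ∑ l ∈ Finset.range m, p.pole (a + (l : ZMod 6)) ≤ 0 :=
    Finset.sum_nonpos fun _ _ => p.pole_nonpos _
  generalize ordDQ p.v (chain (curveFactor h) a m) = x at h1
  cases x with
  -- A product that vanishes identically is assigned the order zero, and the pole orders are
  -- nonpositive.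
  | top => simpa using h2
  | coe x =>
    have := WithTop.coe_le_coe.mp h1
    simpa using this

theorem vanishingOrder_le {a : ZMod 6} {m : ℕ} {n : ℤ}
    (hn : ordDQ p.v (chain (curveFactor h) a m) ≤
      ((n + ∑ l ∈ Finset.range m, p.pole (a + (l : ZMod 6)) : ℤ) : WithTop ℤ)) :
    p.vanishingOrder a m ≤ n := by
  rw [vanishingOrder_eq]
  generalize ordDQ p.v (chain (curveFactor h) a m) = x at hn
  cases x with
  | top => exact absurd (top_le_iff.mp hn) (WithTop.coe_ne_top)
  | coe x =>
    have := WithTop.coe_le_coe.mp hn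
    simp only [WithTop.untopD_coe]
    linarith

/-- A third factor with z = 1 is the identity, so the functional for three factors applies to two.
-/
theorem vanishingOrder_two_le (H : IsGeneric h) (a : ZMod 6) : p.vanishingOrder a 2 ≤ 0 := by
  obtain ⟨φ, hφ⟩ := exists_ev_factor_eq (v := p.v) (H.dim a) (MvPolynomial.X a)
    (MvPolynomial.X (a + 1)) 1
  rw [factor_one_one, DQ.mul_one, ← coe_pole, ← coe_pole, p.v.map_one, min_self, add_zero] at hφ
  refine p.vanishingOrder_le ((ordDQ_le_ev p.const_nonneg φ _).trans (le_of_eq ?_))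
  rw [chain_succ, chain_one, curveFactor, curveFactor, Nat.cast_one, hφ, zero_add,
    Finset.sum_range_succ, Finset.sum_range_one, Nat.cast_one, Nat.cast_zero, add_zero]
  rfl

theorem vanishingOrder_four_le (H : IsGeneric h) {a : ZMod 6} (h0 : 0 ≤ p.v (MvPolynomial.X a))
    (hf : p.v (MvPolynomial.X a) ≠ ⊤) :
    p.vanishingOrder a 4 ≤ iord p.v (MvPolynomial.X a : MvPolynomial (ZMod 6) ℂ) := by
  obtain ⟨φ, hφ⟩ := exists_ev_factor_eq (v := p.v) (H.dim (a + 1)) (MvPolynomial.X (a + 1))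
    (MvPolynomial.X (a + 1 + 1)) (MvPolynomial.X (a + 1 + 2))
  rw [← coe_pole, ← coe_pole, ← coe_pole] at hφ
  have h1 := ordDQ_factor_mul_le p.const_nonneg (H.sq a) h0 (factor (h (a + 1)) 1 (MvPolynomial.X (a + 1)) *
    factor (h (a + 1 + 1)) 1 (MvPolynomial.X (a + 1 + 1)) * factor (h (a + 1 + 2)) 1 (MvPolynomial.X (a + 1 + 2))) φ
  rw [hφ, ← coe_iord hf] at h1
  refine p.vanishingOrder_le ?_
  have e1 : a + 1 + 1 = a + 2 := by ring
  have e2 : a + 1 + 2 = a + 3 := by ring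
  have e : chain (curveFactor h) a 4 = factor (h a) 1 (MvPolynomial.X a) *
      (factor (h (a + 1)) 1 (MvPolynomial.X (a + 1)) *
        factor (h (a + 1 + 1)) 1 (MvPolynomial.X (a + 1 + 1)) *
        factor (h (a + 1 + 2)) 1 (MvPolynomial.X (a + 1 + 2))) := by
    rw [chain_succ', chain_succ, chain_succ, chain_one, Nat.cast_one, Nat.cast_ofNat]
    rfl
  rw [e]
  refine h1.trans (le_of_eq ?_)
  rw [← WithTop.coe_add, ← WithTop.coe_add, ← WithTop.coe_add, WithTop.coe_eq_coe, e1, e2]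
  simp only [Finset.sum_range_succ, Finset.sum_range_zero, Nat.cast_zero, add_zero, Nat.cast_one,
    Nat.cast_ofNat, p.pole_eq_zero h0, zero_add]

/-- The chain of two factors does not vanish, the chain of four vanishes at most to the order of
z_k, and the two subtracted orders are nonnegative. -/
theorem connectionNumber_le (H : IsGeneric h) {k : ZMod 6} (h0 : 0 ≤ p.v (MvPolynomial.X k))
    (hf : p.v (MvPolynomial.X k) ≠ ⊤) :
    p.connectionNumber k 3 ≤ iord p.v (MvPolynomial.X k : MvPolynomial (ZMod 6) ℂ) := by
  have h1 := p.vanishingOrder_two_le H (k + 1)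
  have h2 := p.vanishingOrder_four_le H h0 hf
  have h3 := p.vanishingOrder_nonneg (k + 1) 3
  have h4 := p.vanishingOrder_nonneg k 3
  simp only [connectionNumber, Nat.reduceSub, Nat.reduceAdd]
  linarith

end CurvePoint

end Linkage

end

noncomputable section
namespace Linkage

/-! ### Points of the normalized curve -/

/-- Otherwise every element with a positive first entry has a nonnegative second one. This forces e,
e' ≥ 0 and e e' ≤ 1; zero values are refuted by the combination (1, -1), and e = e' = 1 by
subtracting (1, 1) from a multiple of (m - n, 0). -/
theorem exists_mem_pos_neg (D : AddSubgroup (ℤ × ℤ)) {e e' m n : ℤ} (h1 : ((1, e) : ℤ × ℤ) ∈ D)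
    (h2 : ((e', 1) : ℤ × ℤ) ∈ D) (h3 : ((m, n) : ℤ × ℤ) ∈ D) (hmn : m ≠ n) :
    ∃ x y : ℤ, ((x, y) : ℤ × ℤ) ∈ D ∧ 0 < x ∧ y < 0 := by
  have comb : ∀ {x y x' y' : ℤ} (a b : ℤ), ((x, y) : ℤ × ℤ) ∈ D → ((x', y') : ℤ × ℤ) ∈ D →
      ((a * x + b * x', a * y + b * y') : ℤ × ℤ) ∈ D := fun a b h h' => by
    simpa using D.add_mem (D.zsmul_mem h a) (D.zsmul_mem h' b)
  by_contra! hcon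
  have he : 0 ≤ e := hcon _ _ h1 one_pos
  have he' : 0 ≤ e' := by
    by_contra hlt
    have := hcon _ _ (comb (-1) 0 h2 h2) (by linarith)
    linarith
  -- the lattice contains no vector with one positive and one negative entry
  have hneg : ∀ {x y : ℤ}, ((x, y) : ℤ × ℤ) ∈ D → x < 0 → y ≤ 0 := fun h hx => by
    have := hcon _ _ (comb (-1) 0 h h) (by linarith)
    linarith
  have key1 : e * e' ≤ 1 := by
    by_contra hlt
    have h4 := comb (-e') 1 h1 h2
    have h5 := hcon _ _ (comb 1 (e + 1) h1 h4) (by linarith)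
    nlinarith
  rcases he.eq_or_lt with h0 | h0
  · have := hcon _ _ (comb (e' + 1) (-1) h1 h2) (by linarith)
    subst h0; linarith
  rcases he'.eq_or_lt with h0' | h0'
  · subst h0'
    have := hcon _ _ (comb 1 (-(e + 1)) h1 h2) (by linarith)
    linarith
  have he1 : e = 1 := by nlinarith
  have he1' : e' = 1 := by nlinarith
  subst he1 he1'
  have h4 := comb 1 (-n) h3 h1
  rcases lt_or_gt_of_ne hmn with h | h
  · have := hcon _ _ (comb (-2) (-1) h4 h1) (by linarith)
    linarith
  · have := hcon _ _ (comb 2 (-1) h4 h1) (by linarith)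
    linarith

namespace CurvePoint

variable {h : ZMod 6 → DQ ℝ}

theorem ext' {p p' : CurvePoint h} (hv : p.v = p'.v) : p = p' := by
  cases p; cases p'; cases hv; rfl

/-- The pairs of orders of quotients form a subgroup of ℤ². Normalization of the two valuations and
an element on which they differ supply the vectors for `exists_mem_pos_neg`. -/
theorem exists_sep {p p' : CurvePoint h} (hne : p ≠ p') (hs : ∀ f, p.v f = ⊤ ↔ p'.v f = ⊤) :
    ∃ a b, p.v a < p.v b ∧ p'.v b < p'.v a := by
  have tr : ∀ {f}, p.v f ≠ ⊤ → p'.v f ≠ ⊤ := fun hf h' => hf ((hs _).mpr h')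
  let D : AddSubgroup (ℤ × ℤ) :=
    { carrier := {x | ∃ a b, p.v a ≠ ⊤ ∧ p.v b ≠ ⊤ ∧
        x = (iord p.v b - iord p.v a, iord p'.v b - iord p'.v a)}
      zero_mem' := ⟨1, 1, ne_top_one, ne_top_one, by simp; rfl⟩
      add_mem' := by
        rintro _ _ ⟨a, b, ha, hb, rfl⟩ ⟨a', b', ha', hb', rfl⟩
        refine ⟨a * a', b * b', ne_top_mul ha ha', ne_top_mul hb hb', ?_⟩
        rw [iord_mul ha ha', iord_mul hb hb', iord_mul (tr ha) (tr ha'), iord_mul (tr hb) (tr hb')]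
        ext <;> simp <;> ring
      neg_mem' := by
        rintro _ ⟨a, b, ha, hb, rfl⟩
        exact ⟨b, a, hb, ha, by ext <;> simp⟩ }
  have hn : ∀ {w : AddValuation (MvPolynomial (ZMod 6) ℂ) (WithTop ℤ)} {f g}, w g ≠ ⊤ →
      w f = w g + 1 → w f ≠ ⊤ ∧ iord w f - iord w g = 1 := by
    intro w f g hg hfg
    have hf : w f ≠ ⊤ := by rw [hfg]; exact WithTop.add_ne_top.mpr ⟨hg, WithTop.one_ne_top⟩
    refine ⟨hf, ?_⟩
    rw [← coe_iord hf, ← coe_iord hg] at hfg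
    have : iord w f = iord w g + 1 := by exact_mod_cast hfg
    linarith
  obtain ⟨f, g, hg, hfg⟩ := p.normalized
  obtain ⟨f', g', hg', hfg'⟩ := p'.normalized
  obtain ⟨hf, e⟩ := hn hg hfg
  obtain ⟨hf', e'⟩ := hn hg' hfg'
  have back : ∀ {f}, p'.v f ≠ ⊤ → p.v f ≠ ⊤ := fun hf h' => hf ((hs _).mp h')
  obtain ⟨u, hu⟩ : ∃ u, p.v u ≠ p'.v u := by
    by_contra! hcon
    exact hne (ext' (AddValuation.ext hcon))
  have hu1 : p.v u ≠ ⊤ := fun h1 => hu (by rw [h1, (hs u).mp h1])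
  have hu2 := tr hu1
  have h1 : ((1, iord p'.v f - iord p'.v g) : ℤ × ℤ) ∈ D := ⟨g, f, hg, hf, by rw [e]⟩
  have h2 : ((iord p.v f' - iord p.v g', 1) : ℤ × ℤ) ∈ D :=
    ⟨g', f', back hg', back hf', by rw [e']⟩
  have h3 : ((iord p.v u, iord p'.v u) : ℤ × ℤ) ∈ D :=
    ⟨1, u, ne_top_one, hu1, by simp [iord_one]⟩
  obtain ⟨x, y, ⟨a, b, ha, hb, hxy⟩, hx, hy⟩ := exists_mem_pos_neg D h1 h2 h3 (fun h0 => hu (by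
    rw [← coe_iord hu1, ← coe_iord hu2, h0]))
  rw [Prod.mk.injEq] at hxy
  refine ⟨a, b, ?_, ?_⟩
  · rw [← coe_iord ha, ← coe_iord hb, WithTop.coe_lt_coe]; linarith
  · rw [← coe_iord (tr ha), ← coe_iord (tr hb), WithTop.coe_lt_coe]; linarith

instance (p : CurvePoint h) : p.v.supp.IsPrime :=
  inferInstanceAs (Valuation.supp (AddValuation.toValuation p.v)).IsPrime

/-- A maximal support is the ideal of a point by the Nullstellensatz. Every polynomial would then be
a constant modulo the support, so the valuation would take only the values 0 and ⊤ and could not be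
normalized. -/
theorem not_isMaximal_supp (p : CurvePoint h) : ¬ p.v.supp.IsMaximal := by
  intro hm
  obtain ⟨x, hx⟩ := MvPolynomial.isMaximal_iff_eq_vanishingIdeal_singleton.mp hm
  have key : ∀ f, p.v f = ⊤ ∨ p.v f = 0 := by
    intro f
    set a : ℂ := MvPolynomial.aeval x f with ha
    have h1 : f - MvPolynomial.C a ∈ p.v.supp := by
      rw [hx, MvPolynomial.mem_vanishingIdeal_singleton_iff]
      simp [ha]
    have h2 := p.v.map_add_supp (MvPolynomial.C a) h1
    rw [add_sub_cancel] at h2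
    by_cases h0 : a = 0
    · left; rw [h2, h0, map_zero, p.v.map_zero]
    · right; rw [h2, p.trivial_on_const a h0]
  obtain ⟨f, g, hg, hfg⟩ := p.normalized
  have h1 := (key g).resolve_left hg
  rw [h1, zero_add] at hfg
  rcases key f with h | h <;> rw [h] at hfg
  · exact WithTop.one_ne_top hfg.symm
  · exact absurd hfg (by decide)

/-- If one support were properly contained in the other, a maximal ideal above it would complete a
chain of three primes over the ideal of a one-dimensional set. -/
theorem supp_dichotomy (hdim : mobility h = 1) (p p' : CurvePoint h) :
    (∀ f, p.v f = ⊤ ↔ p'.v f = ⊤) ∨ ∃ f, p'.v f = ⊤ ∧ p.v f ≠ ⊤ := by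
  by_contra! hcon
  obtain ⟨h1, h2⟩ := hcon
  have hle : p'.v.supp ≤ p.v.supp := fun f hf =>
    (AddValuation.mem_supp_iff _ _).mpr (h2 f ((AddValuation.mem_supp_iff _ _).mp hf))
  have hlt : p'.v.supp < p.v.supp := by
    refine lt_of_le_of_ne hle fun he => ?_
    obtain ⟨f, hf⟩ := h1
    have := SetLike.ext_iff.mp he f
    rw [AddValuation.mem_supp_iff, AddValuation.mem_supp_iff] at this
    rcases hf with ⟨ha, hb⟩ | ⟨ha, hb⟩
    · exact hb (this.mpr ha)
    · exact ha (this.mp hb)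
  obtain ⟨M, hM, hpM⟩ := Ideal.exists_le_maximal p.v.supp (inferInstance : p.v.supp.IsPrime).ne_top
  have hlt' : p.v.supp < M := lt_of_le_of_ne hpM fun he => p.not_isMaximal_supp (he ▸ hM)
  have hI : ∀ q : CurvePoint h, configIdeal h ≤ q.v.supp := fun q f hf =>
    (AddValuation.mem_supp_iff _ _).mpr (q.on_curve f hf)
  let Z := PrimeSpectrum.zeroLocus (configIdeal h : Set (MvPolynomial (ZMod 6) ℂ))
  let x₀ : Z := ⟨⟨p'.v.supp, inferInstance⟩, hI p'⟩
  let x₁ : Z := ⟨⟨p.v.supp, inferInstance⟩, hI p⟩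
  let x₂ : Z := ⟨⟨M, hM.isPrime⟩, (hI p).trans hpM⟩
  have l1 : x₀ < x₁ := hlt
  have l2 : x₁ < x₂ := hlt'
  let s : LTSeries Z := ⟨2, ![x₀, x₁, x₂], fun i => by
    fin_cases i
    · exact l1
    · exact l2⟩
  have := Order.LTSeries.length_le_krullDim s
  rw [mobility, ringKrullDim_quotient] at hdim
  have h3 : (s.length : WithBot ℕ∞) ≤ 1 := hdim ▸ this
  have h4 : s.length = 2 := rfl
  rw [h4] at h3
  exact absurd h3 (by decide)

end CurvePoint

end Linkage

end

noncomputable section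
namespace Linkage

/-! ### Counting bonds -/

section Transfer

variable {ι A L R : Type*} [CommRing A] [CommRing L] [CommRing R]

theorem addVal_comap_apply (f : R →+* L) (w : AddValuation L (WithTop ℤ)) (x : R) :
    w.comap f x = w (f x) := rfl

/-- Places of one ring become places of another ring with the same fractions. -/
theorem isPlaces_comap [Algebra ℂ R] (v : ι → AddValuation A (WithTop ℤ)) (V : ι → AddValuation L (WithTop ℤ))
    (e : A →+* L) (φ : R →+* L) (hV : ∀ i f, V i (e f) = v i f)
    (hden : ∀ x, ∃ f m, (∀ i, v i m ≠ ⊤) ∧ x * e m = e f) (T : R) (hT : ∀ i, V i (φ T) ≠ ⊤)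
    (htr : ∀ f, ∃ (N : ℕ) (r : R), φ r = e f * φ T ^ N)
    (const : ∀ i (c : ℂ), c ≠ 0 → V i (φ (algebraMap ℂ R c)) = 0)
    (nonneg : ∀ i r, 0 ≤ V i (φ r))
    (normalized : ∀ i, ∃ f g, v i g ≠ ⊤ ∧ v i f = v i g + 1)
    (supp : ∀ i j, (∀ r, v i r = ⊤ ↔ v j r = ⊤) ∨ ∃ r, v j r = ⊤ ∧ v i r ≠ ⊤)
    (sep : ∀ i j, i ≠ j → (∀ r, v i r = ⊤ ↔ v j r = ⊤) → ∃ a b, v i a < v i b ∧ v j b < v j a) :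
    IsPlaces ℂ fun i => (V i).comap φ := by
  have hpow : ∀ i N, V i (φ T ^ N) ≠ ⊤ := fun i N => (pow_spec (hT i) N).1
  -- Both rings have the same fractions: a power of `T`, of finite order at all places, brings two
  -- given elements into the new ring simultaneously, so comparisons of orders survive.
  have htr2 : ∀ f g, ∃ (N : ℕ) (r s : R), φ r = e f * φ T ^ N ∧ φ s = e g * φ T ^ N := by
    intro f g
    obtain ⟨N, r, hr⟩ := htr f
    obtain ⟨M, s, hs⟩ := htr g
    refine ⟨N + M, r * T ^ M, s * T ^ N, ?_, ?_⟩
    · rw [map_mul, map_pow, hr, pow_add]; ring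
    · rw [map_mul, map_pow, hs, pow_add]; ring
  have hval : ∀ {N r f}, φ r = e f * φ T ^ N → ∀ i, V i (φ r) = v i f + V i (φ T ^ N) := by
    intro N r f hr i
    rw [hr, (V i).map_mul, hV]
  have hadd : ∀ {x y : WithTop ℤ}, y ≠ ⊤ → (x + y = ⊤ ↔ x = ⊤) := fun hy => by
    rw [WithTop.add_eq_top]; exact or_iff_left hy
  have hlt : ∀ {x y z : WithTop ℤ}, z ≠ ⊤ → x < y → x + z < y + z := by
    intro x y z hz h
    exact WithTop.add_lt_add_right hz h
  refine ⟨const, nonneg, fun i => ?_, fun i j => ?_, fun i j hij hs => ?_⟩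
  · obtain ⟨f, g, hg, hfg⟩ := normalized i
    obtain ⟨N, r, s, hr, hs⟩ := htr2 f g
    refine ⟨r, s, ?_, ?_⟩
    · rw [addVal_comap_apply, hval hs]
      exact WithTop.add_ne_top.mpr ⟨hg, hpow i N⟩
    · rw [addVal_comap_apply, addVal_comap_apply, hval hs, hval hr, hfg, add_right_comm]
  · rcases supp i j with h | ⟨f, h1, h2⟩
    · left
      intro r
      obtain ⟨f, m, hm, hx⟩ := hden (φ r)
      have h1 : ∀ i, V i (φ r) + v i m = v i f := fun i => by
        rw [← hV, ← (V i).map_mul, hx, hV]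
      rw [addVal_comap_apply, addVal_comap_apply, ← hadd (hm i), ← hadd (x := V j (φ r)) (hm j),
        h1, h1, h]
    · right
      obtain ⟨N, r, hr⟩ := htr f
      refine ⟨r, ?_, ?_⟩
      · rw [addVal_comap_apply, hval hr, h1, top_add]
      · rw [addVal_comap_apply, hval hr]
        exact WithTop.add_ne_top.mpr ⟨h2, hpow i N⟩
  · have hs' : ∀ f, v i f = ⊤ ↔ v j f = ⊤ := by
      intro f
      obtain ⟨N, r, hr⟩ := htr f
      have := hs r
      rw [addVal_comap_apply, addVal_comap_apply, hval hr, hval hr, hadd (hpow i N),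
        hadd (hpow j N)] at this
      exact this
    obtain ⟨a, b, h1, h2⟩ := sep i j hij hs'
    obtain ⟨N, r, s, hr, hs⟩ := htr2 a b
    refine ⟨r, s, ?_, ?_⟩
    · rw [addVal_comap_apply, addVal_comap_apply, hval hr, hval hs]
      exact hlt (hpow i N) h1
    · rw [addVal_comap_apply, addVal_comap_apply, hval hr, hval hs]
      exact hlt (hpow j N) h2

end Transfer

/-! ### Fractions with denominators of finite order. -/

section Extend

variable {ι A : Type*} [CommRing A] (v : ι → AddValuation A (WithTop ℤ))

/-- The elements of finite order at all places. -/
def finiteOrder : Submonoid A where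
  carrier := {f | ∀ i, v i f ≠ ⊤}
  one_mem' _ := ne_top_one
  mul_mem' ha hb i := ne_top_mul (ha i) (hb i)

/-- The extension of a place to the fractions with denominators of finite order. -/
def extendPlace (i : ι) : AddValuation (Localization (finiteOrder v)) (WithTop ℤ) :=
  AddValuation.ofValuation ((AddValuation.toValuation (v i)).extendToLocalization
    (S := finiteOrder v) (fun _ hf h => hf i h) (Localization (finiteOrder v)))

theorem extendPlace_algebraMap (i : ι) (f : A) :
    extendPlace v i (algebraMap A (Localization (finiteOrder v)) f) = v i f :=
  Valuation.extendToLocalization_apply_map_apply (AddValuation.toValuation (v i))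
    (S := finiteOrder v) (fun _ hf h => hf i h) (Localization (finiteOrder v)) f

theorem exists_inverse {m : A} (hm : ∀ i, v i m ≠ ⊤) :
    ∃ w : Localization (finiteOrder v), w * algebraMap A _ m = 1 ∧
      ∀ i, extendPlace v i w + v i m = 0 := by
  have hu := IsLocalization.map_units (Localization (finiteOrder v)) (⟨m, hm⟩ : finiteOrder v)
  obtain ⟨w, hw⟩ := hu.exists_left_inv
  refine ⟨w, hw, fun i => ?_⟩
  rw [← extendPlace_algebraMap v i m, ← (extendPlace v i).map_mul]
  exact (congrArg _ hw).trans (extendPlace v i).map_one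

theorem exists_fraction (x : Localization (finiteOrder v)) :
    ∃ f m, (∀ i, v i m ≠ ⊤) ∧ x * algebraMap A _ m = algebraMap A _ f := by
  obtain ⟨⟨f, m⟩, hx⟩ := IsLocalization.surj (finiteOrder v) x
  exact ⟨f, m, m.2, hx⟩

end Extend

end Linkage

end

/-! ### Charts finite at all given points, and the resulting bound. -/

noncomputable section
namespace Linkage

open Polynomial

/-- Homogeneous parameters for the coordinate `z`, polynomial in a coordinate `ξ` that is finite
at all places: `a, b` are proportional to `1, z`, or to `z, 1` for a reversed line, and some
multiple of `z` is polynomial in `ξ`. -/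
structure IsChart {L ι : Type*} [CommRing L] [Algebra ℂ L] (V : ι → AddValuation L (WithTop ℤ))
    (z : L) (s : Bool) (ξ l : L) (a b τ r : ℂ[X]) (p q : ℂ) : Prop where
  left : aeval ξ a = if s then l * z else l
  right : aeval ξ b = if s then l else l * z
  lin : p • a + q • b = 1
  gen : a = X ∨ b = X
  nonneg : ∀ i, 0 ≤ V i ξ
  ne_top : ∀ i, V i (aeval ξ τ) ≠ ⊤
  mul_eq : z * aeval ξ τ = aeval ξ r

section Chart

variable {L ι : Type*} [CommRing L] [Algebra ℂ L] {V : ι → AddValuation L (WithTop ℤ)} {z l : L}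

theorem isChart_of_nonneg (hz : ∀ i, 0 ≤ V i z) : IsChart V z false z 1 1 X 1 X 1 0 where
  left := by simp
  right := by simp
  lin := by simp
  gen := Or.inr rfl
  nonneg := hz
  ne_top i := by simp
  mul_eq := by simp

theorem isChart_of_inv (h : l * z = 1) (hl : ∀ i, 0 ≤ V i l) (hl' : ∀ i, V i l ≠ ⊤) :
    IsChart V z true l l 1 X X 1 1 0 where
  left := by simp [h]
  right := by simp
  lin := by simp
  gen := Or.inr rfl
  nonneg := hl
  ne_top i := by simpa using hl' i
  mul_eq := by simpa [mul_comm] using h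

/-- The coordinate is ξ = l = 1/(z + c). The homogeneous parameters l and l z = 1 - c l are
polynomials in ξ, and reversing the line interchanges them. -/
theorem exists_isChart {c : ℂ} (h : l * (z + algebraMap ℂ L c) = 1) (hl : ∀ i, 0 ≤ V i l)
    (hl' : ∀ i, V i l ≠ ⊤) (s : Bool) : ∃ a b τ r p q, IsChart V z s l l a b τ r p q := by
  have e : l * z = 1 - algebraMap ℂ L c * l := by linear_combination h
  have lin : c • (X : ℂ[X]) + (1 : ℂ) • (1 - C c * X) = 1 := by
    rw [smul_eq_C_mul, one_smul]; ring
  cases s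
  · exact ⟨X, 1 - C c * X, X, 1 - C c * X, c, 1, by simp, by simp [e], lin, Or.inl rfl, hl,
      fun i => by simpa using hl' i, by simp [mul_comm z, e]⟩
  · exact ⟨1 - C c * X, X, X, 1 - C c * X, 1, c, by simp [e], by simp, by rw [add_comm, lin],
      Or.inr rfl, hl, fun i => by simpa using hl' i, by simp [mul_comm z, e]⟩

end Chart

section Count

variable {h : ZMod 6 → DQ ℝ}

theorem nonneg_of_add_eq_zero {x y : WithTop ℤ} (h : x + y = 0) (hy : y ≤ 0) : 0 ≤ x ∧ x ≠ ⊤ := by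
  cases x with
  | top => simp at h
  | coe x =>
    cases y with
    | top => simp at h
    | coe y =>
      have h1 : x + y = 0 := by exact_mod_cast h
      have h2 : y ≤ 0 := by exact_mod_cast hy
      exact ⟨by exact_mod_cast (by linarith : 0 ≤ x), WithTop.coe_ne_top⟩

theorem factor_signed {S : Type*} [CommRing S] [Algebra ℂ S] (s : ZMod 6 → Bool)
    (h : ZMod 6 → DQ ℝ) (j : ZMod 6) (l z : S) :
    factor (signed s h j) (if s j then l * z else l) (if s j then l else l * z) =
      l • factor (h j) 1 z := by
  rw [smul_factor, mul_one, signed]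
  split_ifs
  · rw [factor_neg]
  · rfl

/-- Every term of a minor contains all six factors exactly once, so rescaling the factors multiplies
the minor by the product of the scales. -/
theorem map_minor {R A L : Type*} [CommRing R] [CommRing A] [CommRing L] (φ : R →+* L) (e : A →+* L)
    {x : ZMod 6 → DQ R} {y : ZMod 6 → DQ A} {l : ZMod 6 → L}
    (hF : ∀ j, mapDQ φ (x j) = l j • mapDQ e (y j)) (k : ZMod 6) (c d : Fin 8) :
    φ (coord (x k * x (k + 1) * x (k + 2)) c * coord (star (x (k + 3) * x (k + 4) * x (k + 5))) d -
      coord (x k * x (k + 1) * x (k + 2)) d * coord (star (x (k + 3) * x (k + 4) * x (k + 5))) c) =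
    l (k + 2) * (l (k + 1) * l k) * (l (k + 5) * (l (k + 4) * l (k + 3))) *
      e (coord (y k * y (k + 1) * y (k + 2)) c *
        coord (star (y (k + 3) * y (k + 4) * y (k + 5))) d -
      coord (y k * y (k + 1) * y (k + 2)) d *
        coord (star (y (k + 3) * y (k + 4) * y (k + 5))) c) := by
  have h2 : ∀ (q : DQ R) (c), φ (coord q c) = coord (mapDQ φ q) c := fun q c =>
    (coord_mapDQ _ _ _).symm
  have h3 : ∀ (q : DQ A) (c), coord (mapDQ e q) c = e (coord q c) := fun q c => coord_mapDQ _ _ _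
  rw [map_sub, map_mul, map_mul, h2, h2, h2, h2, mapDQ_star]
  simp only [mapDQ_mul, hF, DQ.smul_mul, DQ.mul_smul, DQ.smul_smul, DQ.star_smul]
  simp only [← mapDQ_mul, ← mapDQ_star, coord_smul, Pi.smul_apply, h3, smul_eq_mul]
  rw [map_sub, map_mul, map_mul]
  ring

section Charts

variable {ι L : Type*} [CommRing L] [Algebra ℂ L]
  {v : ι → AddValuation (MvPolynomial (ZMod 6) ℂ) (WithTop ℤ)}
  {V : ι → AddValuation L (WithTop ℤ)} {e : MvPolynomial (ZMod 6) ℂ →ₐ[ℂ] L} {s : ZMod 6 → Bool}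
  {ξ l : ZMod 6 → L} {a b τ r : ZMod 6 → ℂ[X]} {p q : ZMod 6 → ℂ}

theorem isPlaces_of_charts (hVv : ∀ i f, V i (e f) = v i f)
    (hden : ∀ x, ∃ f m, (∀ i, v i m ≠ ⊤) ∧ x * e m = e f)
    (hconst : ∀ i (c : ℂ), c ≠ 0 → V i (algebraMap ℂ L c) = 0)
    (hch : ∀ j, IsChart V (e (MvPolynomial.X j)) (s j) (ξ j) (l j) (a j) (b j) (τ j) (r j) (p j) (q j))
    (normalized : ∀ i, ∃ f g, v i g ≠ ⊤ ∧ v i f = v i g + 1)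
    (supp : ∀ i j, (∀ r, v i r = ⊤ ↔ v j r = ⊤) ∨ ∃ r, v j r = ⊤ ∧ v i r ≠ ⊤)
    (sep : ∀ i j, i ≠ j → (∀ r, v i r = ⊤ ↔ v j r = ⊤) → ∃ a b, v i a < v i b ∧ v j b < v j a) :
    IsPlaces ℂ fun i => (V i).comap
      ((MvPolynomial.aeval ξ : MvPolynomial (ZMod 6) ℂ →ₐ[ℂ] L) : MvPolynomial (ZMod 6) ℂ →+* L) := by
  classical
  obtain ⟨φ, hφdef⟩ : ∃ φ : MvPolynomial (ZMod 6) ℂ →ₐ[ℂ] L, φ = MvPolynomial.aeval ξ := ⟨_, rfl⟩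
  have hX : ∀ j, φ (MvPolynomial.X j) = ξ j := fun j => by rw [hφdef, MvPolynomial.aeval_X]
  rw [← hφdef]
  have hφ : ∀ j (f : ℂ[X]), φ (aeval (MvPolynomial.X j : MvPolynomial (ZMod 6) ℂ) f) = aeval (ξ j) f :=
    fun j f => by rw [← aeval_algHom_apply, hX]
  -- A common denominator for all six coordinates z_j in the new coordinates.
  obtain ⟨T, hT⟩ : ∃ T : MvPolynomial (ZMod 6) ℂ, T = ∏ j, aeval (MvPolynomial.X j) (τ j) := ⟨_, rfl⟩
  refine isPlaces_comap v V (e : MvPolynomial (ZMod 6) ℂ →+* L) φ hVv hden T (fun i => ?_)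
    (fun f => ?_) (fun i c hc => ?_) (fun i f => ?_) normalized supp sep
  · change V i (φ T) ≠ ⊤
    rw [hT, map_prod]
    exact (prod_spec _ _ fun j _ => by rw [hφ]; exact (hch j).ne_top i).1
  · change ∃ (N : ℕ) (r : MvPolynomial (ZMod 6) ℂ), φ r = e f * φ T ^ N
    induction f using MvPolynomial.induction_on with
    | C c =>
      refine ⟨0, MvPolynomial.C c, ?_⟩
      rw [pow_zero, mul_one]
      exact (φ.commutes c).trans (e.commutes c).symm
    | add f g hf hg =>
      obtain ⟨N, x, hx⟩ := hf
      obtain ⟨M, y, hy⟩ := hg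
      refine ⟨N + M, x * T ^ M + y * T ^ N, ?_⟩
      rw [map_add, map_mul, map_mul, map_pow, map_pow, hx, hy, map_add, pow_add]; ring
    | mul_X f j hf =>
      obtain ⟨N, x, hx⟩ := hf
      refine ⟨N + 1, x * (aeval (MvPolynomial.X j) (r j) *
        ∏ j ∈ Finset.univ.erase j, aeval (MvPolynomial.X j) (τ j)), ?_⟩
      have e1 : φ T = aeval (ξ j) (τ j) *
          φ (∏ j ∈ Finset.univ.erase j, aeval (MvPolynomial.X j) (τ j)) := by
        rw [hT, ← hφ, ← map_mul]
        exact congrArg φ (Finset.mul_prod_erase Finset.univ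
          (fun j => aeval (MvPolynomial.X j : MvPolynomial (ZMod 6) ℂ) (τ j))
          (Finset.mem_univ j)).symm
      rw [map_mul, map_mul, hx, hφ, ← (hch j).mul_eq, map_mul, pow_succ]
      linear_combination (-(e f * φ T ^ N * e (MvPolynomial.X j))) * e1
  · change V i (φ (algebraMap ℂ _ c)) = 0
    rw [φ.commutes, hconst i c hc]
  · change 0 ≤ V i (φ f)
    induction f using MvPolynomial.induction_on with
    | C c =>
      have : φ (MvPolynomial.C c) = algebraMap ℂ L c := φ.commutes c
      rw [this]
      by_cases hc : c = 0
      · rw [hc, map_zero, (V i).map_zero]; exact le_top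
      · exact (hconst i c hc).ge
    | add f g hf hg =>
      rw [map_add]
      exact (le_min hf hg).trans ((V i).map_add _ _)
    | mul_X f j hf =>
      rw [map_mul, (V i).map_mul, hX]
      exact add_nonneg hf ((hch j).nonneg i)

/-- In the chart coordinates, `β k` is z_k, and the minors vanish at all places because they vanish
on the configuration curve. So `exists_span_mod` and `IsPlaces.sum_le` apply with the ideal of
elements of infinite order at all places. -/
theorem IsGeneric.sum_iord_le_of_charts [Fintype ι] (H : IsGeneric h)
    (hVv : ∀ i f, V i (e f) = v i f) (hv : ∀ i, ∀ f ∈ configIdeal h, v i f = ⊤) (k : ZMod 6)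
    (hk : ∀ i, 0 < v i (MvPolynomial.X k))
    (hch : ∀ j, IsChart V (e (MvPolynomial.X j)) (s j) (ξ j) (l j) (a j) (b j) (τ j) (r j) (p j) (q j))
    (ak : a k = 1) (bk : b k = X) (ξk : ξ k = e (MvPolynomial.X k)) (ak3 : a (k + 3) = 1)
    (hplaces : IsPlaces ℂ fun i => (V i).comap
      ((MvPolynomial.aeval ξ : MvPolynomial (ZMod 6) ℂ →ₐ[ℂ] L) : MvPolynomial (ZMod 6) ℂ →+* L)) :
    (∀ i, v i (MvPolynomial.X k) ≠ ⊤) ∧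
      ∑ i, iord (v i) (MvPolynomial.X k : MvPolynomial (ZMod 6) ℂ) ≤
        (commonPoly (Linkage.signed s h) k).natDegree := by
  obtain ⟨φ, hφdef⟩ : ∃ φ : MvPolynomial (ZMod 6) ℂ →ₐ[ℂ] L, φ = MvPolynomial.aeval ξ := ⟨_, rfl⟩
  have hX : ∀ j, φ (MvPolynomial.X j) = ξ j := fun j => by rw [hφdef, MvPolynomial.aeval_X]
  rw [← hφdef] at hplaces
  have hφ : ∀ j (f : ℂ[X]), φ (aeval (MvPolynomial.X j : MvPolynomial (ZMod 6) ℂ) f) = aeval (ξ j) f :=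
    fun j f => by rw [← aeval_algHom_apply, hX]
  obtain ⟨α, hα⟩ : ∃ α : ZMod 6 → MvPolynomial (ZMod 6) ℂ,
    ∀ j, α j = aeval (MvPolynomial.X j) (a j) := ⟨_, fun _ => rfl⟩
  obtain ⟨β, hβ⟩ : ∃ β : ZMod 6 → MvPolynomial (ZMod 6) ℂ,
    ∀ j, β j = aeval (MvPolynomial.X j) (b j) := ⟨_, fun _ => rfl⟩
  have hF : ∀ j, mapDQ (φ : MvPolynomial (ZMod 6) ℂ →+* L)
      (factor (Linkage.signed s h j) (α j) (β j)) =
      l j • mapDQ (e : MvPolynomial (ZMod 6) ℂ →+* L) (curveFactor h j) := fun j => by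
    rw [curveFactor, mapDQ_factor, mapDQ_factor, hα, hβ, hφ, hφ, (hch j).left, (hch j).right, map_one,
      factor_signed]
  let I : Ideal (MvPolynomial (ZMod 6) ℂ) :=
    ⨅ i, ((V i).comap (φ : MvPolynomial (ZMod 6) ℂ →+* L)).supp
  have hI : ∀ f, f ∈ I ↔ ∀ i, V i (φ f) = ⊤ := fun f => by
    rw [Ideal.mem_iInf]
    exact forall_congr' fun i => AddValuation.mem_supp_iff _ _
  have hβk : ∀ i, V i (φ (β k)) = v i (MvPolynomial.X k) := fun i => by
    rw [hβ, hφ, bk, aeval_X, ξk, hVv]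
  obtain ⟨u, hu⟩ := (H.signed s).exists_span_mod k (a := α) (b := β) (p := p) (q := q)
    (fun j => by
      have := congrArg (aeval (MvPolynomial.X j : MvPolynomial (ZMod 6) ℂ)) (hch j).lin
      rwa [map_add, map_smul, map_smul, map_one, ← hα, ← hβ] at this)
    (by rw [hα, ak, map_one]) (by rw [hα, ak3, map_one])
    (by
      rw [eq_top_iff, ← MvPolynomial.adjoin_range_X]
      refine Algebra.adjoin_mono ?_
      rintro _ ⟨j, rfl⟩
      rcases (hch j).gen with hj | hj
      · exact Or.inl ⟨j, by rw [hα, hj, aeval_X]⟩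
      · exact Or.inr ⟨j, by rw [hβ, hj, aeval_X]⟩) (I := I) (fun c d => by
      rw [hI]
      intro i
      have e1 := map_minor (φ : MvPolynomial (ZMod 6) ℂ →+* L) (e : MvPolynomial (ZMod 6) ℂ →+* L)
        hF k c d
      refine (congrArg (V i) e1).trans ?_
      rw [(V i).map_mul]
      have e2 := (hVv i _).trans (hv i _ (H.minor_mem_configIdeal k c d))
      exact (congrArg _ e2).trans (add_top _))
  obtain ⟨h1, h2⟩ := hplaces.sum_le (t := β k) (I := I) (fun f hf i => (hI f).mp hf i)
    (fun i => (hk i).trans_eq (hβk i).symm) u hu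
  refine ⟨fun i => ?_, ?_⟩
  · have := h1 i
    rw [addVal_comap_apply] at this
    rw [← hβk]; exact this
  · refine le_trans (le_of_eq (Finset.sum_congr rfl fun i _ => ?_)) h2
    rw [iord, iord, addVal_comap_apply]
    exact congrArg _ (hβk i).symm

/-- At `k` and `k + 3` the sign of the order is known, so z or 1/z is finite and the leading
parameter is one. Elsewhere a constant c that is generic for all places at once makes 1/(z + c)
finite. -/
theorem exists_charts [Fintype ι] (hVv : ∀ i f, V i (e f) = v i f)
    (hinv : ∀ m, (∀ i, v i m ≠ ⊤) → ∃ w, w * e m = 1 ∧ ∀ i, V i w + v i m = 0)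
    (hconst : ∀ i (c : ℂ), c ≠ 0 → v i (algebraMap ℂ _ c) = 0) (k : ZMod 6)
    (hs : s k = false) (hk : ∀ i, 0 < v i (MvPolynomial.X k))
    (hk3 : ∀ i, if s (k + 3) then v i (MvPolynomial.X (k + 3)) < 0
      else 0 < v i (MvPolynomial.X (k + 3))) (j : ZMod 6) :
    ∃ (ξ l : L) (a b τ r : ℂ[X]) (p q : ℂ),
      IsChart V (e (MvPolynomial.X j)) (s j) ξ l a b τ r p q ∧
      (j = k → a = 1 ∧ b = X ∧ ξ = e (MvPolynomial.X j)) ∧ (j = k + 3 → a = 1) := by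
  by_cases hjk : j = k
  · subst hjk
    rw [hs]
    exact ⟨_, _, _, _, _, _, _, _, isChart_of_nonneg fun i => by rw [hVv]; exact (hk i).le,
      fun _ => ⟨rfl, rfl, rfl⟩, fun _ => rfl⟩
  by_cases hj3 : j = k + 3
  · subst hj3
    cases hs3 : s (k + 3) with
    | false =>
      simp only [hs3] at hk3
      exact ⟨_, _, _, _, _, _, _, _, isChart_of_nonneg fun i => by rw [hVv]; exact (hk3 i).le,
        fun h => absurd h hjk, fun _ => rfl⟩
    | true =>
      simp only [hs3, if_true] at hk3
      obtain ⟨w, hw, hwv⟩ := hinv (MvPolynomial.X (k + 3)) fun i => (hk3 i).ne_top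
      have h1 := fun i => nonneg_of_add_eq_zero (hwv i) (hk3 i).le
      exact ⟨_, _, _, _, _, _, _, _, isChart_of_inv hw (fun i => (h1 i).1) fun i => (h1 i).2,
        fun h => absurd h hjk, fun _ => rfl⟩
  · obtain ⟨c, hc⟩ := exists_generic v hconst (MvPolynomial.X j) 1
    have hle : ∀ i, v i (MvPolynomial.X j + c • 1) ≤ 0 := fun i => by
      rw [hc, (v i).map_one]; exact min_le_right _ _
    obtain ⟨w, hw, hwv⟩ := hinv (MvPolynomial.X j + c • 1)
      fun i => ne_top_of_le_ne_top WithTop.zero_ne_top (hle i)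
    have h1 := fun i => nonneg_of_add_eq_zero (hwv i) (hle i)
    rw [map_add, map_smul, map_one, ← Algebra.algebraMap_eq_smul_one] at hw
    obtain ⟨a, b, τ, r, p, q, hch⟩ := exists_isChart hw (fun i => (h1 i).1) (fun i => (h1 i).2) (s j)
    exact ⟨_, _, _, _, _, _, _, _, hch, fun h => absurd h hjk, fun h => absurd h hj3⟩

/-- A bound that is valid for all charts on a common ring of fractions. -/
theorem IsGeneric.sum_iord_le_of_fractions [Fintype ι] (H : IsGeneric h)
    (hVv : ∀ i f, V i (e f) = v i f)
    (hinv : ∀ m, (∀ i, v i m ≠ ⊤) → ∃ w, w * e m = 1 ∧ ∀ i, V i w + v i m = 0)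
    (hden : ∀ x, ∃ f m, (∀ i, v i m ≠ ⊤) ∧ x * e m = e f)
    (hv : ∀ i, ∀ f ∈ configIdeal h, v i f = ⊤)
    (hconst : ∀ i (c : ℂ), c ≠ 0 → v i (algebraMap ℂ _ c) = 0)
    (normalized : ∀ i, ∃ f g, v i g ≠ ⊤ ∧ v i f = v i g + 1)
    (supp : ∀ i j, (∀ r, v i r = ⊤ ↔ v j r = ⊤) ∨ ∃ r, v j r = ⊤ ∧ v i r ≠ ⊤)
    (sep : ∀ i j, i ≠ j → (∀ r, v i r = ⊤ ↔ v j r = ⊤) → ∃ a b, v i a < v i b ∧ v j b < v j a)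
    (k : ZMod 6) (hs : s k = false) (hk : ∀ i, 0 < v i (MvPolynomial.X k))
    (hk3 : ∀ i, if s (k + 3) then v i (MvPolynomial.X (k + 3)) < 0
      else 0 < v i (MvPolynomial.X (k + 3))) :
    (∀ i, v i (MvPolynomial.X k) ≠ ⊤) ∧
      ∑ i, iord (v i) (MvPolynomial.X k : MvPolynomial (ZMod 6) ℂ) ≤
        (commonPoly (Linkage.signed s h) k).natDegree := by
  choose ξ l a b τ r p q hch hchk hch3 using exists_charts hVv hinv hconst k hs hk hk3
  refine H.sum_iord_le_of_charts hVv hv k hk hch (hchk k rfl).1 (hchk k rfl).2.1 (hchk k rfl).2.2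
    (hch3 _ rfl) (isPlaces_of_charts hVv hden (fun i c hc => ?_) hch normalized supp sep)
  rw [← e.commutes, hVv]
  exact hconst i c hc

end Charts

theorem IsGeneric.sum_iord_le (H : IsGeneric h) (hdim : mobility h = 1) (k : ZMod 6)
    (s : ZMod 6 → Bool) (hs : s k = false) {ι : Type*} [Fintype ι] (P : ι → CurvePoint h)
    (hP : Function.Injective P) (hk : ∀ i, (P i).IsPlusI k)
    (hk3 : ∀ i, if s (k + 3) then (P i).IsMinusI (k + 3) else (P i).IsPlusI (k + 3)) :
    (∀ i, (P i).v (MvPolynomial.X k) ≠ ⊤) ∧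
      ∑ i, iord (P i).v (MvPolynomial.X k : MvPolynomial (ZMod 6) ℂ) ≤
        (commonPoly (Linkage.signed s h) k).natDegree :=
  H.sum_iord_le_of_fractions
    (e := IsScalarTower.toAlgHom ℂ (MvPolynomial (ZMod 6) ℂ)
      (Localization (finiteOrder fun i => (P i).v)))
    (extendPlace_algebraMap fun i => (P i).v)
    (fun _ hm => exists_inverse (fun i => (P i).v) hm) (exists_fraction fun i => (P i).v)
    (fun i => (P i).on_curve) (fun i => (P i).trivial_on_const) (fun i => (P i).normalized)
    (fun i j => (P i).supp_dichotomy hdim (P j)) (fun _ _ hij => CurvePoint.exists_sep (hP.ne hij))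
    k hs hk hk3

end Count

end Linkage

end

/-! ### From finite sets of bonds to the two bounds. -/

noncomputable section
namespace Linkage

open Polynomial

variable {h : ZMod 6 → DQ ℝ}

theorem quadFormula_neg (b c s : ZMod 6 → ℝ) (k : ZMod 6) :
    quadFormula b c (fun j => -s j) k = (quadFormula b c s k).map (starRingEnd ℂ) := by
  have conj : ∀ x y : ℝ, starRingEnd ℂ ⟨x, y⟩ = ⟨x, -y⟩ := fun _ _ => rfl
  simp only [quadFormula, Polynomial.map_add, Polynomial.map_pow, map_X, map_C, conj, neg_sq,
    neg_mul_neg]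
  rw [show (-s (k + 3) - -s k) / 4 = -((s (k + 3) - s k) / 4) by ring,
    show ∀ x y : ℝ, -(-s (k + 1) * x + -s (k + 2) * y) / 2 =
      -(-(s (k + 1) * x + s (k + 2) * y) / 2) by intro x y; ring]

/-- Reversing all lines keeps the parameters b and c and changes the signs of the offsets; in the
formula this is complex conjugation. -/
theorem IsGeneric.invQuadPlus_signed_not (H : IsGeneric h) (s : ZMod 6 → Bool) (k : ZMod 6) :
    invQuadPlus (Linkage.signed (fun i => !s i) h) k =
      (invQuadPlus (Linkage.signed s h) k).map (starRingEnd ℂ) := by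
  have e : ∀ a, sgn (!a) = -sgn a := fun a => by cases a <;> simp [sgn]
  rw [(H.signed _).invQuadPlus_eq, (H.signed _).invQuadPlus_eq, ← quadFormula_neg]
  congr 1
  · funext j; rw [paramB_signed, paramB_signed, e, e, neg_mul_neg]
  · funext j; rw [paramC_signed, paramC_signed, e, e, neg_mul_neg]
  · funext j; rw [paramS_signed, paramS_signed, e, neg_mul]

theorem IsGeneric.natDegree_commonPoly_signed_not (H : IsGeneric h) (s : ZMod 6 → Bool)
    (k : ZMod 6) : (commonPoly (Linkage.signed (fun i => !s i) h) k).natDegree =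
      (commonPoly (Linkage.signed s h) k).natDegree := by
  rw [commonPoly, H.invQuadPlus_signed_not, H.invQuadPlus_signed_not, Polynomial.gcd_map,
    natDegree_map, commonPoly]

/-- A bound for all finite subsets of a set of places bounds the whole sum. -/
theorem IsGeneric.finite_and_finsum_le (H : IsGeneric h) {k : ZMod 6} {S : Set (CurvePoint h)}
    {n : ℕ} (hS : ∀ p ∈ S, p.IsPlusI k)
    (hn : ∀ B : Finset (CurvePoint h), (B : Set (CurvePoint h)) ⊆ S →
      (∀ p ∈ B, p.v (MvPolynomial.X k) ≠ ⊤) ∧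
        ∑ p ∈ B, iord p.v (MvPolynomial.X k : MvPolynomial (ZMod 6) ℂ) ≤ n) :
    S.Finite ∧ ∑ᶠ p ∈ S, p.connectionNumber k 3 ≤ (n : ℤ) := by
  have hpos : ∀ p ∈ S, p.v (MvPolynomial.X k) ≠ ⊤ →
      1 ≤ iord p.v (MvPolynomial.X k : MvPolynomial (ZMod 6) ℂ) := fun p hp hf => by
    have h1 := hS p hp
    rw [CurvePoint.IsPlusI, ← coe_iord hf] at h1
    have : 0 < iord p.v (MvPolynomial.X k : MvPolynomial (ZMod 6) ℂ) := by exact_mod_cast h1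
    exact this
  -- Each place contributes at least one to a sum bounded by `n`, so `n + 1` places are impossible.
  have hfin : S.Finite := by
    by_contra hinf
    obtain ⟨B, hB, hcard⟩ := Set.Infinite.exists_subset_card_eq hinf (n + 1)
    obtain ⟨h1, h2⟩ := hn B hB
    have h3 := Finset.sum_le_sum fun p hp => hpos p (hB hp) (h1 p hp)
    rw [Finset.sum_const, hcard, nsmul_one] at h3
    push_cast at h3
    linarith
  refine ⟨hfin, ?_⟩
  rw [finsum_mem_eq_finite_toFinset_sum _ hfin]
  obtain ⟨h1, h2⟩ := hn hfin.toFinset (by rw [hfin.coe_toFinset])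
  refine (Finset.sum_le_sum fun p hp => ?_).trans h2
  exact p.connectionNumber_le H (hS p (hfin.mem_toFinset.mp hp)).le (h1 p hp)

theorem IsGeneric.finite_and_finsum_le_natDegree (H : IsGeneric h) (hdim : mobility h = 1)
    {k : ZMod 6} (s : ZMod 6 → Bool) (hs : s k = false) {S : Set (CurvePoint h)}
    (hS : ∀ p ∈ S, p.IsPlusI k)
    (hS3 : ∀ p ∈ S, if s (k + 3) then p.IsMinusI (k + 3) else p.IsPlusI (k + 3)) :
    S.Finite ∧ ∑ᶠ p ∈ S, p.connectionNumber k 3 ≤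
      ((commonPoly (Linkage.signed s h) k).natDegree : ℤ) := by
  refine H.finite_and_finsum_le hS fun B hB => ?_
  obtain ⟨h1, h2⟩ := H.sum_iord_le hdim k s hs (Subtype.val : {p // p ∈ B} → CurvePoint h)
    Subtype.val_injective (fun i => hS i (hB i.2)) (fun i => hS3 i (hB i.2))
  refine ⟨fun p hp => h1 ⟨p, hp⟩, ?_⟩
  rwa [← Finset.sum_coe_sort]

/-- The bounds for the numbers of bonds. -/
theorem IsGeneric.bonds_le (H : IsGeneric h) (hdim : mobility h = 1) (k : ZMod 6) :
    ((bondsPlus h k).Finite ∧ ∑ᶠ p ∈ bondsPlus h k, p.connectionNumber k 3 ≤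
      ((EuclideanDomain.gcd (invQuadPlus h k) (invQuadPlus h (k + 3))).natDegree : ℤ)) ∧
    (bondsMinus h k).Finite ∧ ∑ᶠ p ∈ bondsMinus h k, p.connectionNumber k 3 ≤
      ((EuclideanDomain.gcd (invQuadMinus h k) (invQuadMinus h (k + 3))).natDegree : ℤ) := by
  constructor
  · have e : Linkage.signed (fun _ => false) h = h := by funext i; rfl
    have := H.finite_and_finsum_le_natDegree hdim (k := k) (fun _ => false) rfl
      (S := bondsPlus h k) (fun p hp => hp.2.2.1) (fun p hp => hp.2.2.2)
    rwa [e] at this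
  · have e : commonPoly (Linkage.signed oddIdx h) k =
        EuclideanDomain.gcd (invQuadMinus h k) (invQuadMinus h (k + 3)) := by
      rw [commonPoly, invQuadMinus, invQuadMinus, flipOdd_eq]
    have odd3 : ∀ k : ZMod 6, oddIdx (k + 3) = !oddIdx k := by decide
    rw [← e]
    -- The reversal must leave `h k` alone to keep t_k = +i. For odd `k` the complementary reversal
    -- is used; its gcd has the same degree by complex conjugation.
    cases hk : oddIdx k with
    | false =>
      exact H.finite_and_finsum_le_natDegree hdim oddIdx hk (S := bondsMinus h k)
        (fun p hp => hp.2.2.1) (fun p hp => by rw [odd3, hk]; exact hp.2.2.2)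
    | true =>
      rw [← H.natDegree_commonPoly_signed_not]
      exact H.finite_and_finsum_le_natDegree hdim (fun i => !oddIdx i) (by rw [hk]; rfl)
        (S := bondsMinus h k) (fun p hp => hp.2.2.1)
        (fun p hp => by rw [odd3, hk]; exact hp.2.2.2)

end Linkage

end

theorem mainTheorem4 (h : ZMod 6 → Linkage.DQ ℝ) (hL : Linkage.IsLinkage h)
    (hpar : ∀ i, ¬ Linkage.Parallel (h i) (h (i + 1)))
    (hdim : ∀ i, Module.finrank ℝ (Linkage.couplingSpace (h i) (h (i + 1)) (h (i + 2))) = 8) :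
    -- bounds for the number of bonds
    (Linkage.mobility h = 1 → ∀ k : ZMod 6,
      (Linkage.bondsPlus h k).Finite ∧
      ∑ᶠ p ∈ Linkage.bondsPlus h k, p.connectionNumber k 3 ≤
        ((EuclideanDomain.gcd (Linkage.invQuadPlus h k)
          (Linkage.invQuadPlus h (k + 3))).natDegree : ℤ) ∧
      (Linkage.bondsMinus h k).Finite ∧
      ∑ᶠ p ∈ Linkage.bondsMinus h k, p.connectionNumber k 3 ≤
        ((EuclideanDomain.gcd (Linkage.invQuadMinus h k)
          (Linkage.invQuadMinus h (k + 3))).natDegree : ℤ)) ∧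
    -- invariance under motion, with any link as base
    (∀ r ∈ Linkage.configSet h, ∀ b k : ZMod 6,
      Linkage.invQuadPlus (Linkage.moved h r b) k = Linkage.invQuadPlus h k ∧
      Linkage.invQuadMinus (Linkage.moved h r b) k = Linkage.invQuadMinus h k) ∧
    -- explicit formulas
    (∀ k : ZMod 6,
      Linkage.invQuadPlus h k =
        Linkage.quadFormula (Linkage.paramB h) (Linkage.paramC h) (Linkage.paramS h) k ∧
      Linkage.invQuadMinus h k =
        Linkage.quadFormula (fun j => -Linkage.paramB h j) (fun j => -Linkage.paramC h j)
          (fun j => (-1) ^ j.val * Linkage.paramS h j) k) := by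
  have H : Linkage.IsGeneric h := ⟨hL.sq_eq, hpar, hdim⟩
  refine ⟨fun hm k => ?_, fun r hr b k => H.invQuad_moved hr b k,
    fun k => ⟨H.invQuadPlus_eq k, H.invQuadMinus_eq k⟩⟩
  obtain ⟨⟨h1, h2⟩, h3, h4⟩ := H.bonds_le hm k
  exact ⟨h1, h2, h3, h4⟩
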